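/- Let $M$ be a compact smooth manifold without boundary of dimension $2n+1$. A contact form is a smooth one-form $\lambda$ on $M$ such that $\lambda\wedge(d\lambda)^n$ vanishes nowhere; $R_\lambda$ denotes its Reeb vector field ($R_\lambda\rfloor d\lambda=0$, $\lambda(R_\lambda)=1$), $\mu_\lambda=\lambda\wedge(d\lambda)^n$ its volume form, with the same symbol for the induced measure, and $\operatorname{vol}(\lambda)=\int_M d\mu_\lambda$. The contact form $\lambda$ is non-projectible if the only $H\in C^\infty(M)$ with $R_\lambda[H]=0$ and $\int_M H\,d\mu_\lambda=0$ is $H=0$. A strict contact pair is a pair $(\lambda,\psi)$ of a contact form and a diffeomorphism of $M$ with $\psi^*\lambda=\lambda$. For a one-form $\beta$ put $\beta^{\pi_\lambda}=\beta-\beta(R_\lambda)\lambda$. For $V>0$ let $\mathfrak{C}_V(M)$ be the set of contact forms of volume $V$ (so $\mathfrak{C}_1(M)$ is the set of volume-normalized contact forms), let $\mathfrak{Diff}_V(M,\mu)$ be the set of pairs $(\lambda,\psi)$ with $\lambda\in\mathfrak{C}_V(M)$, $\psi\in\operatorname{Diff}(M)$, $\psi^*\mu_\lambda=\mu_\lambda$,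 let $\mathfrak{Cont}^{\rm st}_V(M)\subset\mathfrak{Diff}_V(M,\mu)$ be the set of strict contact pairs in it, let $\Phi(\lambda,\psi)=(\psi^*\lambda)^{\pi_\lambda}$ on $\mathfrak{Diff}_V(M,\mu)$, and let $\Pi:\mathfrak{Cont}^{\rm st}_V(M)\to\mathfrak{C}_V(M)$, $\Pi(\lambda,\psi)=\lambda$. A tangent vector at $(\lambda,\psi)$ is the velocity $(\alpha,X)$ at $t=0$ of a smooth curve $(\lambda_t,\psi_t)$, $|t|<\delta$, in the set in question with $(\lambda_0,\psi_0)=(\lambda,\psi)$, where $\alpha=\frac{d}{dt}\big|_{0}\lambda_t$ is a one-form and the vector field $X$ on $M$ is given by $\frac{d}{dt}\big|_{0}\psi_t=X\circ\psi$; $\ker D\Phi(\lambda,\psi)$ is the set of tangent vectors of $\mathfrak{Diff}_V(M,\mu)$ along which $\Phi$ has derivative $0$. The derivative $d\Pi(\lambda,\psi)$ is $(\alpha,X)\mapsto\alpha$. Let $\lambda$ be non-projectible, $V=\operatorname{vol}(\lambda)$, and let $(\lambda,\psi)$ be any strict contact pair. Then $$\ker d\Pi(\lambda,\psi)=\{(0,cR_\lambda)\mid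 c\in\mathbb{R}\},$$ both when the tangent space of the set of strict contact pairs at $(\lambda,\psi)$ is taken to be the set $T_{(\lambda,\psi)}\mathfrak{Cont}^{\rm st}_V(M)$ of velocities of curves of strict contact pairs, and when it is taken to be $\ker D\Phi(\lambda,\psi)$. Moreover, let $\mathfrak{A}=\{(U_a,\varphi_a)\}$ be a finite atlas of Darboux charts of $\lambda$ with image $(-1,1)^{2n+1}$, in which $\lambda=dz-\sum_i p_i\,dq_i$, and let $\varepsilon=(\varepsilon_k)_{k\ge0}$ be a sequence of positive numbers. Say that $(\alpha,X)$ is of class $C^{(1,\varepsilon)}$ if the expressions $f$ of $\alpha$ and of $X$ in each chart of $\mathfrak{A}$ satisfy $\sum_k\varepsilon_k\|D^kf\|_{C^0}<\infty$ and $\sum_k\varepsilon_k\|D^{k+1}f\|_{C^0}<\infty$, where $\|D^kf\|_{C^0}$ is the supremum over $(-1,1)^{2n+1}$ of all partial derivatives of order $k$. Then the kernel of the restriction of $d\Pi(\lambda,\psi)$ to the tangent vectors of class $C^{(1,\varepsilon)}$, for either tangent space, is again $\{(0,cR_\lambda)\mid c\in\mathbb{R}\}$. -/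

import Mathlib

open scoped Manifold ContDiff Topology
open MeasureTheory Set

noncomputable section

namespace StrictContact

/-- The model space `ℝ^(2n+1)`. -/
abbrev Model (n : ℕ) : Type := EuclideanSpace ℝ (Fin (2 * n + 1))

/-- One-forms on `M`, not necessarily smooth. -/
abbrev OneForm (n : ℕ) (M : Type*) [TopologicalSpace M] [ChartedSpace (Model n) M] : Type _ :=
  (x : M) → TangentSpace (𝓡 (2 * n + 1)) x →L[ℝ] ℝ

/-- Vector fields on `M`, not necessarily smooth. -/
abbrev VField (n : ℕ) (M : Type*) [TopologicalSpace M] [ChartedSpace (Model n) M] : Type _ :=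
  (x : M) → TangentSpace (𝓡 (2 * n + 1)) x

/-- Smooth diffeomorphisms of `M`. -/
abbrev Diffeo (n : ℕ) (M : Type*) [TopologicalSpace M] [ChartedSpace (Model n) M] : Type _ :=
  Diffeomorph (𝓡 (2 * n + 1)) (𝓡 (2 * n + 1)) M M ∞

section Forms

variable {n : ℕ} {M : Type*} [TopologicalSpace M] [ChartedSpace (Model n) M]
  [IsManifold (𝓡 (2 * n + 1)) ∞ M]

/-- The point `α x` of the cotangent bundle of `M`. -/
def OneForm.toCotangent (α : OneForm n M) (x : M) :
    Bundle.TotalSpace (Model n →L[ℝ] ℝ)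
      (fun y : M => TangentSpace (𝓡 (2 * n + 1)) y →L[ℝ] Bundle.Trivial M ℝ y) :=
  ⟨x, α x⟩

/-- A one-form is smooth if it is a smooth section of the cotangent bundle. -/
def OneForm.IsSmooth (α : OneForm n M) : Prop :=
  ContMDiff (𝓡 (2 * n + 1)) ((𝓡 (2 * n + 1)).prod 𝓘(ℝ, Model n →L[ℝ] ℝ)) ∞ α.toCotangent

/-- The coordinate expression, in the chart `e`, of the one-form `α`:
the pull-back of `α` under `e⁻¹`. -/
def OneForm.inChart (α : OneForm n M) (e : OpenPartialHomeomorph M (Model n)) (y : Model n) :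
    Model n →L[ℝ] ℝ :=
  (α (e.symm y)).comp (mfderiv (𝓡 (2 * n + 1)) (𝓡 (2 * n + 1)) e.symm y)

/-- The coordinate expression, in the chart `e`, of the vector field `X`:
the push-forward of `X` under `e`. -/
def VField.inChart (X : VField n M) (e : OpenPartialHomeomorph M (Model n)) (y : Model n) :
    Model n :=
  mfderiv (𝓡 (2 * n + 1)) (𝓡 (2 * n + 1)) e (e.symm y) (X (e.symm y))

/-- The exterior derivative `dα` at `x`, evaluated on `v` and `w`. It is computed in the preferred
chart at `x`, where `dα(v, w) = D_v α(w) - D_w α(v)`. -/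
def OneForm.d (α : OneForm n M) (x : M) (v w : TangentSpace (𝓡 (2 * n + 1)) x) : ℝ :=
  let e := chartAt (Model n) x
  let v' : Model n := mfderiv (𝓡 (2 * n + 1)) (𝓡 (2 * n + 1)) e x v
  let w' : Model n := mfderiv (𝓡 (2 * n + 1)) (𝓡 (2 * n + 1)) e x w
  fderiv ℝ (α.inChart e) (e x) v' w' - fderiv ℝ (α.inChart e) (e x) w' v'

/-- The top degree form `μ_α = α ∧ (dα)^n` at `x`, evaluated on `v 0, …, v (2n)`. -/
def OneForm.volForm (α : OneForm n M) (x : M)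
    (v : Fin (2 * n + 1) → TangentSpace (𝓡 (2 * n + 1)) x) : ℝ :=
  (1 / 2 ^ n : ℝ) * ∑ σ : Equiv.Perm (Fin (2 * n + 1)),
    ((Equiv.Perm.sign σ : ℤ) : ℝ) * α x (v (σ 0)) *
      ∏ i : Fin n, α.d x (v (σ ⟨2 * (i : ℕ) + 1, by omega⟩)) (v (σ ⟨2 * (i : ℕ) + 2, by omega⟩))

/-- Contact forms: smooth one-forms `lam` for which `lam ∧ (d lam)^n` vanishes nowhere. -/
def IsContactForm (lam : OneForm n M) : Prop :=
  lam.IsSmooth ∧ ∀ x : M, ∃ v : Fin (2 * n + 1) → TangentSpace (𝓡 (2 * n + 1)) x,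
    lam.volForm x v ≠ 0

open Classical in
/-- The Reeb vector field of a contact form: at every point, the unique vector `R` with
`lam(R) = 1` and `d lam(R, ·) = 0` (and `0` where there is no such vector, which does not happen
for a contact form). -/
def reeb (lam : OneForm n M) : VField n M := fun x =>
  if h : ∃ R : TangentSpace (𝓡 (2 * n + 1)) x, lam x R = 1 ∧ ∀ w, lam.d x R w = 0
  then h.choose else 0

/-- The component `α^π = α - α(R) lam` of `α` in the decomposition `α = α^π + α(R) lam`, where `R`
is the Reeb vector field of `lam`. -/
def projPi (lam α : OneForm n M) : OneForm n M :=
  fun x => α x - (α x (reeb lam x)) • lam x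

/-- The pull-back `ψ^* α`. -/
def pullback (ψ : Diffeo n M) (α : OneForm n M) : OneForm n M :=
  fun x => (α (ψ x)).comp (mfderiv (𝓡 (2 * n + 1)) (𝓡 (2 * n + 1)) ψ x)

/-- `(lam, ψ)` is a strict contact pair: `lam` is a contact form and `ψ^* lam = lam`. -/
def IsStrictContactPair (lam : OneForm n M) (ψ : Diffeo n M) : Prop :=
  IsContactForm lam ∧ pullback ψ lam = lam

/-- `ψ` is `lam`-incompressible: `ψ^* μ = μ` for the volume form `μ = lam ∧ (d lam)^n`. -/
def IsIncompressible (lam : OneForm n M) (ψ : Diffeo n M) : Prop :=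
  ∀ (x : M) (v : Fin (2 * n + 1) → TangentSpace (𝓡 (2 * n + 1)) x),
    lam.volForm (ψ x) (fun i => mfderiv (𝓡 (2 * n + 1)) (𝓡 (2 * n + 1)) ψ x (v i))
      = lam.volForm x v

/-- The map `Φ(lam, ψ) = (ψ^* lam)^π`, the projection being the one of `lam`. -/
def Phi (lam : OneForm n M) (ψ : Diffeo n M) : OneForm n M :=
  projPi lam (pullback ψ lam)

end Forms

section Measure

variable {n : ℕ} {M : Type*} [TopologicalSpace M] [ChartedSpace (Model n) M]
  [IsManifold (𝓡 (2 * n + 1)) ∞ M] [MeasurableSpace M]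

/-- The measure that `|lam ∧ (d lam)^n|` defines on the domain of the chart `e`: in coordinates it
is `|(lam ∧ (d lam)^n)(∂_0, …, ∂_{2n})|` times Lebesgue measure. -/
def chartMeasure (lam : OneForm n M) (e : OpenPartialHomeomorph M (Model n)) : Measure M :=
  ((volume.restrict e.target).withDensity (fun y => ENNReal.ofReal
    |lam.volForm (e.symm y) (fun i => mfderiv (𝓡 (2 * n + 1)) (𝓡 (2 * n + 1)) e.symm y
      (EuclideanSpace.single i (1 : ℝ)))|)).map e.symm

/-- The measure `μ_lam` on `M` induced by the volume form `lam ∧ (d lam)^n`. The measures of the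
charts agree on overlaps, and `μ_lam` is the smallest measure that dominates them all, that is,
the one that restricts to each of them. -/
def contactMeasure (lam : OneForm n M) : Measure M :=
  ⨆ e ∈ IsManifold.maximalAtlas (𝓡 (2 * n + 1)) ∞ M, chartMeasure lam e

/-- Non-projectible contact forms: the only smooth function `H` with `R[H] = 0` and
`∫ H dμ_lam = 0` is `H = 0`, where `R` is the Reeb vector field of `lam`. -/
def IsNonProjectible (lam : OneForm n M) : Prop :=
  IsContactForm lam ∧
    ∀ H : M → ℝ, ContMDiff (𝓡 (2 * n + 1)) 𝓘(ℝ, ℝ) ∞ H →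
      (∀ x, mfderiv (𝓡 (2 * n + 1)) 𝓘(ℝ, ℝ) H x (reeb lam x) = 0) →
      ∫ x, H x ∂(contactMeasure lam) = 0 → H = 0

/-- The contact forms of volume `V`. The volume-normalized contact forms are those
with `V = 1`. -/
def contactForms (n : ℕ) (M : Type*) [TopologicalSpace M] [ChartedSpace (Model n) M]
    [IsManifold (𝓡 (2 * n + 1)) ∞ M] [MeasurableSpace M] (V : ENNReal) : Set (OneForm n M) :=
  {lam | IsContactForm lam ∧ contactMeasure lam univ = V}

/-- The pairs `(lam, ψ)` of a contact form of volume `V` and a `lam`-incompressible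
diffeomorphism. -/
def incompressiblePairs (n : ℕ) (M : Type*) [TopologicalSpace M] [ChartedSpace (Model n) M]
    [IsManifold (𝓡 (2 * n + 1)) ∞ M] [MeasurableSpace M] (V : ENNReal) :
    Set (OneForm n M × Diffeo n M) :=
  {p | p.1 ∈ contactForms n M V ∧ IsIncompressible p.1 p.2}

/-- The strict contact pairs `(lam, ψ)` with `lam` of volume `V`. -/
def strictContactPairs (n : ℕ) (M : Type*) [TopologicalSpace M] [ChartedSpace (Model n) M]
    [IsManifold (𝓡 (2 * n + 1)) ∞ M] [MeasurableSpace M] (V : ENNReal) :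
    Set (OneForm n M × Diffeo n M) :=
  {p | p.1 ∈ contactForms n M V ∧ IsStrictContactPair p.1 p.2}

end Measure

section Tangent

variable {n : ℕ} {M : Type*} [TopologicalSpace M] [ChartedSpace (Model n) M]
  [IsManifold (𝓡 (2 * n + 1)) ∞ M]

/-- `(γ t)`, `-δ < t < δ`, is a smooth curve of pairs (one-form, diffeomorphism): both components
are jointly smooth in the parameter and the point of `M`. -/
structure IsSmoothCurve (δ : ℝ) (γ : ℝ → OneForm n M × Diffeo n M) : Prop where
  form : ContMDiffOn (𝓘(ℝ, ℝ).prod (𝓡 (2 * n + 1)))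
    ((𝓡 (2 * n + 1)).prod 𝓘(ℝ, Model n →L[ℝ] ℝ)) ∞
    (fun p : ℝ × M => (γ p.1).1.toCotangent p.2) (Ioo (-δ) δ ×ˢ univ)
  diffeo : ContMDiffOn (𝓘(ℝ, ℝ).prod (𝓡 (2 * n + 1))) (𝓡 (2 * n + 1)) ∞
    (fun p : ℝ × M => (γ p.1).2 p.2) (Ioo (-δ) δ ×ˢ univ)

/-- The curve `γ t = (lam_t, ψ_t)` has velocity `(α, X)` at `t = 0`. Vector fields along `ψ_0` are
identified with vector fields on `M` by right translation, so that the second component means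
`d/dt ψ_t(x) = X(ψ_0(x))` at `t = 0`. -/
structure HasVelocity (γ : ℝ → OneForm n M × Diffeo n M) (α : OneForm n M) (X : VField n M) :
    Prop where
  form : ∀ (x : M) (v : TangentSpace (𝓡 (2 * n + 1)) x),
    HasDerivAt (fun t : ℝ => (γ t).1 x v) (α x v) 0
  diffeo : ∀ x : M, HasMFDerivAt 𝓘(ℝ, ℝ) (𝓡 (2 * n + 1)) (fun t : ℝ => (γ t).2 x) 0
    ((1 : ℝ →L[ℝ] ℝ).smulRight (X ((γ 0).2 x)))

/-- The tangent vectors at `p` of a set `S` of pairs (one-form, diffeomorphism): the velocities at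
`t = 0` of the germs of smooth curves in `S` with `γ 0 = p`. -/
def tangentVectors (S : Set (OneForm n M × Diffeo n M)) (p : OneForm n M × Diffeo n M) :
    Set (OneForm n M × VField n M) :=
  {u | ∃ (δ : ℝ) (γ : ℝ → OneForm n M × Diffeo n M), 0 < δ ∧ IsSmoothCurve δ γ ∧ γ 0 = p ∧
    (∀ t ∈ Ioo (-δ) δ, γ t ∈ S) ∧ HasVelocity γ u.1 u.2}

variable [MeasurableSpace M]

/-- The tangent space at `(lam, ψ)` of the set of strict contact pairs (whose forms have
the volume of `lam`). -/
def tangentStrict (lam : OneForm n M) (ψ : Diffeo n M) : Set (OneForm n M × VField n M) :=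
  tangentVectors (strictContactPairs n M (contactMeasure lam univ)) (lam, ψ)

/-- The kernel of the derivative `DΦ(lam, ψ)`, where `Φ` is defined on the set of incompressible
pairs (whose forms have the volume of `lam`): the velocities of the curves `(lam_t, ψ_t)` in that
set, starting at `(lam, ψ)`, along which `Φ(lam_t, ψ_t)` has derivative `0` at `t = 0`. -/
def kerDPhi (lam : OneForm n M) (ψ : Diffeo n M) : Set (OneForm n M × VField n M) :=
  {u | ∃ (δ : ℝ) (γ : ℝ → OneForm n M × Diffeo n M), 0 < δ ∧ IsSmoothCurve δ γ ∧
    γ 0 = (lam, ψ) ∧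
    (∀ t ∈ Ioo (-δ) δ, γ t ∈ incompressiblePairs n M (contactMeasure lam univ)) ∧
    HasVelocity γ u.1 u.2 ∧
    ∀ (x : M) (v : TangentSpace (𝓡 (2 * n + 1)) x),
      HasDerivAt (fun t : ℝ => Phi (γ t).1 (γ t).2 x v) 0 0}

/-- The derivative `dΠ : (α, X) ↦ α` of the projection `Π(lam, ψ) = lam`. -/
def dPi (u : OneForm n M × VField n M) : OneForm n M := u.1

/-- The kernel of the restriction of `dΠ` to the set `T` of tangent vectors. -/
def kerDPi (T : Set (OneForm n M × VField n M)) : Set (OneForm n M × VField n M) :=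
  {u ∈ T | dPi u = 0}

/-- The infinitesimal Reeb flows: the pairs `(0, c R)`, `c ∈ ℝ`, where `R` is the Reeb vector
field of `lam`. -/
def reebPairs (lam : OneForm n M) : Set (OneForm n M × VField n M) :=
  {u | ∃ c : ℝ, u = (0, fun x => c • reeb lam x)}

end Tangent

section FloerNorm

variable {n : ℕ} {M : Type*} [TopologicalSpace M] [ChartedSpace (Model n) M]
  [IsManifold (𝓡 (2 * n + 1)) ∞ M]

/-- The open cube `(-1, 1)^(2n+1)`. -/
def cube (n : ℕ) : Set (Model n) := {y | ∀ i, y i ∈ Ioo (-1 : ℝ) 1}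

/-- `e` is a Darboux chart of `lam` with image `(-1, 1)^(2n+1)`. With coordinates
`(q_1, …, q_n, p_1, …, p_n, z)`, the form is `lam = dz - ∑ p_i dq_i`. -/
structure IsDarbouxChart (lam : OneForm n M) (e : OpenPartialHomeomorph M (Model n)) :
    Prop where
  smooth : e ∈ IsManifold.maximalAtlas (𝓡 (2 * n + 1)) ∞ M
  target : e.target = cube n
  form : ∀ y ∈ cube n, ∀ w : Model n, lam.inChart e y w =
    w (Fin.last (2 * n)) -
      ∑ i : Fin n, y ⟨n + (i : ℕ), by omega⟩ * w ⟨(i : ℕ), by omega⟩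

/-- A finite atlas of Darboux charts of `lam`. -/
structure IsDarbouxAtlas (lam : OneForm n M) (A : Finset (OpenPartialHomeomorph M (Model n))) :
    Prop where
  chart : ∀ e ∈ A, IsDarbouxChart lam e
  cover : ∀ x : M, ∃ e ∈ A, x ∈ e.source

/-- `‖D^k g‖_{C^0}` on the cube: the supremum over the cube of all partial derivatives
of order `k`. -/
def normD {F : Type*} [NormedAddCommGroup F] [NormedSpace ℝ F] (k : ℕ) (g : Model n → F) :
    ENNReal :=
  ⨆ y ∈ cube n, ⨆ i : Fin k → Fin (2 * n + 1),
    ‖iteratedFDeriv ℝ k g y (fun j => EuclideanSpace.single (i j) (1 : ℝ))‖ₑ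

/-- `g` and `Dg` have finite `C^ε`-norm on the cube, where `‖g‖_ε = ∑ ε_k ‖D^k g‖_{C^0}`. -/
def FiniteC1Eps {F : Type*} [NormedAddCommGroup F] [NormedSpace ℝ F] (ε : ℕ → ℝ)
    (g : Model n → F) : Prop :=
  ∑' k, ENNReal.ofReal (ε k) * normD k g < ⊤ ∧ ∑' k, ENNReal.ofReal (ε k) * normD (k + 1) g < ⊤

/-- The pairs `(α, X)` of a one-form and a vector field whose coordinate expressions in the charts
of the atlas `A` have finite `C^(1,ε)`-norm. -/
def c1epsPairs (A : Finset (OpenPartialHomeomorph M (Model n))) (ε : ℕ → ℝ) :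
    Set (OneForm n M × VField n M) :=
  {u | ∀ e ∈ A, FiniteC1Eps ε (u.1.inChart e) ∧ FiniteC1Eps ε (VField.inChart u.2 e)}

end FloerNorm

end StrictContact

end

/-! Let `(λ_t, ψ_t)` be a curve in the incompressible pairs through `(λ, ψ)` with velocity `(0, X)`
along which `Φ` is stationary. The family `χ_t = ψ_t ∘ ψ⁻¹` starts at the identity with velocity
`X`, and Cartan's formula (`IsSmoothCurve.hasDerivAt_pullback`) gives `X ⌟ dλ + dH`, with `H =
λ(X)`, for the derivative of `χ_t^* λ_t` at `t = 0`. Stationarity of `Φ` makes this one-form a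
pointwise multiple `h λ` (`exists_smul_of_hasDerivAt_Phi`). A family of forms with velocity `h λ`
changes the volume form at the rate `(n + 1) h μ` (`IsContactForm.hasDerivAt_volForm`).
Incompressibility says that `ψ_t^* μ_{λ_t} = μ_{λ_t}`, and the right side is stationary because `α =
0`; hence `h = 0` and `X ⌟ dλ + dH = 0`. Inserting the Reeb field gives `R[H] = 0`.
Non-projectibility, applied to `H` minus its mean, makes `H` a constant `c`. Then `λ(X) = c` and `X
⌟ dλ = 0`, which characterize `X = c R`. This is `mem_reebPairs_of_mem_kerDPhi`. The mean exists
because `contactMeasure` is finite on a compact manifold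
(`OneForm.IsSmooth.isFiniteMeasure_contactMeasure`). Conversely, the flow of `c R` preserves `λ`, so
composing it with `ψ` gives a curve of strict contact pairs with velocity `(0, c R)`
(`reebPairs_subset_tangentStrict`). This needs the flow of a smooth vector field on a compact
manifold as a smooth curve of diffeomorphisms. It is built from smooth dependence on initial values
in vector spaces (`IsFlow.contDiffOn`), proved by induction through the tangent system, and from
local flow boxes. Strict pairs are incompressible and satisfy `Φ = 0`, so `tangentStrict` lies in
`kerDPhi`. In Darboux charts the Reeb field is the constant field `∂_z`, so the pairs `(0, c R)` are
of class `C^(1,ε)`. All four tangent spaces therefore lie between `reebPairs` and `kerDPhi`, and one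
argument treats them together. -/

noncomputable section

namespace StrictContact

set_option linter.unusedSectionVars false

/-! ### Flows on vector spaces and smooth dependence on initial values -/

section Flow

variable {E : Type*} [NormedAddCommGroup E] [NormedSpace ℝ E]

/-- Grönwall's inequality on an interval that is symmetric about the initial time. -/
theorem exists_gronwall_const (K : ℝ) {T : ℝ} (hT : 0 ≤ T) : ∃ C : ℝ, 0 ≤ C ∧
    ∀ (u u' : ℝ → E) (ε : ℝ), 0 ≤ ε →
      (∀ t ∈ Icc (-T) T, HasDerivWithinAt u (u' t) (Icc (-T) T) t) →
      (∀ t ∈ Icc (-T) T, ‖u' t‖ ≤ K * ‖u t‖ + ε) →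
      ∀ t ∈ Icc (-T) T, ‖u t‖ ≤ C * (‖u 0‖ + ε) := by
  -- A constant that is at least `1` avoids the degenerate case of the Grönwall bound and gives `ε /
  -- K' ≤ ε`.
  set K' : ℝ := |K| + 1 with hK'
  have hK1 : 1 ≤ K' := by have := abs_nonneg K; linarith
  have key : ∀ (u u' : ℝ → E) (ε : ℝ), 0 ≤ ε →
      (∀ t ∈ Icc (-T) T, HasDerivWithinAt u (u' t) (Icc (-T) T) t) →
      (∀ t ∈ Icc (-T) T, ‖u' t‖ ≤ K * ‖u t‖ + ε) →
      ∀ t ∈ Icc 0 T, ‖u t‖ ≤ Real.exp (K' * T) * (‖u 0‖ + ε) := by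
    intro u u' ε hε hu hb t ht
    have h := norm_le_gronwallBound_of_norm_deriv_right_le (f := u) (f' := u') (δ := ‖u 0‖)
      (K := K') (ε := ε) (a := 0) (b := T)
      (fun s hs => ((hu s ⟨by linarith [hs.1], hs.2⟩).continuousWithinAt).mono
        (Icc_subset_Icc (by linarith) le_rfl))
      (fun s hs => by
        have h1 := hu s ⟨by linarith [hs.1], hs.2.le⟩
        refine (h1.mono_of_mem_nhdsWithin ?_)
        refine Filter.mem_of_superset (Icc_mem_nhdsGE hs.2)
          (Icc_subset_Icc (by linarith [hs.1]) le_rfl))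
      le_rfl
      (fun s hs => (hb s ⟨by linarith [hs.1], hs.2.le⟩).trans (by
        have : K ≤ K' := by have := le_abs_self K; linarith
        gcongr)) t ht
    refine h.trans ?_
    rw [gronwallBound_of_K_ne_0 (by linarith), sub_zero]
    have h1 : Real.exp (K' * t) ≤ Real.exp (K' * T) := by
      apply Real.exp_le_exp.2; have := ht.2; gcongr
    have h2 : ε / K' ≤ ε := div_le_self hε hK1
    have h3 : 1 ≤ Real.exp (K' * t) := Real.one_le_exp (by have := ht.1; positivity)
    have h4 : ε / K' * (Real.exp (K' * t) - 1) ≤ ε * Real.exp (K' * T) :=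
      mul_le_mul h2 (by linarith) (by linarith) hε
    nlinarith [norm_nonneg (u 0)]
  refine ⟨Real.exp (K' * T), (Real.exp_pos _).le, fun u u' ε hε hu hb t ht => ?_⟩
  rcases le_total 0 t with h0 | h0
  · exact key u u' ε hε hu hb t ⟨h0, ht.2⟩
  -- Negative times reduce to positive ones by reversing time.
  · have hm : MapsTo (fun s : ℝ => -s) (Icc (-T) T) (Icc (-T) T) :=
      fun s hs => ⟨by linarith [hs.2], by linarith [hs.1]⟩
    have h := key (fun s => u (-s)) (fun s => -u' (-s)) ε hε
      (fun s hs => by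
        have h1 := (hu (-s) (hm hs)).scomp s (hasDerivWithinAt_id s _).neg hm
        simpa [Function.comp_def] using h1)
      (fun s hs => by simpa using hb (-s) (hm hs)) (-t) ⟨by linarith, by linarith [ht.1]⟩
    simpa using h

/-- Two solutions of an autonomous equation that have the same initial value and stay in a set on
which the vector field is Lipschitz are equal. -/
theorem eqOn_of_hasDerivWithinAt_of_lipschitzOnWith {f : E → E} {s : Set E} {K : NNReal}
    (hf : LipschitzOnWith K f s) {T : ℝ} (hT : 0 ≤ T) {a b : ℝ → E}
    (ha : ∀ t ∈ Icc (-T) T, HasDerivWithinAt a (f (a t)) (Icc (-T) T) t)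
    (hb : ∀ t ∈ Icc (-T) T, HasDerivWithinAt b (f (b t)) (Icc (-T) T) t)
    (has : ∀ t ∈ Icc (-T) T, a t ∈ s) (hbs : ∀ t ∈ Icc (-T) T, b t ∈ s) (h0 : a 0 = b 0) :
    ∀ t ∈ Icc (-T) T, a t = b t := by
  obtain ⟨C, -, h⟩ := exists_gronwall_const (E := E) K hT
  intro t ht
  have := h (fun t => a t - b t) (fun t => f (a t) - f (b t)) 0 le_rfl
    (fun t ht => (ha t ht).sub (hb t ht))
    (fun t ht => by simpa using hf.norm_sub_le (has t ht) (hbs t ht)) t ht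
  simpa [h0, sub_eq_zero] using this

/-- `φ` is a flow of the vector field `f` on the time interval `[-T, T]`. -/
structure IsFlow (T : ℝ) (f : E → E) (φ : ℝ → E → E) : Prop where
  zero : ∀ x, φ 0 x = x
  deriv : ∀ x, ∀ t ∈ Icc (-T) T, HasDerivWithinAt (fun s => φ s x) (f (φ t x)) (Icc (-T) T) t

/-- A `C^1` vector field with compact support has a flow. -/
theorem exists_isFlow_of_hasCompactSupport [CompleteSpace E] {f : E → E} (hf : ContDiff ℝ 1 f)
    (hs : HasCompactSupport f) {T : ℝ} (hT : 0 ≤ T) : ∃ φ : ℝ → E → E, IsFlow T f φ := by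
  obtain ⟨K, hK⟩ := hf.lipschitzWith_of_hasCompactSupport hs (by norm_num)
  obtain ⟨L, hL⟩ := hs.exists_bound_of_continuous hf.continuous
  have hL0 : 0 ≤ L := (norm_nonneg _).trans (hL 0)
  have key : ∀ x : E, ∃ α : ℝ → E, α 0 = x ∧
      ∀ t ∈ Icc (-T) T, HasDerivWithinAt α (f (α t)) (Icc (-T) T) t := by
    intro x
    -- A solution of speed at most `L` stays within `L * T` of its start. With this radius the whole
    -- interval is admissible, because the bounds on `f` are global.
    have hP : IsPicardLindelof (fun _ : ℝ => f) (⟨0, by constructor <;> linarith⟩ : Icc (-T) T) x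
        (⟨L * T, by positivity⟩) 0 ⟨L, hL0⟩ K :=
      IsPicardLindelof.of_time_independent (fun x _ => hL x) hK.lipschitzOnWith (by simp; rfl)
    simpa using hP.exists_eq_forall_mem_Icc_hasDerivWithinAt₀
  choose φ h0 h1 using key
  exact ⟨fun t x => φ x t, h0, h1⟩

theorem IsFlow.norm_le {T : ℝ} {f : E → E} {φ : ℝ → E → E} (h : IsFlow T f φ) (x : E) :
    ∃ R : ℝ, ∀ t ∈ Icc (-T) T, ‖φ t x‖ ≤ R :=
  isCompact_Icc.exists_bound_of_continuousOn
    (fun t ht => (h.deriv x t ht).continuousWithinAt)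

/-- The tangent system of a vector field: the equation of a solution and its variation. -/
def tangentSystem (f : E → E) (p : E × E) : E × E := (f p.1, fderiv ℝ f p.1 p.2)

theorem contDiff_tangentSystem {f : E → E} (hf : ContDiff ℝ ∞ f) :
    ContDiff ℝ ∞ (tangentSystem f) := by
  have h1 : ContDiff ℝ ∞ (fderiv ℝ f) := hf.fderiv_right (by simp)
  exact (hf.comp contDiff_fst).prodMk ((h1.comp contDiff_fst).clm_apply contDiff_snd)

theorem exists_norm_fderiv_le {f : E → E} (hf : ContDiff ℝ ∞ f) (hs : HasCompactSupport f) :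
    ∃ L : ℝ, 0 ≤ L ∧ ∀ x, ‖fderiv ℝ f x‖ ≤ L := by
  obtain ⟨L, hL⟩ := (hs.fderiv (𝕜 := ℝ)).exists_bound_of_continuous
    (hf.continuous_fderiv (by simp))
  exact ⟨L, (norm_nonneg _).trans (hL 0), hL⟩

/-- The first order Taylor estimate for a smooth map with compact support. -/
theorem exists_norm_sub_sub_fderiv_le {f : E → E} (hf : ContDiff ℝ ∞ f)
    (hs : HasCompactSupport f) :
    ∃ C : ℝ, 0 ≤ C ∧ ∀ x y, ‖f y - f x - fderiv ℝ f x (y - x)‖ ≤ C * ‖y - x‖ ^ 2 := by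
  have h1 : ContDiff ℝ 1 (fderiv ℝ f) :=
    (hf.fderiv_right (m := ∞) (by simp)).of_le (by simp)
  obtain ⟨K, hK⟩ := h1.lipschitzWith_of_hasCompactSupport (hs.fderiv (𝕜 := ℝ)) (by norm_num)
  refine ⟨K, K.2, fun x y => ?_⟩
  have := (convex_closedBall x ‖y - x‖).norm_image_sub_le_of_norm_hasFDerivWithin_le'
    (f := f) (f' := fderiv ℝ f) (φ := fderiv ℝ f x) (C := K * ‖y - x‖) (x := x) (y := y)
    (fun z _ => ((hf.differentiable (by simp)) z).hasFDerivAt.hasFDerivWithinAt)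
    (fun z hz => (hK.norm_sub_le _ _).trans (by
      rw [mem_closedBall_iff_norm] at hz; gcongr)) (by simp) (by simp [dist_eq_norm])
  rw [pow_two, ← mul_assoc]
  exact this

variable [FiniteDimensional ℝ E]

theorem exists_lipschitzOnWith_closedBall {f : E → E} (hf : ContDiff ℝ ∞ f) (R : ℝ) :
    ∃ K : NNReal, LipschitzOnWith K f (Metric.closedBall 0 R) := by
  have := FiniteDimensional.proper ℝ E
  obtain ⟨C, hC⟩ := (isCompact_closedBall (0 : E) R).exists_bound_of_continuousOn
    (hf.continuous_fderiv (by simp)).continuousOn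
  exact ⟨C.toNNReal, (convex_closedBall (0 : E) R).lipschitzOnWith_of_nnnorm_fderiv_le
    (fun x _ => (hf.differentiable (by simp)) x)
    (fun x hx => by rw [← NNReal.coe_le_coe, coe_nnnorm]
                    exact (hC x hx).trans (Real.le_coe_toNNReal C))⟩

/-- Cutting off a smooth vector field outside of a ball. -/
theorem exists_cutoff {f : E → E} (hf : ContDiff ℝ ∞ f) (R : ℝ) :
    ∃ g : E → E, ContDiff ℝ ∞ g ∧ HasCompactSupport g ∧ (∀ x ∈ Metric.closedBall 0 R, g x = f x) ∧
      ∀ x, ‖g x‖ ≤ ‖f x‖ := by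
  have := FiniteDimensional.proper ℝ E
  let b : ContDiffBump (0 : E) := ⟨|R| + 1, |R| + 2, by positivity, by linarith⟩
  refine ⟨fun x => b x • f x, b.contDiff.smul hf, b.hasCompactSupport.smul_right, fun x hx => ?_,
    fun x => ?_⟩
  · have : b x = 1 := b.one_of_mem_closedBall
      (Metric.closedBall_subset_closedBall (by change R ≤ |R| + 1; linarith [le_abs_self R]) hx)
    simp [this]
  · rw [norm_smul, Real.norm_of_nonneg b.nonneg]
    exact mul_le_of_le_one_left (norm_nonneg _) b.le_one

/-- Near a given initial value, a flow of a smooth vector field is a flow of a smooth vector field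
with compact support. -/
theorem IsFlow.exists_eventuallyEq_hasCompactSupport {T : ℝ} (hT : 0 ≤ T) {f : E → E}
    (hf : ContDiff ℝ ∞ f) {φ : ℝ → E → E} (h : IsFlow T f φ) (x₀ : E) :
    ∃ (g : E → E) (χ : ℝ → E → E), ContDiff ℝ ∞ g ∧ HasCompactSupport g ∧ IsFlow T g χ ∧
      ∀ᶠ x in 𝓝 x₀, ∀ t ∈ Icc (-T) T, φ t x = χ t x := by
  obtain ⟨R, hR⟩ := h.norm_le x₀
  -- The orbit of `x₀` stays in the ball of radius `R`. The margin `1` leaves room for the orbits of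
  -- nearby points, which Grönwall keeps at distance less than `1` from it.
  obtain ⟨g, hg, hgs, hgf, -⟩ := exists_cutoff hf (R + 1)
  obtain ⟨χ, hχ⟩ := exists_isFlow_of_hasCompactSupport (hg.of_le (by simp)) hgs hT
  refine ⟨g, χ, hg, hgs, hχ, ?_⟩
  obtain ⟨K, hK⟩ := (hg.of_le (by simp : (1 : WithTop ℕ∞) ≤ ∞)).lipschitzWith_of_hasCompactSupport
    hgs (by norm_num)
  obtain ⟨C, hC0, hC⟩ := exists_gronwall_const (E := E) K hT
  have h0 : ∀ t ∈ Icc (-T) T, χ t x₀ = φ t x₀ :=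
    eqOn_of_hasDerivWithinAt_of_lipschitzOnWith (hK.lipschitzOnWith (s := univ)) hT
      (hχ.deriv x₀)
      (fun t ht => by
        rw [hgf _ (by
          rw [mem_closedBall_zero_iff]; linarith [hR t ht])]
        exact h.deriv x₀ t ht)
      (fun _ _ => mem_univ _) (fun _ _ => mem_univ _) (by rw [hχ.zero, h.zero])
  have h1 : ∀ᶠ x in 𝓝 x₀, C * ‖x - x₀‖ < 1 := by
    have : Filter.Tendsto (fun x => C * ‖x - x₀‖) (𝓝 x₀) (𝓝 (C * ‖x₀ - x₀‖)) :=
      (by fun_prop : Continuous fun x => C * ‖x - x₀‖).tendsto _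
    exact this.eventually (gt_mem_nhds (by simp))
  filter_upwards [h1] with x hx
  have h2 : ∀ t ∈ Icc (-T) T, ‖χ t x‖ ≤ R + 1 := by
    intro t ht
    have := hC (fun t => χ t x - χ t x₀) (fun t => g (χ t x) - g (χ t x₀)) 0 le_rfl
      (fun t ht => (hχ.deriv x t ht).sub (hχ.deriv x₀ t ht))
      (fun t ht => by simpa using hK.norm_sub_le _ _) t ht
    simp only [hχ.zero, add_zero] at this
    have h3 := hR t ht
    rw [← h0 t ht] at h3
    calc ‖χ t x‖ = ‖(χ t x - χ t x₀) + χ t x₀‖ := by simp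
      _ ≤ ‖χ t x - χ t x₀‖ + ‖χ t x₀‖ := norm_add_le _ _
      _ ≤ R + 1 := by linarith
  obtain ⟨R', hR'⟩ := h.norm_le x
  -- `f` is only locally Lipschitz, so uniqueness is applied in a ball that contains both orbits of
  -- `x`. Its radius may depend on `x`.
  obtain ⟨K', hK'⟩ := exists_lipschitzOnWith_closedBall hf (max R' (R + 1))
  refine eqOn_of_hasDerivWithinAt_of_lipschitzOnWith hK' hT (h.deriv x)
    (fun t ht => ?_) (fun t ht => ?_) (fun t ht => ?_) (by rw [hχ.zero, h.zero])
  · rw [← hgf _ (by simpa using h2 t ht)]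
    exact hχ.deriv x t ht
  · simpa using Or.inl (hR' t ht)
  · simpa using Or.inr (h2 t ht)

/-- The tangent system of a smooth vector field with compact support has a flow. -/
theorem exists_isFlow_tangentSystem {f : E → E} (hf : ContDiff ℝ ∞ f) (hs : HasCompactSupport f)
    {T : ℝ} (hT : 0 ≤ T) : ∃ Φ : ℝ → E × E → E × E, IsFlow T (tangentSystem f) Φ := by
  obtain ⟨L, hL0, hL⟩ := exists_norm_fderiv_le hf hs
  obtain ⟨B, hB⟩ := hs.exists_bound_of_continuous hf.continuous
  obtain ⟨C, hC0, hC⟩ := exists_gronwall_const (E := E × E) L hT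
  have key : ∀ p : E × E, ∃ α : ℝ → E × E, α 0 = p ∧
      ∀ t ∈ Icc (-T) T, HasDerivWithinAt α (tangentSystem f (α t)) (Icc (-T) T) t := by
    intro p
    -- The tangent system has no compact support but grows at most linearly, by `L ‖·‖ + B`. The
    -- cut-off field obeys the same bound, so Grönwall confines its orbit to the ball where nothing
    -- was cut off.
    obtain ⟨g, hg, hgs, hgf, hgn⟩ := exists_cutoff (contDiff_tangentSystem hf) (C * (‖p‖ + B))
    obtain ⟨χ, hχ⟩ := exists_isFlow_of_hasCompactSupport (hg.of_le (by simp)) hgs hT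
    refine ⟨fun t => χ t p, hχ.zero p, fun t ht => ?_⟩
    rw [← hgf]
    · exact hχ.deriv p t ht
    · have := hC (fun t => χ t p) (fun t => g (χ t p)) B ((norm_nonneg _).trans (hB 0)) (hχ.deriv p)
        (fun t _ => (hgn _).trans ?_) t ht
      · simpa [hχ.zero] using this
      · refine max_le ((hB _).trans (le_add_of_nonneg_left (by positivity))) ?_
        refine (ContinuousLinearMap.le_of_opNorm_le _ (hL _) _).trans ?_
        have : ‖(χ t p).2‖ ≤ ‖χ t p‖ := norm_snd_le _
        have hB0 : 0 ≤ B := (norm_nonneg _).trans (hB 0)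
        have := mul_le_mul_of_nonneg_left this hL0
        linarith
  choose Φ h0 h1 using key
  exact ⟨fun t x => Φ x t, h0, h1⟩

/-- The derivative of the flow of a smooth vector field with compact support, in terms of a flow of
the tangent system. -/
theorem IsFlow.hasFDerivAt_of_tangentSystem {f : E → E} (hf : ContDiff ℝ ∞ f)
    (hs : HasCompactSupport f) {T : ℝ} (hT : 0 ≤ T) {φ : ℝ → E → E} (h : IsFlow T f φ)
    {Φ : ℝ → E × E → E × E} (hΦ : IsFlow T (tangentSystem f) Φ) :
    ∃ A : ℝ → E → E →L[ℝ] E, (∀ t ∈ Ioo (-T) T, ∀ x v, A t x v = (Φ t (x, v)).2) ∧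
      ∀ t ∈ Ioo (-T) T, ∀ x, HasFDerivAt (fun p : ℝ × E => φ p.1 p.2)
        ((ContinuousLinearMap.fst ℝ ℝ E).smulRight (f (φ t x)) +
          (A t x).comp (ContinuousLinearMap.snd ℝ ℝ E)) (t, x) := by
  obtain ⟨L, hL0, hL⟩ := exists_norm_fderiv_le hf hs
  obtain ⟨K, hK⟩ := (hf.of_le (by simp : (1 : WithTop ℕ∞) ≤ ∞)).lipschitzWith_of_hasCompactSupport
    hs (by norm_num)
  obtain ⟨C₂, hC₂0, hC₂⟩ := exists_norm_sub_sub_fderiv_le hf hs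
  obtain ⟨C₁, hC₁0, hC₁⟩ := exists_gronwall_const (E := E) K hT
  obtain ⟨C₃, hC₃0, hC₃⟩ := exists_gronwall_const (E := E) L hT
  have hfst : ∀ x v, ∀ t ∈ Icc (-T) T, (Φ t (x, v)).1 = φ t x := fun x v =>
    eqOn_of_hasDerivWithinAt_of_lipschitzOnWith (hK.lipschitzOnWith (s := univ)) hT
      (fun t ht => (hΦ.deriv (x, v) t ht).fst) (h.deriv x)
      (fun _ _ => mem_univ _) (fun _ _ => mem_univ _) (by rw [hΦ.zero, h.zero])
  have hsnd : ∀ x v, ∀ t ∈ Icc (-T) T, HasDerivWithinAt (fun s => (Φ s (x, v)).2)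
      (fderiv ℝ f (φ t x) (Φ t (x, v)).2) (Icc (-T) T) t := fun x v t ht => by
    have := (hΦ.deriv (x, v) t ht).snd
    rwa [tangentSystem, hfst x v t ht] at this
  have hlip : ∀ x y, ∀ t ∈ Icc (-T) T, ‖φ t y - φ t x‖ ≤ C₁ * ‖y - x‖ := fun x y t ht => by
    have := hC₁ (fun t => φ t y - φ t x) (fun t => f (φ t y) - f (φ t x)) 0 le_rfl
      (fun t ht => (h.deriv y t ht).sub (h.deriv x t ht))
      (fun t ht => by simpa using hK.norm_sub_le _ _) t ht
    simpa [h.zero] using this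
  have hadd : ∀ x v w, ∀ t ∈ Icc (-T) T,
      (Φ t (x, v + w)).2 = (Φ t (x, v)).2 + (Φ t (x, w)).2 := fun x v w t ht => by
    have := hC₃ (fun t => (Φ t (x, v + w)).2 - ((Φ t (x, v)).2 + (Φ t (x, w)).2)) _ 0 le_rfl
      (fun t ht => (hsnd x (v + w) t ht).sub ((hsnd x v t ht).add (hsnd x w t ht)))
      (fun t ht => by
        rw [← map_add, ← map_sub, add_zero]; exact ContinuousLinearMap.le_of_opNorm_le _ (hL _) _)
      t ht
    simpa [hΦ.zero, sub_eq_zero] using this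
  have hsmul : ∀ x (c : ℝ) v, ∀ t ∈ Icc (-T) T,
      (Φ t (x, c • v)).2 = c • (Φ t (x, v)).2 := fun x c v t ht => by
    have := hC₃ (fun t => (Φ t (x, c • v)).2 - c • (Φ t (x, v)).2) _ 0 le_rfl
      (fun t ht => (hsnd x (c • v) t ht).sub ((hsnd x v t ht).const_smul c))
      (fun t ht => by
        rw [← map_smul, ← map_sub, add_zero]; exact ContinuousLinearMap.le_of_opNorm_le _ (hL _) _)
      t ht
    simpa [hΦ.zero, sub_eq_zero] using this
  -- The remainder solves the linearized equation up to a Taylor error of order `‖y - x‖ ^ 2`, so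
  -- Grönwall makes it quadratic, uniformly in time.
  have hquad : ∀ x y, ∀ t ∈ Icc (-T) T,
      ‖φ t y - φ t x - (Φ t (x, y - x)).2‖ ≤ C₃ * (C₂ * C₁ ^ 2) * ‖y - x‖ ^ 2 :=
    fun x y t ht => by
    have := hC₃ (fun t => φ t y - φ t x - (Φ t (x, y - x)).2) _ (C₂ * (C₁ * ‖y - x‖) ^ 2)
      (by positivity)
      (fun t ht => ((h.deriv y t ht).sub (h.deriv x t ht)).sub (hsnd x (y - x) t ht))
      (fun t ht => by
        have e : f (φ t y) - f (φ t x) - fderiv ℝ f (φ t x) (Φ t (x, y - x)).2 =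
            fderiv ℝ f (φ t x) (φ t y - φ t x - (Φ t (x, y - x)).2) +
            (f (φ t y) - f (φ t x) - fderiv ℝ f (φ t x) (φ t y - φ t x)) := by
          simp only [map_sub]; abel
        rw [e]
        refine (norm_add_le _ _).trans (add_le_add
          (ContinuousLinearMap.le_of_opNorm_le _ (hL _) _) ((hC₂ _ _).trans ?_))
        have := hlip x y t ht
        gcongr) t ht
    refine this.trans (le_of_eq ?_)
    simp [h.zero, hΦ.zero]; ring
  classical
  let A : ℝ → E → E →L[ℝ] E := fun t x => if ht : t ∈ Icc (-T) T then
    LinearMap.toContinuousLinearMap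
      { toFun := fun v => (Φ t (x, v)).2
        map_add' := fun v w => hadd x v w t ht
        map_smul' := fun c v => hsmul x c v t ht } else 0
  have hA : ∀ t ∈ Icc (-T) T, ∀ x v, A t x v = (Φ t (x, v)).2 := fun t ht x v => by
    simp only [A, dif_pos ht]; rfl
  refine ⟨A, fun t ht => hA t (Ioo_subset_Icc_self ht), fun t ht x => ?_⟩
  have hnt : Icc (-T) T ∈ 𝓝 t := Icc_mem_nhds ht.1 ht.2
  -- For joint differentiability, `φ s y` is split into `φ s x`, `A t x (y - x)`, `(A s x - A t x)
  -- (y - x)` and the quadratic remainder. The last two have derivative `0`.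
  have hd1 : HasFDerivAt (fun p : ℝ × E => φ p.1 x)
      ((ContinuousLinearMap.fst ℝ ℝ E).smulRight (f (φ t x))) (t, x) := by
    have h1 := ((h.deriv x t (Ioo_subset_Icc_self ht)).hasDerivAt hnt).hasFDerivAt
    have h2 := HasFDerivAt.comp (t, x) h1 (hasFDerivAt_fst (𝕜 := ℝ) (E := ℝ) (F := E) (p := (t, x)))
    convert! h2 using 1
  have hd2 : HasFDerivAt (fun p : ℝ × E => A t x (p.2 - x))
      ((A t x).comp (ContinuousLinearMap.snd ℝ ℝ E)) (t, x) :=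
    (A t x).hasFDerivAt.comp (t, x) ((hasFDerivAt_snd (p := (t, x))).sub_const x)
  have hd3 : HasFDerivAt (fun p : ℝ × E => (A p.1 x - A t x) (p.2 - x))
      (0 : ℝ × E →L[ℝ] E) (t, x) := by
    have hc : ContinuousAt (fun s => A s x) t := by
      refine ContinuousOn.continuousAt (continuousOn_clm_apply.2 fun v => ?_) hnt
      exact ContinuousOn.congr (fun s hs => (hsnd x v s hs).continuousWithinAt)
        (fun s hs => hA s hs x v)
    rw [hasFDerivAt_iff_isLittleO]
    have h1 : (fun p : ℝ × E => A p.1 x - A t x) =o[𝓝 (t, x)] (fun _ => (1 : ℝ)) := by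
      rw [Asymptotics.isLittleO_one_iff]
      have : Filter.Tendsto (fun p : ℝ × E => A p.1 x) (𝓝 (t, x)) (𝓝 (A t x)) :=
        Filter.Tendsto.comp (y := 𝓝 t) hc continuousAt_fst
      simpa using this.sub_const (A t x)
    have h2 : (fun p : ℝ × E => p.2 - x) =O[𝓝 (t, x)] (fun p => p - (t, x)) :=
      Asymptotics.isBigO_of_le _ (fun p => norm_snd_le (p - (t, x)))
    have h3 : (fun p : ℝ × E => (A p.1 x - A t x) (p.2 - x)) =O[𝓝 (t, x)]
        (fun p => ‖A p.1 x - A t x‖ * ‖p.2 - x‖) :=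
      Asymptotics.isBigO_of_le _ (fun p => by
        simpa using (A p.1 x - A t x).le_opNorm (p.2 - x))
    have h4 := h3.trans_isLittleO (h1.norm_left.mul_isBigO h2.norm_norm)
    simpa using h4.norm_right
  have hd4 : HasFDerivAt (fun p : ℝ × E => φ p.1 p.2 - φ p.1 x - A p.1 x (p.2 - x))
      (0 : ℝ × E →L[ℝ] E) (t, x) := by
    refine Asymptotics.IsBigO.hasFDerivAt (n := 2) ?_ one_lt_two
    refine Asymptotics.IsBigO.of_bound (C₃ * (C₂ * C₁ ^ 2)) ?_
    have : ∀ᶠ p : ℝ × E in 𝓝 (t, x), p.1 ∈ Icc (-T) T := continuousAt_fst.eventually hnt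
    filter_upwards [this] with p hp
    rw [hA _ hp]
    refine (hquad x p.2 p.1 hp).trans ?_
    have : ‖p.2 - x‖ ≤ ‖p - (t, x)‖ := norm_snd_le (p - (t, x))
    simp only [norm_pow, norm_norm]
    gcongr
  convert! ((hd1.add hd2).add hd3).add hd4 using 1
  · ext p; simp
  · simp

end Flow

/-- **Smooth dependence on initial values**, for finitely many derivatives. -/
theorem IsFlow.contDiffOn_nat (k : ℕ) : ∀ {E : Type} [NormedAddCommGroup E] [NormedSpace ℝ E]
    [FiniteDimensional ℝ E] {f : E → E} (_ : ContDiff ℝ ∞ f) {T : ℝ} (_ : 0 ≤ T) {φ : ℝ → E → E}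
    (_ : IsFlow T f φ), ContDiffOn ℝ k (fun p : ℝ × E => φ p.1 p.2) (Ioo (-T) T ×ˢ univ) := by
  -- The statement ranges over all spaces and all smooth fields, not only those with compact
  -- support, because the step applies it to the tangent system on `E × E`.
  induction k with
  | zero =>
    intro E _ _ _ f hf T hT φ h p hp
    obtain ⟨g, χ, hg, hgs, hχ, he⟩ := h.exists_eventuallyEq_hasCompactSupport hT hf p.2
    obtain ⟨Φ, hΦ⟩ := exists_isFlow_tangentSystem hg hgs hT
    obtain ⟨A, -, hA⟩ := hχ.hasFDerivAt_of_tangentSystem hg hgs hT hΦ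
    have hχc : ContDiffOn ℝ 0 (fun p : ℝ × E => χ p.1 p.2) (Ioo (-T) T ×ˢ univ) :=
      contDiffOn_zero.2 fun p hp => (hA p.1 hp.1 p.2).continuousAt.continuousWithinAt
    refine (hχc p hp).congr_of_eventuallyEq_of_mem ?_ hp
    filter_upwards [nhdsWithin_le_nhds (continuousAt_snd.eventually he), self_mem_nhdsWithin]
      with q hq hq'
    exact hq q.1 (Ioo_subset_Icc_self hq'.1)
  | succ k ih =>
    intro E _ _ _ f hf T hT φ h p hp
    obtain ⟨g, χ, hg, hgs, hχ, he⟩ := h.exists_eventuallyEq_hasCompactSupport hT hf p.2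
    obtain ⟨Φ, hΦ⟩ := exists_isFlow_tangentSystem hg hgs hT
    obtain ⟨A, hAΦ, hA⟩ := hχ.hasFDerivAt_of_tangentSystem hg hgs hT hΦ
    have hopen : IsOpen (Ioo (-T) T ×ˢ (univ : Set E)) := isOpen_Ioo.prod isOpen_univ
    have hχk := ih hg hT hχ
    have hΦk := ih (contDiff_tangentSystem hg) hT hΦ
    have hAk : ContDiffOn ℝ k (fun p : ℝ × E => A p.1 p.2) (Ioo (-T) T ×ˢ univ) := by
      refine contDiffOn_clm_apply.2 fun v => ?_
      have h1 : ContDiffOn ℝ k (fun p : ℝ × E => (Φ p.1 (p.2, v)).2) (Ioo (-T) T ×ˢ univ) := by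
        refine contDiff_snd.comp_contDiffOn (hΦk.comp (g := fun p : ℝ × (E × E) => Φ p.1 p.2)
          (f := fun p : ℝ × E => (p.1, (p.2, v))) ?_ ?_)
        · exact ContDiff.contDiffOn (by fun_prop)
        · exact fun p hp => ⟨hp.1, mem_univ _⟩
      exact h1.congr fun p hp => hAΦ p.1 hp.1 p.2 v
    -- The derivative of `χ` is made of `g ∘ χ` in time and of `A`, a component of the flow of the
    -- tangent system, in space. Both are `C^k` by induction.
    have hχc : ContDiffOn ℝ ((k : WithTop ℕ∞) + 1) (fun p : ℝ × E => χ p.1 p.2)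
        (Ioo (-T) T ×ˢ univ) := by
      rw [contDiffOn_succ_iff_fderiv_of_isOpen hopen]
      refine ⟨fun p hp => (hA p.1 hp.1 p.2).differentiableAt.differentiableWithinAt, by simp, ?_⟩
      refine ContDiffOn.congr (f := fun p : ℝ × E =>
        (ContinuousLinearMap.fst ℝ ℝ E).smulRight (g (χ p.1 p.2)) +
          (A p.1 p.2).comp (ContinuousLinearMap.snd ℝ ℝ E)) ?_
        (fun p hp => (hA p.1 hp.1 p.2).fderiv)
      refine ContDiffOn.add ?_ (hAk.clm_comp contDiffOn_const)
      exact contDiffOn_const.smulRight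
        ((hg.of_le (by exact_mod_cast le_top)).comp_contDiffOn hχk)
    push_cast
    refine (hχc p hp).congr_of_eventuallyEq_of_mem ?_ hp
    filter_upwards [nhdsWithin_le_nhds (continuousAt_snd.eventually he), self_mem_nhdsWithin]
      with q hq hq'
    exact hq q.1 (Ioo_subset_Icc_self hq'.1)

/-- **Smooth dependence on initial values**: a flow of a smooth vector field is smooth. -/
theorem IsFlow.contDiffOn {E : Type} [NormedAddCommGroup E] [NormedSpace ℝ E]
    [FiniteDimensional ℝ E] {f : E → E} (hf : ContDiff ℝ ∞ f) {T : ℝ} (hT : 0 ≤ T)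
    {φ : ℝ → E → E} (h : IsFlow T f φ) :
    ContDiffOn ℝ ∞ (fun p : ℝ × E => φ p.1 p.2) (Ioo (-T) T ×ˢ univ) :=
  contDiffOn_infty.2 fun k => h.contDiffOn_nat k hf hT

/-! ### Linear algebra of `a ∧ η^n` -/

section Algebra

variable {V : Type*} {n : ℕ}

/-- The value of `a ∧ η^n` on `v 0, …, v (2n)`. -/
def wedgePow (a : V → ℝ) (η : V → V → ℝ) (v : Fin (2 * n + 1) → V) : ℝ :=
  (1 / 2 ^ n : ℝ) * ∑ σ : Equiv.Perm (Fin (2 * n + 1)),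
    ((Equiv.Perm.sign σ : ℤ) : ℝ) * a (v (σ 0)) *
      ∏ i : Fin n, η (v (σ ⟨2 * (i : ℕ) + 1, by omega⟩)) (v (σ ⟨2 * (i : ℕ) + 2, by omega⟩))

/-- Right multiplication by the transposition is a fixed-point free involution that reverses the
sign, so the terms cancel in pairs. It expresses that a wedge product with a repeated one-form
vanishes. -/
theorem sum_sign_mul_eq_zero_of_swap {m : ℕ} (g : Equiv.Perm (Fin m) → ℝ) {i j : Fin m}
    (hij : i ≠ j) (hg : ∀ σ, g (σ * Equiv.swap i j) = g σ) :
    ∑ σ : Equiv.Perm (Fin m), ((Equiv.Perm.sign σ : ℤ) : ℝ) * g σ = 0 := by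
  refine Finset.sum_involution (fun σ _ => σ * Equiv.swap i j) ?_ ?_ ?_ ?_
  · intro σ _
    simp [hg, Equiv.Perm.sign_swap hij]
  · intro σ _ _ h
    exact hij (Equiv.swap_eq_one_iff.1 (mul_eq_left.1 h))
  · intro σ _; exact Finset.mem_univ _
  · intro σ _; simp [mul_assoc]

/-- If `a' = h a` and `η' = k ∧ a + h η`, then the derivative of `a ∧ η^n` is `(n + 1) h a ∧ η^n`. -/
theorem hasDerivAt_wedgePow {a : ℝ → V → ℝ} {η : ℝ → V → V → ℝ} {h : ℝ} {k : V → ℝ} {t : ℝ}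
    (ha : ∀ v, HasDerivAt (fun s => a s v) (h * a t v) t)
    (hη : ∀ v w, HasDerivAt (fun s => η s v w) (k v * a t w - k w * a t v + h * η t v w) t)
    (v : Fin (2 * n + 1) → V) :
    HasDerivAt (fun s => wedgePow (a s) (η s) v) ((n + 1) * h * wedgePow (a t) (η t) v) t := by
  unfold wedgePow
  have hd := (HasDerivAt.fun_sum (u := Finset.univ) fun (σ : Equiv.Perm (Fin (2 * n + 1))) _ =>
    ((ha (v (σ 0))).const_mul ((Equiv.Perm.sign σ : ℤ) : ℝ)).fun_mul
      (HasDerivAt.fun_finsetProd (u := Finset.univ) fun (i : Fin n) _ =>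
        hη (v (σ ⟨2 * (i : ℕ) + 1, by omega⟩)) (v (σ ⟨2 * (i : ℕ) + 2, by omega⟩)))).const_mul
      (1 / 2 ^ n : ℝ)
  convert! hd using 1
  rw [mul_left_comm]
  congr 1
  rw [Finset.mul_sum]
  -- The contribution of `k ∧ a` contains `a` twice. Exchanging slot `0` with the slot of the second
  -- `a` cancels it.
  have h0 : ∀ i : Fin n, ∑ σ : Equiv.Perm (Fin (2 * n + 1)), ((Equiv.Perm.sign σ : ℤ) : ℝ) *
      (a t (v (σ 0)) * (∏ j ∈ Finset.univ.erase i,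
        η t (v (σ ⟨2 * (j : ℕ) + 1, by omega⟩)) (v (σ ⟨2 * (j : ℕ) + 2, by omega⟩))) *
        (k (v (σ ⟨2 * (i : ℕ) + 1, by omega⟩)) * a t (v (σ ⟨2 * (i : ℕ) + 2, by omega⟩)) -
          k (v (σ ⟨2 * (i : ℕ) + 2, by omega⟩)) * a t (v (σ ⟨2 * (i : ℕ) + 1, by omega⟩)))) = 0 := by
    intro i
    have key : ∀ (p q : Fin (2 * n + 1)), 0 ≠ q → p ≠ 0 → p ≠ q →
        (∀ j : Fin n, j ≠ i → (⟨2 * (j : ℕ) + 1, by omega⟩ : Fin (2 * n + 1)) ≠ q ∧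
          (⟨2 * (j : ℕ) + 2, by omega⟩ : Fin (2 * n + 1)) ≠ q) →
        ∑ σ : Equiv.Perm (Fin (2 * n + 1)), ((Equiv.Perm.sign σ : ℤ) : ℝ) *
          (a t (v (σ 0)) * (∏ j ∈ Finset.univ.erase i,
            η t (v (σ ⟨2 * (j : ℕ) + 1, by omega⟩)) (v (σ ⟨2 * (j : ℕ) + 2, by omega⟩))) *
            (k (v (σ p)) * a t (v (σ q)))) = 0 := by
      intro p q hq hp hpq hj
      refine sum_sign_mul_eq_zero_of_swap _ hq fun σ => ?_
      have e1 : (σ * Equiv.swap 0 q) 0 = σ q := by simp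
      have e2 : (σ * Equiv.swap 0 q) q = σ 0 := by simp
      have e3 : ∀ r, r ≠ 0 → r ≠ q → (σ * Equiv.swap 0 q) r = σ r := fun r h1 h2 => by
        simp [Equiv.swap_apply_of_ne_of_ne h1 h2]
      rw [e1, e2, e3 p hp hpq]
      have e4 : ∏ j ∈ Finset.univ.erase i,
            η t (v ((σ * Equiv.swap 0 q) ⟨2 * (j : ℕ) + 1, by omega⟩))
              (v ((σ * Equiv.swap 0 q) ⟨2 * (j : ℕ) + 2, by omega⟩)) =
          ∏ j ∈ Finset.univ.erase i,
            η t (v (σ ⟨2 * (j : ℕ) + 1, by omega⟩)) (v (σ ⟨2 * (j : ℕ) + 2, by omega⟩)) := by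
        refine Finset.prod_congr rfl fun j hji => ?_
        have := hj j (Finset.ne_of_mem_erase hji)
        rw [e3 _ (by simp [Fin.ext_iff]) this.1, e3 _ (by simp [Fin.ext_iff]) this.2]
      rw [e4]; ring
    have k1 := key ⟨2 * (i : ℕ) + 1, by omega⟩ ⟨2 * (i : ℕ) + 2, by omega⟩
      (by simp [Fin.ext_iff]) (by simp [Fin.ext_iff]) (by simp [Fin.ext_iff])
      (fun j hj => by have := Fin.val_ne_of_ne hj; simp only [ne_eq, Fin.mk.injEq]; omega)
    have k2 := key ⟨2 * (i : ℕ) + 2, by omega⟩ ⟨2 * (i : ℕ) + 1, by omega⟩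
      (by simp [Fin.ext_iff]) (by simp [Fin.ext_iff]) (by simp [Fin.ext_iff])
      (fun j hj => by have := Fin.val_ne_of_ne hj; simp only [ne_eq, Fin.mk.injEq]; omega)
    simp only [mul_sub, Finset.sum_sub_distrib]
    rw [k1, k2, sub_zero]
  have h1 : ∑ σ : Equiv.Perm (Fin (2 * n + 1)), ∑ i : Fin n, ((Equiv.Perm.sign σ : ℤ) : ℝ) *
      (a t (v (σ 0)) * (∏ j ∈ Finset.univ.erase i,
        η t (v (σ ⟨2 * (j : ℕ) + 1, by omega⟩)) (v (σ ⟨2 * (j : ℕ) + 2, by omega⟩))) *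
        (k (v (σ ⟨2 * (i : ℕ) + 1, by omega⟩)) * a t (v (σ ⟨2 * (i : ℕ) + 2, by omega⟩)) -
          k (v (σ ⟨2 * (i : ℕ) + 2, by omega⟩)) * a t (v (σ ⟨2 * (i : ℕ) + 1, by omega⟩)))) = 0 := by
    rw [Finset.sum_comm]; exact Finset.sum_eq_zero fun i _ => h0 i
  rw [← add_zero (∑ σ : Equiv.Perm (Fin (2 * n + 1)), (n + 1) * h * _), ← h1,
    ← Finset.sum_add_distrib]
  refine Finset.sum_congr rfl fun σ _ => ?_
  have h2 : ∀ i : Fin n, (∏ j ∈ Finset.univ.erase i,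
        η t (v (σ ⟨2 * (j : ℕ) + 1, by omega⟩)) (v (σ ⟨2 * (j : ℕ) + 2, by omega⟩))) *
      η t (v (σ ⟨2 * (i : ℕ) + 1, by omega⟩)) (v (σ ⟨2 * (i : ℕ) + 2, by omega⟩)) =
      ∏ j : Fin n, η t (v (σ ⟨2 * (j : ℕ) + 1, by omega⟩)) (v (σ ⟨2 * (j : ℕ) + 2, by omega⟩)) :=
    fun i => Finset.prod_erase_mul _ _ (Finset.mem_univ i)
  simp only [smul_eq_mul, mul_add, Finset.sum_add_distrib, mul_left_comm _ h, h2]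
  -- One factor `h` comes from `a` and one from each of the `n` copies of `η`, which makes `n + 1`.
  rw [Finset.sum_const, Finset.card_univ, Fintype.card_fin, nsmul_eq_mul, Finset.mul_sum]
  simp only [mul_assoc]
  ring

variable [AddCommGroup V] [Module ℝ V]

/-- Every slot enters exactly one factor: slot `0` enters `a`, an odd slot is a first argument of
`η`, and a positive even slot is a second argument. One linear map yields both axioms of
multilinearity in `prodMultilinear`. -/
theorem exists_linearMap_update (a : V →ₗ[ℝ] ℝ) (η : V →ₗ[ℝ] V →ₗ[ℝ] ℝ)
    (v : Fin (2 * n + 1) → V) (j : Fin (2 * n + 1)) : ∃ L : V →ₗ[ℝ] ℝ, ∀ x,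
      a (Function.update v j x 0) * ∏ i : Fin n, η (Function.update v j x ⟨2 * (i : ℕ) + 1, by omega⟩)
        (Function.update v j x ⟨2 * (i : ℕ) + 2, by omega⟩) = L x := by
  have hs : ∀ (i : Fin n) (g : Fin n → ℝ), (∏ l ∈ Finset.univ.erase i, g l) * g i = ∏ l, g l :=
    fun i g => Finset.prod_erase_mul _ _ (Finset.mem_univ i)
  have hu : ∀ (i : Fin (2 * n + 1)) (x : V), i ≠ j → Function.update v j x i = v i :=
    fun i x h => Function.update_of_ne h _ _
  by_cases hj : j = 0
  · subst hj
    refine ⟨(∏ i : Fin n, η (v ⟨2 * (i : ℕ) + 1, by omega⟩) (v ⟨2 * (i : ℕ) + 2, by omega⟩)) • a,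
      fun x => ?_⟩
    rw [Function.update_self, LinearMap.smul_apply, smul_eq_mul, mul_comm]
    congr 1
  have hj0 : (j : ℕ) ≠ 0 := fun h => hj (Fin.ext h)
  rcases Nat.even_or_odd' (j : ℕ) with ⟨m, hm | hm⟩
  · obtain ⟨i, hi⟩ : ∃ i : Fin n, (j : ℕ) = 2 * (i : ℕ) + 2 :=
      ⟨⟨m - 1, by omega⟩, by simp only; omega⟩
    have hji : j = ⟨2 * (i : ℕ) + 2, by omega⟩ := Fin.ext hi
    refine ⟨(a (v 0) * ∏ l ∈ Finset.univ.erase i, η (v ⟨2 * (l : ℕ) + 1, by omega⟩)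
      (v ⟨2 * (l : ℕ) + 2, by omega⟩)) • η (v ⟨2 * (i : ℕ) + 1, by omega⟩), fun x => ?_⟩
    rw [← hs i, hu 0 x (Ne.symm hj), hu ⟨2 * (i : ℕ) + 1, by omega⟩ x
      (by simp only [ne_eq, Fin.ext_iff]; omega), ← hji, Function.update_self, ← mul_assoc]
    congr 2
    refine Finset.prod_congr rfl fun l hl => ?_
    have := Fin.val_ne_of_ne (Finset.ne_of_mem_erase hl)
    rw [hu _ _ (by simp only [ne_eq, Fin.ext_iff]; omega),
      hu _ _ (by simp only [ne_eq, Fin.ext_iff]; omega)]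
  · obtain ⟨i, hi⟩ : ∃ i : Fin n, (j : ℕ) = 2 * (i : ℕ) + 1 := ⟨⟨m, by omega⟩, hm⟩
    have hji : j = ⟨2 * (i : ℕ) + 1, by omega⟩ := Fin.ext hi
    refine ⟨(a (v 0) * ∏ l ∈ Finset.univ.erase i, η (v ⟨2 * (l : ℕ) + 1, by omega⟩)
      (v ⟨2 * (l : ℕ) + 2, by omega⟩)) • η.flip (v ⟨2 * (i : ℕ) + 2, by omega⟩), fun x => ?_⟩
    rw [← hs i, hu 0 x (Ne.symm hj), hu ⟨2 * (i : ℕ) + 2, by omega⟩ x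
      (by simp only [ne_eq, Fin.ext_iff]; omega), ← hji, Function.update_self, ← mul_assoc]
    congr 2
    refine Finset.prod_congr rfl fun l hl => ?_
    have := Fin.val_ne_of_ne (Finset.ne_of_mem_erase hl)
    rw [hu _ _ (by simp only [ne_eq, Fin.ext_iff]; omega),
      hu _ _ (by simp only [ne_eq, Fin.ext_iff]; omega)]

/-- The multilinear map `(v 0, …, v (2n)) ↦ a (v 0) η(v 1, v 2) ⋯ η(v (2n - 1), v (2n))`. -/
def prodMultilinear (n : ℕ) (a : V →ₗ[ℝ] ℝ) (η : V →ₗ[ℝ] V →ₗ[ℝ] ℝ) :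
    MultilinearMap ℝ (fun _ : Fin (2 * n + 1) => V) ℝ :=
  MultilinearMap.mk' (fun v => a (v 0) *
      ∏ i : Fin n, η (v ⟨2 * (i : ℕ) + 1, by omega⟩) (v ⟨2 * (i : ℕ) + 2, by omega⟩))
    (fun v j x y => by
      obtain ⟨L, hL⟩ := exists_linearMap_update a η v j
      rw [hL, hL, hL, map_add])
    (fun v j c x => by
      obtain ⟨L, hL⟩ := exists_linearMap_update a η v j
      rw [hL, hL, map_smul])

theorem prodMultilinear_apply (a : V →ₗ[ℝ] ℝ) (η : V →ₗ[ℝ] V →ₗ[ℝ] ℝ)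
    (v : Fin (2 * n + 1) → V) : prodMultilinear n a η v =
      a (v 0) * ∏ i : Fin n, η (v ⟨2 * (i : ℕ) + 1, by omega⟩) (v ⟨2 * (i : ℕ) + 2, by omega⟩) :=
  rfl

/-- The alternating map `a ∧ η^n`. -/
def wedgePowAlt (n : ℕ) (a : V →ₗ[ℝ] ℝ) (η : V →ₗ[ℝ] V →ₗ[ℝ] ℝ) :
    V [⋀^Fin (2 * n + 1)]→ₗ[ℝ] ℝ :=
  (1 / 2 ^ n : ℝ) • MultilinearMap.alternatization (prodMultilinear n a η)

theorem wedgePowAlt_apply (a : V →ₗ[ℝ] ℝ) (η : V →ₗ[ℝ] V →ₗ[ℝ] ℝ) (v : Fin (2 * n + 1) → V) :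
    wedgePowAlt n a η v = wedgePow a (fun x y => η x y) v := by
  simp [wedgePowAlt, wedgePow, MultilinearMap.alternatization_apply, prodMultilinear_apply,
    Units.smul_def, mul_assoc]

/-- If `a ∧ η^n ≠ 0`, then no non-zero vector is in the kernels of both `a` and `η`. -/
theorem eq_zero_of_wedgePow_ne_zero [FiniteDimensional ℝ V] (hV : Module.finrank ℝ V = 2 * n + 1)
    (a : V →ₗ[ℝ] ℝ) (η : V →ₗ[ℝ] V →ₗ[ℝ] ℝ) (hη : ∀ x y, η x y = - η y x)
    {v : Fin (2 * n + 1) → V} (hv : wedgePow a (fun x y => η x y) v ≠ 0) {w : V} (ha : a w = 0)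
    (hw : ∀ y, η w y = 0) : w = 0 := by
  by_contra hw0
  obtain ⟨f, hf⟩ : ∃ f : Module.Dual ℝ V, f w ≠ 0 := by
    by_contra! h
    exact hw0 ((Module.forall_dual_apply_eq_zero_iff ℝ w).1 h)
  -- Subtracting multiples of `w` does not change `a ∧ η^n`, since `w` is in both kernels. It moves
  -- all `2n + 1` vectors into the hyperplane `ker f`, where they are dependent.
  set u : Fin (2 * n + 1) → V := fun i => v i - (f (v i) / f w) • w with hu
  have hfu : ∀ i, f (u i) = 0 := fun i => by simp [hu, hf]
  have hw' : ∀ y, η y w = 0 := fun y => by rw [hη, hw, neg_zero]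
  have h1 : wedgePowAlt n a η u = wedgePow a (fun x y => η x y) v := by
    rw [wedgePowAlt_apply]
    simp [wedgePow, hu, ha, hw, hw']
  rw [← h1] at hv
  refine hv (AlternatingMap.map_linearDependent _ _ fun hli => hf ?_)
  have hspan := hli.span_eq_top_of_card_eq_finrank' (by simp [hV])
  have hw1 : w ∈ Submodule.span ℝ (Set.range u) := by rw [hspan]; trivial
  have hle : Submodule.span ℝ (Set.range u) ≤ LinearMap.ker f :=
    Submodule.span_le.2 (by rintro _ ⟨i, rfl⟩; exact hfu i)
  exact hle hw1

/-- A skew-symmetric bilinear form on a space of odd dimension is degenerate. -/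
theorem exists_ne_zero_of_skew [FiniteDimensional ℝ V] (hV : Module.finrank ℝ V = 2 * n + 1)
    (η : V →ₗ[ℝ] V →ₗ[ℝ] ℝ) (hη : ∀ x y, η x y = - η y x) : ∃ w, w ≠ 0 ∧ ∀ y, η w y = 0 := by
  let b := Module.finBasisOfFinrankEq ℝ V hV
  let A : Matrix (Fin (2 * n + 1)) (Fin (2 * n + 1)) ℝ := Matrix.of fun i j => η (b i) (b j)
  -- In odd size, `det A = det Aᵀ = det (-A) = -det A`.
  have hA : A.det = 0 := by
    have h1 : A.transpose = -A := by
      ext i j; simp [A, hη (b j) (b i)]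
    have h2 := congrArg Matrix.det h1
    rw [Matrix.det_transpose, Matrix.det_neg, Fintype.card_fin,
      Odd.neg_one_pow ⟨n, rfl⟩] at h2
    linarith
  obtain ⟨c, hc, hcA⟩ := Matrix.exists_vecMul_eq_zero_iff.2 hA
  refine ⟨∑ i, c i • b i, fun h => hc ?_, fun y => ?_⟩
  · exact funext (Fintype.linearIndependent_iff.1 b.linearIndependent c h)
  · have : η (∑ i, c i • b i) = 0 := b.ext fun j => by
      have := congrFun hcA j
      simpa [Matrix.vecMul, dotProduct, A] using this
    rw [this]; rfl

end Algebra

/-! ### Exterior derivative and Cartan's formula on vector spaces -/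

section Calculus

variable {E F : Type*} [NormedAddCommGroup E] [NormedSpace ℝ E] [NormedAddCommGroup F]
  [NormedSpace ℝ F]

/-- The exterior derivative of one-forms on vector spaces is natural. -/
theorem fderiv_sub_fderiv_of_eventuallyEq_comp {A : E → E →L[ℝ] ℝ} {B : F → F →L[ℝ] ℝ} {G : E → F}
    {u : E} (hG : ContDiffAt ℝ 2 G u) (hB : DifferentiableAt ℝ B (G u))
    (hA : A =ᶠ[𝓝 u] fun y => (B (G y)).comp (fderiv ℝ G y)) (v w : E) :
    fderiv ℝ A u v w - fderiv ℝ A u w v =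
      fderiv ℝ B (G u) (fderiv ℝ G u v) (fderiv ℝ G u w) -
        fderiv ℝ B (G u) (fderiv ℝ G u w) (fderiv ℝ G u v) := by
  have hG1 : DifferentiableAt ℝ G u := hG.differentiableAt (by norm_num)
  have hG2 : DifferentiableAt ℝ (fderiv ℝ G) u :=
    (hG.fderiv_right (m := 1) (by norm_num)).differentiableAt (by norm_num)
  have h1 := (hB.hasFDerivAt.comp u hG1.hasFDerivAt).clm_comp hG2.hasFDerivAt
  have h2 := (h1.congr_of_eventuallyEq hA).fderiv
  -- The second derivatives of `G` cancel in the skew-symmetrization.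
  have hsymm : fderiv ℝ (fderiv ℝ G) u v w = fderiv ℝ (fderiv ℝ G) u w v :=
    (hG.isSymmSndFDerivAt (by simp)) v w
  rw [h2]
  simp [hsymm]

/-- Differentiation in a parameter and in the space variable commute. -/
theorem hasDerivAt_fderiv_of_contDiffAt {B : ℝ × E → F} {t : ℝ} {u : E}
    (hB : ContDiffAt ℝ 2 B (t, u)) :
    HasDerivAt (fun s => fderiv ℝ (fun y => B (s, y)) u)
      (fderiv ℝ (fun y => fderiv ℝ B (t, y) (1, 0)) u) t := by
  have hd : ∀ᶠ p in 𝓝 (t, u), DifferentiableAt ℝ B p :=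
    (hB.eventually (by simp)).mono fun p hp => hp.differentiableAt (by norm_num)
  have hB2 : DifferentiableAt ℝ (fderiv ℝ B) (t, u) :=
    (hB.fderiv_right (m := 1) (by norm_num)).differentiableAt (by norm_num)
  have hc : Filter.Tendsto (fun s : ℝ => (s, u)) (𝓝 t) (𝓝 (t, u)) :=
    (Continuous.tendsto (by fun_prop) t)
  have h1 : (fun s => fderiv ℝ (fun y => B (s, y)) u) =ᶠ[𝓝 t]
      fun s => (fderiv ℝ B (s, u)).comp (ContinuousLinearMap.inr ℝ ℝ E) := by
    filter_upwards [hc.eventually hd] with s hs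
    exact (hs.hasFDerivAt.comp u (hasFDerivAt_prodMk_right s u)).fderiv
  have h2 : HasDerivAt (fun s => fderiv ℝ B (s, u)) (fderiv ℝ (fderiv ℝ B) (t, u) (1, 0)) t := by
    have := hB2.hasFDerivAt.comp_hasDerivAt t
      ((hasDerivAt_id t).prodMk (hasDerivAt_const t u))
    exact this
  have h3 : HasDerivAt (fun s => (fderiv ℝ B (s, u)).comp (ContinuousLinearMap.inr ℝ ℝ E))
      ((fderiv ℝ (fderiv ℝ B) (t, u) (1, 0)).comp (ContinuousLinearMap.inr ℝ ℝ E)) t := by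
    have := h2.clm_comp (hasDerivAt_const t (ContinuousLinearMap.inr ℝ ℝ E))
    simpa using this
  have h4 : HasFDerivAt (fun y => fderiv ℝ B (t, y) (1, 0))
      (((fderiv ℝ (fderiv ℝ B) (t, u)).comp (ContinuousLinearMap.inr ℝ ℝ E)).flip (1, 0)) u := by
    have := (hB2.hasFDerivAt.comp u (hasFDerivAt_prodMk_right t u)).clm_apply
      (hasFDerivAt_const ((1, 0) : ℝ × E) u)
    convert! this using 1
    simp
  rw [h4.fderiv]
  convert! h3.congr_of_eventuallyEq h1 using 1
  ext w
  have hsymm : fderiv ℝ (fderiv ℝ B) (t, u) (0, w) (1, 0) =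
      fderiv ℝ (fderiv ℝ B) (t, u) (1, 0) (0, w) := (hB.isSymmSndFDerivAt (by simp)) (0, w) (1, 0)
  simpa using hsymm

theorem hasDerivAt_fst_of_contDiffAt {B : ℝ × E → F} {t : ℝ} {u : E}
    (hB : DifferentiableAt ℝ B (t, u)) :
    HasDerivAt (fun s => B (s, u)) (fderiv ℝ B (t, u) (1, 0)) t :=
  hB.hasFDerivAt.comp_hasDerivAt t ((hasDerivAt_id t).prodMk (hasDerivAt_const t u))

/-- **Cartan's formula** on a vector space, for a family `L` of one-forms and a family `G` of maps
that starts at the identity. -/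
theorem hasDerivAt_pullback_family {L : ℝ × E → E →L[ℝ] ℝ} {G : ℝ × E → E} {u : E}
    (hG : ContDiffAt ℝ 2 G (0, u)) (hL : ContDiffAt ℝ 1 L (0, u))
    (hG0 : ∀ᶠ y in 𝓝 u, G (0, y) = y) (v : E) :
    HasDerivAt (fun t => L (t, G (t, u)) (fderiv ℝ (fun y => G (t, y)) u v))
      (fderiv ℝ L (0, u) (1, 0) v +
        (fderiv ℝ (fun y => L (0, y)) u (fderiv ℝ G (0, u) (1, 0)) v -
          fderiv ℝ (fun y => L (0, y)) u v (fderiv ℝ G (0, u) (1, 0))) +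
        fderiv ℝ (fun y => L (0, y) (fderiv ℝ G (0, y) (1, 0))) u v) 0 := by
  have hGu : G (0, u) = u := hG0.self_of_nhds
  have hL1 : DifferentiableAt ℝ L (0, u) := hL.differentiableAt (by norm_num)
  have hL0 : HasFDerivAt (fun y => L (0, y))
      ((fderiv ℝ L (0, u)).comp (ContinuousLinearMap.inr ℝ ℝ E)) u :=
    hL1.hasFDerivAt.comp u (hasFDerivAt_prodMk_right 0 u)
  have hGt := hasDerivAt_fst_of_contDiffAt (hG.differentiableAt (by norm_num))
  have hDG := hasDerivAt_fderiv_of_contDiffAt hG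
  have hX : DifferentiableAt ℝ (fun y => fderiv ℝ G (0, y) (1, 0)) u := by
    have h1 : DifferentiableAt ℝ (fderiv ℝ G) (0, u) :=
      (hG.fderiv_right (m := 1) (by norm_num)).differentiableAt (by norm_num)
    exact ((h1.hasFDerivAt.comp u (hasFDerivAt_prodMk_right 0 u)).clm_apply
      (hasFDerivAt_const ((1, 0) : ℝ × E) u)).differentiableAt
  have hid : fderiv ℝ (fun y => G (0, y)) u = ContinuousLinearMap.id ℝ E := by
    have : (fun y => G (0, y)) =ᶠ[𝓝 u] fun y => y := hG0
    rw [this.fderiv_eq]; exact fderiv_fun_id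
  have h1 : HasDerivAt (fun t => L (t, G (t, u)))
      (fderiv ℝ L (0, u) (1, fderiv ℝ G (0, u) (1, 0))) 0 := by
    have h2 : HasFDerivAt L (fderiv ℝ L (0, u)) ((fun t => (t, G (t, u))) 0) := by
      simpa [hGu] using hL1.hasFDerivAt
    exact h2.comp_hasDerivAt 0 ((hasDerivAt_id (0 : ℝ)).prodMk hGt)
  have h3 := h1.clm_apply (hDG.clm_apply (hasDerivAt_const 0 v))
  -- By the product rule, the differential of `L(X)` contains the term `D_v L (X)` that the exterior
  -- derivative subtracts. What remains is the transport term `D_X L (v)` and `L(D_v X)`.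
  have h4 := (hL0.clm_apply hX.hasFDerivAt).fderiv
  convert! h3 using 1
  rw [h4, hL0.fderiv, hid, hGu]
  have h5 : ((1 : ℝ), fderiv ℝ G (0, u) (1, 0)) = (1, 0) + (0, fderiv ℝ G (0, u) (1, 0)) := by simp
  rw [h5, map_add]
  simp
  ring

end Calculus

/-! ### Forms, fields and maps in charts -/

section Charts

variable {n : ℕ} {M : Type*} [TopologicalSpace M] [ChartedSpace (Model n) M]
  [IsManifold (𝓡 (2 * n + 1)) ∞ M]

theorem mdifferentiable_of_mem_maximalAtlas {e : OpenPartialHomeomorph M (Model n)}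
    (he : e ∈ IsManifold.maximalAtlas (𝓡 (2 * n + 1)) ∞ M) :
    e.MDifferentiable (𝓡 (2 * n + 1)) (𝓡 (2 * n + 1)) :=
  ⟨(contMDiffOn_of_mem_maximalAtlas he).mdifferentiableOn (by simp),
    (contMDiffOn_symm_of_mem_maximalAtlas he).mdifferentiableOn (by simp)⟩

theorem chartAt_mem_maximalAtlas (x : M) :
    chartAt (Model n) x ∈ IsManifold.maximalAtlas (𝓡 (2 * n + 1)) ∞ M :=
  IsManifold.chart_mem_maximalAtlas x

theorem mfderiv_symm_mfderiv {e : OpenPartialHomeomorph M (Model n)}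
    (he : e ∈ IsManifold.maximalAtlas (𝓡 (2 * n + 1)) ∞ M) {x : M} (hx : x ∈ e.source)
    (v : TangentSpace (𝓡 (2 * n + 1)) x) :
    (mfderiv (𝓡 (2 * n + 1)) (𝓡 (2 * n + 1)) e.symm (e x)
      (mfderiv (𝓡 (2 * n + 1)) (𝓡 (2 * n + 1)) e x v) : Model n) = v :=
  DFunLike.congr_fun ((mdifferentiable_of_mem_maximalAtlas he).symm_comp_deriv hx) v

theorem mfderiv_mfderiv_symm {e : OpenPartialHomeomorph M (Model n)}
    (he : e ∈ IsManifold.maximalAtlas (𝓡 (2 * n + 1)) ∞ M) {x : M} (hx : x ∈ e.source)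
    (v : Model n) :
    mfderiv (𝓡 (2 * n + 1)) (𝓡 (2 * n + 1)) e x
      (mfderiv (𝓡 (2 * n + 1)) (𝓡 (2 * n + 1)) e.symm (e x) v : Model n) = v := by
  have h := DFunLike.congr_fun ((mdifferentiable_of_mem_maximalAtlas he).comp_symm_deriv
    (e.map_source hx)) v
  rw [e.left_inv hx] at h
  exact h

/-- The coordinate expression of a one-form at the image of a point. -/
theorem OneForm.inChart_apply (α : OneForm n M) {e : OpenPartialHomeomorph M (Model n)} {x : M}
    (hx : x ∈ e.source) (w : Model n) : α.inChart e (e x) w =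
      α x (mfderiv (𝓡 (2 * n + 1)) (𝓡 (2 * n + 1)) e.symm (e x) w : Model n) := by
  -- The covectors at `e.symm (e x)` and at `x` are compared in the common model space, since the
  -- two points are equal only through `e.left_inv`.
  have : ∀ z : M, z = x → ∀ u : Model n, (α z : Model n →L[ℝ] ℝ) u = α x u := by
    rintro z rfl u; rfl
  exact this _ (e.left_inv hx) _

theorem OneForm.apply_eq_inChart (α : OneForm n M) {e : OpenPartialHomeomorph M (Model n)}
    (he : e ∈ IsManifold.maximalAtlas (𝓡 (2 * n + 1)) ∞ M) {x : M} (hx : x ∈ e.source)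
    (v : TangentSpace (𝓡 (2 * n + 1)) x) :
    α x v = α.inChart e (e x) (mfderiv (𝓡 (2 * n + 1)) (𝓡 (2 * n + 1)) e x v) := by
  refine Eq.trans ?_ (α.inChart_apply hx _).symm
  exact congrArg (α x) (mfderiv_symm_mfderiv he hx v).symm

theorem VField.inChart_apply (X : VField n M) {e : OpenPartialHomeomorph M (Model n)} {x : M}
    (hx : x ∈ e.source) : X.inChart e (e x) =
      mfderiv (𝓡 (2 * n + 1)) (𝓡 (2 * n + 1)) e x (X x) := by
  have : ∀ z : M, z = x →
      (mfderiv (𝓡 (2 * n + 1)) (𝓡 (2 * n + 1)) e z (X z) : Model n) =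
        mfderiv (𝓡 (2 * n + 1)) (𝓡 (2 * n + 1)) e x (X x) := by
    rintro z rfl; rfl
  exact this _ (e.left_inv hx)

/-- The coordinate expression of a family of maps is smooth. -/
theorem contDiffAt_chart_family {δ : ℝ} {f : ℝ → M → M}
    (hf : ContMDiffOn (𝓘(ℝ, ℝ).prod (𝓡 (2 * n + 1))) (𝓡 (2 * n + 1)) ∞
      (fun p : ℝ × M => f p.1 p.2) (Ioo (-δ) δ ×ˢ univ))
    {e e' : OpenPartialHomeomorph M (Model n)}
    (he : e ∈ IsManifold.maximalAtlas (𝓡 (2 * n + 1)) ∞ M)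
    (he' : e' ∈ IsManifold.maximalAtlas (𝓡 (2 * n + 1)) ∞ M) {t : ℝ} (ht : t ∈ Ioo (-δ) δ)
    {y : Model n} (hy : y ∈ e.target) (hy' : f t (e.symm y) ∈ e'.source) :
    ContDiffAt ℝ ∞ (fun p : ℝ × Model n => e' (f p.1 (e.symm p.2))) (t, y) := by
  rw [← contMDiffAt_iff_contDiffAt]
  have h1 : ContMDiffAt 𝓘(ℝ, ℝ × Model n) (𝓡 (2 * n + 1)) ∞
      (fun p : ℝ × Model n => e.symm p.2) (t, y) := by
    have h2 := contMDiffAt_symm_of_mem_maximalAtlas he hy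
    exact ContMDiffAt.comp (t, y) h2 contDiff_snd.contMDiff.contMDiffAt
  have h3 : ContMDiffAt 𝓘(ℝ, ℝ × Model n) (𝓘(ℝ, ℝ).prod (𝓡 (2 * n + 1))) ∞
      (fun p : ℝ × Model n => (p.1, e.symm p.2)) (t, y) :=
    contDiff_fst.contMDiff.contMDiffAt.prodMk h1
  have h4 : ContMDiffAt (𝓘(ℝ, ℝ).prod (𝓡 (2 * n + 1))) (𝓡 (2 * n + 1)) ∞
      (fun p : ℝ × M => f p.1 p.2) (t, e.symm y) :=
    hf.contMDiffAt (prod_mem_nhds (isOpen_Ioo.mem_nhds ht) Filter.univ_mem)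
  have h5 := contMDiffAt_of_mem_maximalAtlas he' hy'
  exact ContMDiffAt.comp (t, y) h5 (ContMDiffAt.comp (t, y) h4 h3)

/-- The coordinate expression of a smooth map is smooth. -/
theorem contDiffAt_chart {f : M → M} (hf : ContMDiff (𝓡 (2 * n + 1)) (𝓡 (2 * n + 1)) ∞ f)
    {e e' : OpenPartialHomeomorph M (Model n)}
    (he : e ∈ IsManifold.maximalAtlas (𝓡 (2 * n + 1)) ∞ M)
    (he' : e' ∈ IsManifold.maximalAtlas (𝓡 (2 * n + 1)) ∞ M)
    {y : Model n} (hy : y ∈ e.target) (hy' : f (e.symm y) ∈ e'.source) :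
    ContDiffAt ℝ ∞ (fun z => e' (f (e.symm z))) y := by
  rw [← contMDiffAt_iff_contDiffAt]
  exact ContMDiffAt.comp y (contMDiffAt_of_mem_maximalAtlas he' hy')
    (hf.contMDiffAt.comp y (contMDiffAt_symm_of_mem_maximalAtlas he hy))

/-- The chain rule for `(e' ∘ f ∘ e.symm) ∘ e = e' ∘ f` near `x`. With `f = id` it becomes the
transformation law between two charts. -/
theorem fderiv_chart {f : M → M} (hf : ContMDiff (𝓡 (2 * n + 1)) (𝓡 (2 * n + 1)) ∞ f)
    {e e' : OpenPartialHomeomorph M (Model n)}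
    (he : e ∈ IsManifold.maximalAtlas (𝓡 (2 * n + 1)) ∞ M)
    (he' : e' ∈ IsManifold.maximalAtlas (𝓡 (2 * n + 1)) ∞ M)
    {x : M} (hx : x ∈ e.source) (hx' : f x ∈ e'.source) (v : TangentSpace (𝓡 (2 * n + 1)) x) :
    fderiv ℝ (fun z => e' (f (e.symm z))) (e x)
        (mfderiv (𝓡 (2 * n + 1)) (𝓡 (2 * n + 1)) e x v) =
      mfderiv (𝓡 (2 * n + 1)) (𝓡 (2 * n + 1)) e' (f x)
        (mfderiv (𝓡 (2 * n + 1)) (𝓡 (2 * n + 1)) f x v) := by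
  have hG : DifferentiableAt ℝ (fun z => e' (f (e.symm z))) (e x) :=
    (contDiffAt_chart hf he he' (e.map_source hx) (by rwa [e.left_inv hx])).differentiableAt
      (by simp)
  have h1 := HasMFDerivAt.comp x hG.hasFDerivAt.hasMFDerivAt
    ((mdifferentiable_of_mem_maximalAtlas he).mdifferentiableAt hx).hasMFDerivAt
  have h2 := HasMFDerivAt.comp x
    ((mdifferentiable_of_mem_maximalAtlas he').mdifferentiableAt hx').hasMFDerivAt
    (hf.mdifferentiable (by simp) x).hasMFDerivAt
  have h3 : ((fun z => e' (f (e.symm z))) ∘ e) =ᶠ[𝓝 x] (e' ∘ f) := by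
    filter_upwards [e.open_source.mem_nhds hx] with z hz
    simp [e.left_inv hz]
  exact DFunLike.congr_fun (hasMFDerivAt_unique h1 (h2.congr_of_eventuallyEq h3)) v

/-- The coordinate expression of a pull-back. -/
theorem pullback_inChart (α : OneForm n M) (χ : Diffeo n M)
    {e e' : OpenPartialHomeomorph M (Model n)}
    (he : e ∈ IsManifold.maximalAtlas (𝓡 (2 * n + 1)) ∞ M)
    (he' : e' ∈ IsManifold.maximalAtlas (𝓡 (2 * n + 1)) ∞ M)
    {y : Model n} (hy : y ∈ e.target) (hy' : χ (e.symm y) ∈ e'.source) :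
    (pullback χ α).inChart e y = (α.inChart e' (e' (χ (e.symm y)))).comp
      (fderiv ℝ (fun z => e' (χ (e.symm z))) y) := by
  obtain ⟨x, hx, rfl⟩ : ∃ x ∈ e.source, y = e x :=
    ⟨e.symm y, e.map_target hy, (e.right_inv hy).symm⟩
  rw [e.left_inv hx] at hy' ⊢
  ext w
  rw [OneForm.inChart_apply _ hx, ContinuousLinearMap.comp_apply]
  have h1 := fderiv_chart χ.contMDiff he he' hx hy'
    (mfderiv (𝓡 (2 * n + 1)) (𝓡 (2 * n + 1)) e.symm (e x) w : Model n)
  rw [mfderiv_mfderiv_symm he hx] at h1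
  rw [h1, ← α.apply_eq_inChart he' hy']
  rfl

theorem pullback_refl (α : OneForm n M) :
    pullback (Diffeomorph.refl (𝓡 (2 * n + 1)) M ∞) α = α := by
  funext x
  unfold pullback
  have : mfderiv (𝓡 (2 * n + 1)) (𝓡 (2 * n + 1)) (Diffeomorph.refl (𝓡 (2 * n + 1)) M ∞) x =
    ContinuousLinearMap.id ℝ _ := mfderiv_id
  rw [this]; rfl

/-- The change of coordinates of a one-form. -/
theorem OneForm.inChart_eq_comp (α : OneForm n M) {e e' : OpenPartialHomeomorph M (Model n)}
    (he : e ∈ IsManifold.maximalAtlas (𝓡 (2 * n + 1)) ∞ M)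
    (he' : e' ∈ IsManifold.maximalAtlas (𝓡 (2 * n + 1)) ∞ M)
    {y : Model n} (hy : y ∈ e.target) (hy' : e.symm y ∈ e'.source) :
    α.inChart e y = (α.inChart e' (e' (e.symm y))).comp
      (fderiv ℝ (fun z => e' (e.symm z)) y) := by
  have := pullback_inChart α (Diffeomorph.refl (𝓡 (2 * n + 1)) M ∞) he he' hy hy'
  rwa [pullback_refl] at this

/-- In the preferred chart at a point, a smooth family of one-forms is smooth near the point. -/
theorem contDiffAt_inChart_chartAt {δ : ℝ} {Λ : ℝ → OneForm n M}
    (hΛ : ContMDiffOn (𝓘(ℝ, ℝ).prod (𝓡 (2 * n + 1)))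
      ((𝓡 (2 * n + 1)).prod 𝓘(ℝ, Model n →L[ℝ] ℝ)) ∞
      (fun p : ℝ × M => (Λ p.1).toCotangent p.2) (Ioo (-δ) δ ×ˢ univ)) {t : ℝ}
    (ht : t ∈ Ioo (-δ) δ) (x : M) :
    ContDiffAt ℝ ∞ (fun p : ℝ × Model n => (Λ p.1).inChart (chartAt (Model n) x) p.2)
      (t, chartAt (Model n) x x) := by
  have h0 : ContMDiffAt (𝓘(ℝ, ℝ).prod (𝓡 (2 * n + 1)))
      ((𝓡 (2 * n + 1)).prod 𝓘(ℝ, Model n →L[ℝ] ℝ)) ∞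
      (fun p : ℝ × M => (Λ p.1).toCotangent p.2) (t, x) :=
    hΛ.contMDiffAt (prod_mem_nhds (isOpen_Ioo.mem_nhds ht) Filter.univ_mem)
  have h1 := ((contMDiffAt_hom_bundle _).1 h0).2
  set e := chartAt (Model n) x with he
  have hem := chartAt_mem_maximalAtlas (n := n) x
  have hx : x ∈ e.source := mem_chart_source _ x
  have h2 : ContMDiffAt 𝓘(ℝ, ℝ × Model n) (𝓡 (2 * n + 1)) ∞
      (fun p : ℝ × Model n => e.symm p.2) (t, e x) :=
    ContMDiffAt.comp (t, e x) (contMDiffAt_symm_of_mem_maximalAtlas hem (e.map_source hx))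
      contDiff_snd.contMDiff.contMDiffAt
  have h3 : ContMDiffAt 𝓘(ℝ, ℝ × Model n) (𝓘(ℝ, ℝ).prod (𝓡 (2 * n + 1))) ∞
      (fun p : ℝ × Model n => (p.1, e.symm p.2)) (t, e x) :=
    contDiff_fst.contMDiff.contMDiffAt.prodMk h2
  have h4 := ContMDiffAt.comp_of_eq h1 h3 (by simp [e.left_inv hx])
  rw [← contMDiffAt_iff_contDiffAt]
  refine h4.congr_of_eventuallyEq ?_
  have h5 : ∀ᶠ p : ℝ × Model n in 𝓝 (t, e x), p.2 ∈ e.target :=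
    continuousAt_snd.eventually (e.open_target.mem_nhds (e.map_source hx))
  filter_upwards [h5] with p hp
  have hp' : e.symm p.2 ∈ e.source := e.map_target hp
  -- Over the domain of the preferred chart the inverse trivialization is the derivative of
  -- `e.symm`, so the bundle coordinates of the form are its expression `inChart`.
  have h6 : (trivializationAt (Model n) (TangentSpace (𝓡 (2 * n + 1))) x).symmL ℝ (e.symm p.2) =
      mfderiv (𝓡 (2 * n + 1)) (𝓡 (2 * n + 1)) e.symm p.2 := by
    have := TangentBundle.symmL_trivializationAt (I := 𝓡 (2 * n + 1)) hp'
    rw [this]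
    have h7 : (extChartAt (𝓡 (2 * n + 1)) x) (e.symm p.2) = p.2 := by
      simp [extChartAt, ← he, e.right_inv hp]
    rw [h7]
    simp only [modelWithCornersSelf_coe, range_id, mfderivWithin_univ]
    rfl
  simp only [Function.comp_def, OneForm.toCotangent, ContinuousLinearMap.inCoordinates]
  rw [h6]
  ext w
  simp [OneForm.inChart]

end Charts

/-! ### Chart independence and naturality of the exterior derivative -/

section ExteriorDerivative

variable {n : ℕ} {M : Type*} [TopologicalSpace M] [ChartedSpace (Model n) M]
  [IsManifold (𝓡 (2 * n + 1)) ∞ M]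

theorem OneForm.IsSmooth.contMDiffOn_const {α : OneForm n M} (hα : α.IsSmooth) (δ : ℝ) :
    ContMDiffOn (𝓘(ℝ, ℝ).prod (𝓡 (2 * n + 1)))
      ((𝓡 (2 * n + 1)).prod 𝓘(ℝ, Model n →L[ℝ] ℝ)) ∞
      (fun p : ℝ × M => α.toCotangent p.2) (Ioo (-δ) δ ×ˢ univ) :=
  (ContMDiff.comp hα contMDiff_snd).contMDiffOn

/-- Bundle smoothness is read off in the preferred chart at the point itself. The transformation law
carries it to any other chart. -/
theorem OneForm.IsSmooth.contDiffAt_inChart {α : OneForm n M} (hα : α.IsSmooth)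
    {e : OpenPartialHomeomorph M (Model n)}
    (he : e ∈ IsManifold.maximalAtlas (𝓡 (2 * n + 1)) ∞ M) {x : M} (hx : x ∈ e.source) :
    ContDiffAt ℝ ∞ (α.inChart e) (e x) := by
  set c := chartAt (Model n) x with hc
  have hcm : c ∈ IsManifold.maximalAtlas (𝓡 (2 * n + 1)) ∞ M := chartAt_mem_maximalAtlas x
  have hxc : x ∈ c.source := mem_chart_source _ x
  have h1 : ContDiffAt ℝ ∞ (α.inChart c) (c x) := by
    have := contDiffAt_inChart_chartAt (Λ := fun _ => α) (hα.contMDiffOn_const 1)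
      (t := 0) (by simp) x
    exact this.comp (c x) (contDiff_prodMk_right (0 : ℝ)).contDiffAt
  have h2 : ContDiffAt ℝ ∞ (fun z => c (e.symm z)) (e x) :=
    contDiffAt_chart (f := id) contMDiff_id he hcm (e.map_source hx)
      (by simpa [e.left_inv hx] using hxc)
  have h3 : ContDiffAt ℝ ∞ (fun y => (α.inChart c (c (e.symm y))).comp
      (fderiv ℝ (fun z => c (e.symm z)) y)) (e x) := by
    have h5 : ContDiffAt ℝ ∞ (α.inChart c) (c (e.symm (e x))) := by rwa [e.left_inv hx]
    exact (h5.comp (e x) h2).clm_comp (h2.fderiv_right (by simp))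
  refine h3.congr_of_eventuallyEq ?_
  have h4 : ∀ᶠ y in 𝓝 (e x), e.symm y ∈ c.source :=
    (e.continuousAt_symm (e.map_source hx)).eventually
      (c.open_source.mem_nhds (by simpa [e.left_inv hx] using hxc))
  filter_upwards [h4, e.open_target.mem_nhds (e.map_source hx)] with y hy hy'
  exact α.inChart_eq_comp he hcm hy' hy

/-- The common source of two facts: `χ = id` gives independence of the chart, and taking for `e` the
preferred chart at `χ x` gives naturality. -/
theorem d_pullback_eq_inChart {α : OneForm n M} (hα : α.IsSmooth) (χ : Diffeo n M)
    {e : OpenPartialHomeomorph M (Model n)}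
    (he : e ∈ IsManifold.maximalAtlas (𝓡 (2 * n + 1)) ∞ M) {x : M} (hx : χ x ∈ e.source)
    (v w : TangentSpace (𝓡 (2 * n + 1)) x) :
    (pullback χ α).d x v w =
      fderiv ℝ (α.inChart e) (e (χ x))
        (mfderiv (𝓡 (2 * n + 1)) (𝓡 (2 * n + 1)) e (χ x)
          (mfderiv (𝓡 (2 * n + 1)) (𝓡 (2 * n + 1)) χ x v))
        (mfderiv (𝓡 (2 * n + 1)) (𝓡 (2 * n + 1)) e (χ x)
          (mfderiv (𝓡 (2 * n + 1)) (𝓡 (2 * n + 1)) χ x w)) -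
      fderiv ℝ (α.inChart e) (e (χ x))
        (mfderiv (𝓡 (2 * n + 1)) (𝓡 (2 * n + 1)) e (χ x)
          (mfderiv (𝓡 (2 * n + 1)) (𝓡 (2 * n + 1)) χ x w))
        (mfderiv (𝓡 (2 * n + 1)) (𝓡 (2 * n + 1)) e (χ x)
          (mfderiv (𝓡 (2 * n + 1)) (𝓡 (2 * n + 1)) χ x v)) := by
  set c := chartAt (Model n) x with hc
  have hcm : c ∈ IsManifold.maximalAtlas (𝓡 (2 * n + 1)) ∞ M := chartAt_mem_maximalAtlas x
  have hxc : x ∈ c.source := mem_chart_source _ x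
  have hG : ContDiffAt ℝ ∞ (fun z => e (χ (c.symm z))) (c x) :=
    contDiffAt_chart χ.contMDiff hcm he (c.map_source hxc) (by rwa [c.left_inv hxc])
  have hGx : e (χ (c.symm (c x))) = e (χ x) := by rw [c.left_inv hxc]
  have hB : DifferentiableAt ℝ (α.inChart e) (e (χ x)) :=
    (hα.contDiffAt_inChart he hx).differentiableAt (by simp)
  have hA : (pullback χ α).inChart c =ᶠ[𝓝 (c x)] fun y => (α.inChart e (e (χ (c.symm y)))).comp
      (fderiv ℝ (fun z => e (χ (c.symm z))) y) := by
    have h4 : ∀ᶠ y in 𝓝 (c x), χ (c.symm y) ∈ e.source :=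
      (χ.continuous.continuousAt.comp (c.continuousAt_symm (c.map_source hxc))).eventually
        (e.open_source.mem_nhds (by rwa [Function.comp_apply, c.left_inv hxc]))
    filter_upwards [h4, c.open_target.mem_nhds (c.map_source hxc)] with y hy hy'
    exact pullback_inChart α χ hcm he hy' hy
  have key := fderiv_sub_fderiv_of_eventuallyEq_comp (hG.of_le (by norm_cast)) (by rwa [hGx]) hA
    (mfderiv (𝓡 (2 * n + 1)) (𝓡 (2 * n + 1)) c x v)
    (mfderiv (𝓡 (2 * n + 1)) (𝓡 (2 * n + 1)) c x w)
  rw [hGx, fderiv_chart χ.contMDiff hcm he hxc hx v, fderiv_chart χ.contMDiff hcm he hxc hx w]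
    at key
  exact key

/-- The exterior derivative may be computed in any chart. -/
theorem OneForm.IsSmooth.d_eq_inChart {α : OneForm n M} (hα : α.IsSmooth)
    {e : OpenPartialHomeomorph M (Model n)}
    (he : e ∈ IsManifold.maximalAtlas (𝓡 (2 * n + 1)) ∞ M) {x : M} (hx : x ∈ e.source)
    (v w : TangentSpace (𝓡 (2 * n + 1)) x) :
    α.d x v w =
      fderiv ℝ (α.inChart e) (e x) (mfderiv (𝓡 (2 * n + 1)) (𝓡 (2 * n + 1)) e x v)
        (mfderiv (𝓡 (2 * n + 1)) (𝓡 (2 * n + 1)) e x w) -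
      fderiv ℝ (α.inChart e) (e x) (mfderiv (𝓡 (2 * n + 1)) (𝓡 (2 * n + 1)) e x w)
        (mfderiv (𝓡 (2 * n + 1)) (𝓡 (2 * n + 1)) e x v) := by
  have h := d_pullback_eq_inChart hα (Diffeomorph.refl (𝓡 (2 * n + 1)) M ∞) he hx v w
  have hid : mfderiv (𝓡 (2 * n + 1)) (𝓡 (2 * n + 1)) (Diffeomorph.refl (𝓡 (2 * n + 1)) M ∞) x =
    ContinuousLinearMap.id ℝ _ := mfderiv_id
  rw [pullback_refl, hid] at h
  exact h

/-- The exterior derivative is natural. -/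
theorem OneForm.IsSmooth.d_pullback {α : OneForm n M} (hα : α.IsSmooth) (χ : Diffeo n M) (x : M)
    (v w : TangentSpace (𝓡 (2 * n + 1)) x) :
    (pullback χ α).d x v w = α.d (χ x) (mfderiv (𝓡 (2 * n + 1)) (𝓡 (2 * n + 1)) χ x v)
      (mfderiv (𝓡 (2 * n + 1)) (𝓡 (2 * n + 1)) χ x w) :=
  (d_pullback_eq_inChart hα χ (chartAt_mem_maximalAtlas _) (mem_chart_source _ _) v w).trans
    (hα.d_eq_inChart (chartAt_mem_maximalAtlas _) (mem_chart_source _ _) _ _).symm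

theorem OneForm.volForm_eq_wedgePow (α : OneForm n M) (x : M)
    (v : Fin (2 * n + 1) → TangentSpace (𝓡 (2 * n + 1)) x) :
    α.volForm x v = wedgePow (fun w => α x w) (α.d x) v := rfl

theorem OneForm.IsSmooth.volForm_pullback {α : OneForm n M} (hα : α.IsSmooth) (χ : Diffeo n M)
    (x : M) (v : Fin (2 * n + 1) → TangentSpace (𝓡 (2 * n + 1)) x) :
    (pullback χ α).volForm x v =
      α.volForm (χ x) (fun i => mfderiv (𝓡 (2 * n + 1)) (𝓡 (2 * n + 1)) χ x (v i)) := by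
  rw [OneForm.volForm_eq_wedgePow, OneForm.volForm_eq_wedgePow]
  have : (pullback χ α).d x = fun v w => α.d (χ x)
      (mfderiv (𝓡 (2 * n + 1)) (𝓡 (2 * n + 1)) χ x v)
      (mfderiv (𝓡 (2 * n + 1)) (𝓡 (2 * n + 1)) χ x w) := by
    funext v w; exact hα.d_pullback χ x v w
  rw [this]; rfl

theorem IsStrictContactPair.isIncompressible {lam : OneForm n M} {ψ : Diffeo n M}
    (h : IsStrictContactPair lam ψ) : IsIncompressible lam ψ := fun x v => by
  rw [← h.1.1.volForm_pullback, h.2]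

theorem OneForm.d_skew (α : OneForm n M) (x : M) (v w : TangentSpace (𝓡 (2 * n + 1)) x) :
    α.d x v w = - α.d x w v := (neg_sub _ _).symm

/-- The skew-symmetrization of a bilinear form. -/
def skewBilin (T : Model n →L[ℝ] Model n →L[ℝ] ℝ) : Model n →ₗ[ℝ] Model n →ₗ[ℝ] ℝ :=
  LinearMap.mk₂ ℝ (fun v w => T v w - T w v)
    (fun v v' w => by simp; ring) (fun c v w => by simp; ring)
    (fun v w w' => by simp; ring) (fun c v w => by simp; ring)

/-- The exterior derivative at a point, as a bilinear map. -/
def OneForm.dBilin (α : OneForm n M) (x : M) : TangentSpace (𝓡 (2 * n + 1)) x →ₗ[ℝ]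
    TangentSpace (𝓡 (2 * n + 1)) x →ₗ[ℝ] ℝ :=
  (skewBilin (fderiv ℝ (α.inChart (chartAt (Model n) x)) (chartAt (Model n) x x))).compl₁₂
    (mfderiv (𝓡 (2 * n + 1)) (𝓡 (2 * n + 1)) (chartAt (Model n) x) x).toLinearMap
    (mfderiv (𝓡 (2 * n + 1)) (𝓡 (2 * n + 1)) (chartAt (Model n) x) x).toLinearMap

theorem OneForm.dBilin_apply (α : OneForm n M) (x : M) (v w : TangentSpace (𝓡 (2 * n + 1)) x) :
    α.dBilin x v w = α.d x v w := rfl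

end ExteriorDerivative

/-! ### Existence and uniqueness of the Reeb vector -/

section Reeb

variable {n : ℕ} {M : Type*} [TopologicalSpace M] [ChartedSpace (Model n) M]
  [IsManifold (𝓡 (2 * n + 1)) ∞ M] {lam : OneForm n M}

theorem finrank_tangentSpace (x : M) :
    Module.finrank ℝ (TangentSpace (𝓡 (2 * n + 1)) x) = 2 * n + 1 :=
  finrank_euclideanSpace_fin (𝕜 := ℝ) (n := 2 * n + 1)

instance (x : M) : FiniteDimensional ℝ (TangentSpace (𝓡 (2 * n + 1)) x) :=
  inferInstanceAs (FiniteDimensional ℝ (Model n))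

/-- A common kernel vector of `lam` and `d lam` would make `lam ∧ (d lam)^n` vanish. This is the
form in which the contact condition gives uniqueness. -/
theorem IsContactForm.eq_zero (h : IsContactForm lam) {x : M}
    {v : TangentSpace (𝓡 (2 * n + 1)) x} (h1 : lam x v = 0) (h2 : ∀ w, lam.d x v w = 0) :
    v = 0 := by
  obtain ⟨u, hu⟩ := h.2 x
  exact eq_zero_of_wedgePow_ne_zero (finrank_tangentSpace x) (lam x).toLinearMap (lam.dBilin x)
    (lam.d_skew x) hu h1 h2

/-- In odd dimension `d lam` has a non-zero kernel vector, on which `lam` cannot vanish by the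
contact condition. Scaling it gives a Reeb vector, so the default value in `reeb` does not occur. -/
theorem IsContactForm.reeb_spec (h : IsContactForm lam) (x : M) :
    lam x (reeb lam x) = 1 ∧ ∀ w, lam.d x (reeb lam x) w = 0 := by
  have hex : ∃ R : TangentSpace (𝓡 (2 * n + 1)) x, lam x R = 1 ∧ ∀ w, lam.d x R w = 0 := by
    obtain ⟨w, hw0, hw⟩ := exists_ne_zero_of_skew (finrank_tangentSpace x) (lam.dBilin x)
      (lam.d_skew x)
    have hl : lam x w ≠ 0 := fun h0 => hw0 (h.eq_zero h0 hw)
    refine ⟨(lam x w)⁻¹ • w, by simp [hl], fun y => ?_⟩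
    rw [← OneForm.dBilin_apply, map_smul, LinearMap.smul_apply, hw, smul_zero]
  have : reeb lam x = hex.choose := dif_pos hex
  rw [this]
  exact hex.choose_spec

theorem IsContactForm.eq_smul_reeb (h : IsContactForm lam) {x : M}
    {v : TangentSpace (𝓡 (2 * n + 1)) x} {c : ℝ} (h1 : lam x v = c) (h2 : ∀ w, lam.d x v w = 0) :
    v = c • reeb lam x := by
  obtain ⟨h3, h4⟩ := h.reeb_spec x
  refine sub_eq_zero.1 (h.eq_zero (by simp [h1, h3]) fun w => ?_)
  rw [← OneForm.dBilin_apply, map_sub, map_smul, LinearMap.sub_apply, LinearMap.smul_apply,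
    OneForm.dBilin_apply, OneForm.dBilin_apply, h2, h4, smul_zero, sub_zero]

end Reeb

/-! ### Smooth vector fields and smoothness of the Reeb field -/

section VectorFields

variable {n : ℕ} {M : Type*} [TopologicalSpace M] [ChartedSpace (Model n) M]
  [IsManifold (𝓡 (2 * n + 1)) ∞ M] {lam : OneForm n M}

/-- A vector field is smooth if, for every point, its expression in the preferred chart is smooth
near the point. -/
def VField.IsSmooth (X : VField n M) : Prop :=
  ∀ x : M, ContDiffAt ℝ ∞ (X.inChart (chartAt (Model n) x)) (chartAt (Model n) x x)

theorem VField.IsSmooth.contDiffAt_inChart {X : VField n M} (hX : X.IsSmooth)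
    {e : OpenPartialHomeomorph M (Model n)}
    (he : e ∈ IsManifold.maximalAtlas (𝓡 (2 * n + 1)) ∞ M) {x : M} (hx : x ∈ e.source) :
    ContDiffAt ℝ ∞ (X.inChart e) (e x) := by
  set c := chartAt (Model n) x with hc
  have hcm : c ∈ IsManifold.maximalAtlas (𝓡 (2 * n + 1)) ∞ M := chartAt_mem_maximalAtlas x
  have hxc : x ∈ c.source := mem_chart_source _ x
  have h1 : ContDiffAt ℝ ∞ (X.inChart c) (c x) := hX x
  have h2 : ContDiffAt ℝ ∞ (fun z => c (e.symm z)) (e x) :=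
    contDiffAt_chart (f := id) contMDiff_id he hcm (e.map_source hx)
      (by simpa [e.left_inv hx] using hxc)
  have h3 : ContDiffAt ℝ ∞ (fun z => e (c.symm z)) (c x) :=
    contDiffAt_chart (f := id) contMDiff_id hcm he (c.map_source hxc)
      (by simpa [c.left_inv hxc] using hx)
  have h4 : ContDiffAt ℝ ∞ (fun y => fderiv ℝ (fun z => e (c.symm z)) (c (e.symm y))
      (X.inChart c (c (e.symm y)))) (e x) := by
    have h5 : ContDiffAt ℝ ∞ (X.inChart c) (c (e.symm (e x))) := by rwa [e.left_inv hx]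
    have h6 : ContDiffAt ℝ ∞ (fderiv ℝ (fun z => e (c.symm z))) (c (e.symm (e x))) := by
      rw [e.left_inv hx]; exact h3.fderiv_right (by simp)
    have h7 : ContDiffAt ℝ ∞ (fun y => X.inChart c (c (e.symm y))) (e x) :=
      ContDiffAt.comp (g := X.inChart c) (e x) h5 h2
    exact (h6.comp (e x) h2).clm_apply h7
  refine h4.congr_of_eventuallyEq ?_
  have h7 : ∀ᶠ y in 𝓝 (e x), e.symm y ∈ c.source :=
    (e.continuousAt_symm (e.map_source hx)).eventually
      (c.open_source.mem_nhds (by simpa [e.left_inv hx] using hxc))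
  filter_upwards [h7, e.open_target.mem_nhds (e.map_source hx)] with y hy hy'
  obtain ⟨z, hz, rfl⟩ : ∃ z ∈ e.source, y = e z :=
    ⟨e.symm y, e.map_target hy', (e.right_inv hy').symm⟩
  rw [e.left_inv hz] at hy ⊢
  rw [X.inChart_apply hz, X.inChart_apply hy]
  have := fderiv_chart (f := id) contMDiff_id hcm he hy hz (X z)
  rw [mfderiv_id] at this
  exact this.symm

/-- Passes from the criterion in charts to sections of the tangent bundle, the form required by the
theory of integral curves. -/
theorem VField.IsSmooth.contMDiff {X : VField n M} (hX : X.IsSmooth) :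
    ContMDiff (𝓡 (2 * n + 1)) (𝓡 (2 * n + 1)).tangent ∞
      (fun x => (⟨x, X x⟩ : TangentBundle (𝓡 (2 * n + 1)) M)) := by
  intro x
  rw [Bundle.contMDiffAt_section]
  set c := chartAt (Model n) x with hc
  have hxc : x ∈ c.source := mem_chart_source _ x
  have h1 : ContMDiffAt (𝓡 (2 * n + 1)) 𝓘(ℝ, Model n) ∞ (fun y => X.inChart c (c y)) x :=
    ContMDiffAt.comp x (contMDiffAt_iff_contDiffAt.2 (hX x))
      (contMDiffAt_of_mem_maximalAtlas (chartAt_mem_maximalAtlas x) hxc)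
  refine h1.congr_of_eventuallyEq ?_
  filter_upwards [c.open_source.mem_nhds hxc] with y hy
  rw [X.inChart_apply hy]
  have h2 := TangentBundle.continuousLinearMapAt_trivializationAt (I := 𝓡 (2 * n + 1)) hy
  have h3 := DFunLike.congr_fun h2 (X y)
  rw [Bundle.Trivialization.continuousLinearMapAt_apply,
    Bundle.Trivialization.coe_linearMapAt_of_mem _ (by simpa using hy)] at h3
  exact h3

/-- A function that is smooth in the charts is smooth. -/
theorem contMDiff_of_contDiffAt_chart {H : M → ℝ}
    (hH : ∀ x : M, ContDiffAt ℝ ∞ (fun u => H ((chartAt (Model n) x).symm u))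
      (chartAt (Model n) x x)) : ContMDiff (𝓡 (2 * n + 1)) 𝓘(ℝ, ℝ) ∞ H := by
  intro x
  set c := chartAt (Model n) x with hc
  have hxc : x ∈ c.source := mem_chart_source _ x
  have h1 : ContMDiffAt (𝓡 (2 * n + 1)) 𝓘(ℝ, ℝ) ∞ (fun y => H (c.symm (c y))) x :=
    ContMDiffAt.comp (g := fun u => H (c.symm u)) x (contMDiffAt_iff_contDiffAt.2 (hH x))
      (contMDiffAt_of_mem_maximalAtlas (chartAt_mem_maximalAtlas x) hxc)
  refine h1.congr_of_eventuallyEq ?_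
  filter_upwards [c.open_source.mem_nhds hxc] with y hy
  rw [c.left_inv hy]

theorem fderiv_chart_symm {H : M → ℝ} (hH : ContMDiff (𝓡 (2 * n + 1)) 𝓘(ℝ, ℝ) ∞ H)
    {e : OpenPartialHomeomorph M (Model n)}
    (he : e ∈ IsManifold.maximalAtlas (𝓡 (2 * n + 1)) ∞ M) {x : M} (hx : x ∈ e.source)
    (v : TangentSpace (𝓡 (2 * n + 1)) x) :
    fderiv ℝ (fun u => H (e.symm u)) (e x) (mfderiv (𝓡 (2 * n + 1)) (𝓡 (2 * n + 1)) e x v) =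
      mfderiv (𝓡 (2 * n + 1)) 𝓘(ℝ, ℝ) H x v := by
  have hG : DifferentiableAt ℝ (fun u => H (e.symm u)) (e x) := by
    refine ContDiffAt.differentiableAt (n := ∞) ?_ (by simp)
    rw [← contMDiffAt_iff_contDiffAt]
    exact hH.contMDiffAt.comp (e x) (contMDiffAt_symm_of_mem_maximalAtlas he (e.map_source hx))
  have h1 := HasMFDerivAt.comp x hG.hasFDerivAt.hasMFDerivAt
    ((mdifferentiable_of_mem_maximalAtlas he).mdifferentiableAt hx).hasMFDerivAt
  have h2 := (hH.mdifferentiable (by simp) x).hasMFDerivAt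
  have h3 : ((fun u => H (e.symm u)) ∘ e) =ᶠ[𝓝 x] H := by
    filter_upwards [e.open_source.mem_nhds hx] with z hz
    simp [e.left_inv hz]
  exact DFunLike.congr_fun (hasMFDerivAt_unique (h1.congr_of_eventuallyEq h3.symm) h2) v

theorem IsContactForm.reeb_inChart_spec (h : IsContactForm lam)
    {e : OpenPartialHomeomorph M (Model n)}
    (he : e ∈ IsManifold.maximalAtlas (𝓡 (2 * n + 1)) ∞ M) {x : M} (hx : x ∈ e.source) :
    lam.inChart e (e x) ((reeb lam).inChart e (e x)) = 1 ∧
      ∀ w, skewBilin (fderiv ℝ (lam.inChart e) (e x)) ((reeb lam).inChart e (e x)) w = 0 := by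
  obtain ⟨h1, h2⟩ := h.reeb_spec x
  rw [VField.inChart_apply _ hx]
  refine ⟨(lam.apply_eq_inChart he hx _).symm.trans h1, fun w => ?_⟩
  obtain ⟨w', rfl⟩ := (mdifferentiable_of_mem_maximalAtlas he).mfderiv_surjective hx w
  exact (h.1.d_eq_inChart he hx _ w').symm.trans (h2 w')

theorem IsContactForm.eq_zero_inChart (h : IsContactForm lam)
    {e : OpenPartialHomeomorph M (Model n)}
    (he : e ∈ IsManifold.maximalAtlas (𝓡 (2 * n + 1)) ∞ M) {x : M} (hx : x ∈ e.source)
    {v : Model n} (h1 : lam.inChart e (e x) v = 0)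
    (h2 : ∀ w, skewBilin (fderiv ℝ (lam.inChart e) (e x)) v w = 0) : v = 0 := by
  obtain ⟨v', rfl⟩ := (mdifferentiable_of_mem_maximalAtlas he).mfderiv_surjective hx v
  have h3 : v' = 0 := h.eq_zero ((lam.apply_eq_inChart he hx v').trans h1)
    fun w => (h.1.d_eq_inChart he hx v' w).trans (h2 _)
  rw [h3]
  exact map_zero _

/-- `reeb` is chosen point by point, but in a chart it solves the linear equation `T R = lam` with
`T v = lam(v) lam + d lam(v, ·)`. The map `T` depends smoothly on the point. It is injective, as
seen by evaluating `T v` first on `R` and then on all vectors, hence invertible, and inversion is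
smooth. -/
theorem IsContactForm.isSmooth_reeb (h : IsContactForm lam) : VField.IsSmooth (reeb lam) := by
  intro x
  set e := chartAt (Model n) x with hc
  have he : e ∈ IsManifold.maximalAtlas (𝓡 (2 * n + 1)) ∞ M := chartAt_mem_maximalAtlas x
  have hx : x ∈ e.source := mem_chart_source _ x
  let l := lam.inChart e
  let T : Model n → Model n →L[ℝ] Model n →L[ℝ] ℝ := fun u =>
    (l u).smulRight (l u) + (fderiv ℝ l u - (fderiv ℝ l u).flip)
  have hl : ContDiffAt ℝ ∞ l (e x) := h.1.contDiffAt_inChart he hx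
  have hT : ContDiffAt ℝ ∞ T (e x) := by
    have h1 : ContDiffAt ℝ ∞ (fderiv ℝ l) (e x) := hl.fderiv_right (by simp)
    have hflip : ContDiff ℝ ∞ (fun B : Model n →L[ℝ] Model n →L[ℝ] ℝ => B.flip) := by
      refine contDiff_clm_apply_iff.2 fun v => contDiff_clm_apply_iff.2 fun w => ?_
      simp only [ContinuousLinearMap.flip_apply]
      fun_prop
    have h2 : ContDiffAt ℝ ∞ (fun u => (fderiv ℝ l u).flip) (e x) :=
      hflip.contDiffAt.comp (e x) h1
    exact (hl.smulRight hl).add (h1.sub h2)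
  have hTR : ∀ z ∈ e.source, T (e z) ((reeb lam).inChart e (e z)) = l (e z) := by
    intro z hz
    obtain ⟨h1, h2⟩ := h.reeb_inChart_spec he hz
    ext w
    have h3 : l (e z) ((reeb lam).inChart e (e z)) = 1 := h1
    have h4 := h2 w
    simp only [skewBilin, LinearMap.mk₂_apply] at h4
    simp [T, h3]
    exact h4
  have hTinj : ∀ z ∈ e.source, ∀ v, T (e z) v = 0 → v = 0 := by
    intro z hz v hv
    obtain ⟨h1, h2⟩ := h.reeb_inChart_spec he hz
    have h3 : l (e z) ((reeb lam).inChart e (e z)) = 1 := h1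
    have h5 := DFunLike.congr_fun hv ((reeb lam).inChart e (e z))
    have h6 := h2 v
    simp only [skewBilin, LinearMap.mk₂_apply] at h6
    have h7 : l (e z) v = 0 := by
      simp [T, h3] at h5
      linarith [show fderiv ℝ l (e z) ((reeb lam).inChart e (e z)) v -
        fderiv ℝ l (e z) v ((reeb lam).inChart e (e z)) = 0 from h6]
    refine h.eq_zero_inChart he hz h7 fun w => ?_
    have h8 := DFunLike.congr_fun hv w
    simp [T, h7] at h8
    exact h8
  have hTe : ∀ z ∈ e.source, ∃ L : Model n ≃L[ℝ] (Model n →L[ℝ] ℝ), (L : Model n →L[ℝ] _) = T (e z) := by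
    intro z hz
    have hinj : Function.Injective (T (e z)).toLinearMap :=
      (injective_iff_map_eq_zero _).2 (hTinj z hz)
    have hfin : Module.finrank ℝ (Model n) = Module.finrank ℝ (Model n →L[ℝ] ℝ) := by
      rw [← (LinearMap.toContinuousLinearMap (𝕜 := ℝ) (E := Model n) (F' := ℝ)).finrank_eq]
      exact (Subspace.dual_finrank_eq).symm
    refine ⟨(LinearEquiv.ofInjectiveOfFinrankEq _ hinj hfin).toContinuousLinearEquiv, ?_⟩
    ext v w; rfl
  have hR : (reeb lam).inChart e =ᶠ[𝓝 (e x)] fun u => (T u).inverse (l u) := by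
    filter_upwards [e.open_target.mem_nhds (e.map_source hx)] with u hu
    obtain ⟨z, hz, rfl⟩ : ∃ z ∈ e.source, u = e z :=
      ⟨e.symm u, e.map_target hu, (e.right_inv hu).symm⟩
    obtain ⟨L, hL⟩ := hTe z hz
    rw [← hTR z hz, ← hL, ContinuousLinearMap.inverse_equiv]
    simp
  refine ContDiffAt.congr_of_eventuallyEq ?_ hR
  obtain ⟨L, hL⟩ := hTe x hx
  have h1 : ContDiffAt ℝ ∞ (fun u => (T u).inverse) (e x) := by
    have := contDiffAt_map_inverse (n := ∞) L
    rw [hL] at this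
    exact this.comp (e x) hT
  exact h1.clm_apply hl

theorem VField.IsSmooth.const_smul {X : VField n M} (hX : X.IsSmooth) (c : ℝ) :
    VField.IsSmooth (fun x => c • X x) := by
  intro x
  refine (contDiffAt_const.smul (hX x) (f := fun _ => c)).congr_of_eventuallyEq
    (Filter.Eventually.of_forall fun u => ?_)
  exact map_smul _ c _

end VectorFields

/-! ### Derivatives along smooth curves of pairs; Cartan's formula on the manifold -/

section Curves

variable {n : ℕ} {M : Type*} [TopologicalSpace M] [ChartedSpace (Model n) M]
  [IsManifold (𝓡 (2 * n + 1)) ∞ M]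

/-- The derivative of a family of one-forms, in a chart. -/
theorem inChart_eq_fderiv_of_hasDerivAt {Λ : ℝ → OneForm n M} {Λ' : OneForm n M}
    (hΛ' : ∀ (y : M) (v : TangentSpace (𝓡 (2 * n + 1)) y),
      HasDerivAt (fun t => Λ t y v) (Λ' y v) 0)
    {e : OpenPartialHomeomorph M (Model n)} {u : Model n}
    (hB : DifferentiableAt ℝ (fun p : ℝ × Model n => (Λ p.1).inChart e p.2) (0, u)) :
    Λ'.inChart e u = fderiv ℝ (fun p : ℝ × Model n => (Λ p.1).inChart e p.2) (0, u) (1, 0) := by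
  ext w
  have h1 := (hasDerivAt_fst_of_contDiffAt hB).clm_apply (hasDerivAt_const (0 : ℝ) w)
  simp only [map_zero, add_zero] at h1
  exact (hΛ' (e.symm u) (mfderiv (𝓡 (2 * n + 1)) (𝓡 (2 * n + 1)) e.symm u w)).unique h1

/-- The exterior derivative of a family of one-forms may be differentiated in the parameter. -/
theorem hasDerivAt_d {Λ : ℝ → OneForm n M} {Λ' : OneForm n M}
    (hΛ' : ∀ (y : M) (v : TangentSpace (𝓡 (2 * n + 1)) y),
      HasDerivAt (fun t => Λ t y v) (Λ' y v) 0) {x : M}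
    (hB : ContDiffAt ℝ ∞ (fun p : ℝ × Model n => (Λ p.1).inChart (chartAt (Model n) x) p.2)
      (0, chartAt (Model n) x x)) (v w : TangentSpace (𝓡 (2 * n + 1)) x) :
    HasDerivAt (fun t => (Λ t).d x v w) (Λ'.d x v w) 0 := by
  set e := chartAt (Model n) x with he
  have hB2 : ContDiffAt ℝ 2 (fun p : ℝ × Model n => (Λ p.1).inChart e p.2) (0, e x) :=
    hB.of_le (by norm_cast)
  have h1 := hasDerivAt_fderiv_of_contDiffAt hB2
  have h2 : ∀ᶠ p : ℝ × Model n in 𝓝 (0, e x),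
      DifferentiableAt ℝ (fun p : ℝ × Model n => (Λ p.1).inChart e p.2) p :=
    (hB2.eventually (by simp)).mono fun p hp => hp.differentiableAt (by norm_num)
  have h3 : Λ'.inChart e =ᶠ[𝓝 (e x)]
      fun u => fderiv ℝ (fun p : ℝ × Model n => (Λ p.1).inChart e p.2) (0, u) (1, 0) := by
    have hc : Filter.Tendsto (fun u : Model n => ((0 : ℝ), u)) (𝓝 (e x)) (𝓝 (0, e x)) :=
      (Continuous.tendsto (by fun_prop) _)
    filter_upwards [hc.eventually h2] with u hu
    exact inChart_eq_fderiv_of_hasDerivAt hΛ' hu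
  rw [← h3.fderiv_eq] at h1
  have h4 : ∀ a b : Model n, HasDerivAt (fun t => fderiv ℝ ((Λ t).inChart e) (e x) a b)
      (fderiv ℝ (Λ'.inChart e) (e x) a b) 0 := fun a b => by
    simpa using (h1.clm_apply (hasDerivAt_const (0 : ℝ) a)).clm_apply (hasDerivAt_const (0 : ℝ) b)
  exact (h4 _ _).sub (h4 _ _)

/-- The differential of a function, as a one-form. -/
def dFun (H : M → ℝ) : OneForm n M := fun x => mfderiv (𝓡 (2 * n + 1)) 𝓘(ℝ, ℝ) H x

variable {δ : ℝ} {γ : ℝ → OneForm n M × Diffeo n M} {α : OneForm n M} {X : VField n M}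

/-- The velocity of a family of diffeomorphisms that starts at the identity, in a chart. -/
theorem HasVelocity.inChart_eq_fderiv (hv : HasVelocity γ α X) (hid : ∀ x, (γ 0).2 x = x)
    {e : OpenPartialHomeomorph M (Model n)}
    (he : e ∈ IsManifold.maximalAtlas (𝓡 (2 * n + 1)) ∞ M) {x : M} (hx : x ∈ e.source)
    (hG : DifferentiableAt ℝ (fun p : ℝ × Model n => e ((γ p.1).2 (e.symm p.2))) (0, e x)) :
    X.inChart e (e x) =
      fderiv ℝ (fun p : ℝ × Model n => e ((γ p.1).2 (e.symm p.2))) (0, e x) (1, 0) := by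
  have h0 := hasDerivAt_fst_of_contDiffAt hG
  simp only [e.left_inv hx] at h0
  have h1 := h0.hasFDerivAt.hasMFDerivAt
  have hx0 : (γ 0).2 x ∈ e.source := by rwa [hid]
  have h2 := HasMFDerivAt.comp (0 : ℝ)
    ((mdifferentiable_of_mem_maximalAtlas he).mdifferentiableAt hx0).hasMFDerivAt (hv.diffeo x)
  have h3 := DFunLike.congr_fun (hasMFDerivAt_unique h2 h1) (1 : ℝ)
  have h4 : ∀ z : M, z = x → (mfderiv (𝓡 (2 * n + 1)) (𝓡 (2 * n + 1)) e z (X z) : Model n) =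
      mfderiv (𝓡 (2 * n + 1)) (𝓡 (2 * n + 1)) e x (X x) := by
    rintro z rfl; rfl
  rw [X.inChart_apply hx, ← h4 _ (hid x)]
  have h5 : (mfderiv (𝓡 (2 * n + 1)) (𝓡 (2 * n + 1)) e ((γ 0).2 x)
      ((1 : ℝ) • X ((γ 0).2 x)) : Model n) = (1 : ℝ) • (fderiv ℝ
        (fun p : ℝ × Model n => e ((γ p.1).2 (e.symm p.2))) (0, e x) (1, 0)) := h3
  rwa [one_smul, one_smul] at h5

theorem IsSmoothCurve.contDiffAt_diffeo (hγ : IsSmoothCurve δ γ) (hδ : 0 < δ)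
    (hid : ∀ x, (γ 0).2 x = x) {e : OpenPartialHomeomorph M (Model n)}
    (he : e ∈ IsManifold.maximalAtlas (𝓡 (2 * n + 1)) ∞ M) {x : M} (hx : x ∈ e.source) :
    ContDiffAt ℝ ∞ (fun p : ℝ × Model n => e ((γ p.1).2 (e.symm p.2))) (0, e x) :=
  contDiffAt_chart_family (f := fun t x => (γ t).2 x) hγ.diffeo he he ⟨by linarith, hδ⟩ (e.map_source hx)
    (by rwa [hid, e.left_inv hx])

theorem IsSmoothCurve.contDiffAt_form (hγ : IsSmoothCurve δ γ) (hδ : 0 < δ) (x : M) :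
    ContDiffAt ℝ ∞ (fun p : ℝ × Model n => (γ p.1).1.inChart (chartAt (Model n) x) p.2)
      (0, chartAt (Model n) x x) :=
  contDiffAt_inChart_chartAt (Λ := fun t => (γ t).1) hγ.form ⟨by linarith, hδ⟩ x

/-- The velocity of a smooth family of diffeomorphisms is a smooth vector field. -/
theorem IsSmoothCurve.isSmooth_velocity (hγ : IsSmoothCurve δ γ) (hδ : 0 < δ)
    (hv : HasVelocity γ α X) (hid : ∀ x, (γ 0).2 x = x) : X.IsSmooth := by
  intro x
  set e := chartAt (Model n) x with he
  have hem : e ∈ IsManifold.maximalAtlas (𝓡 (2 * n + 1)) ∞ M := chartAt_mem_maximalAtlas x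
  have hx : x ∈ e.source := mem_chart_source _ x
  have hG := hγ.contDiffAt_diffeo hδ hid hem hx
  have h1 : ContDiffAt ℝ ∞ (fun u : Model n =>
      fderiv ℝ (fun p : ℝ × Model n => e ((γ p.1).2 (e.symm p.2))) (0, u) (1, 0)) (e x) := by
    have h2 := hG.fderiv_right (m := ∞) (by simp)
    exact (h2.comp (e x) (contDiff_prodMk_right (0 : ℝ)).contDiffAt).clm_apply contDiffAt_const
  refine h1.congr_of_eventuallyEq ?_
  filter_upwards [e.open_target.mem_nhds (e.map_source hx)] with u hu
  obtain ⟨z, hz, rfl⟩ : ∃ z ∈ e.source, u = e z :=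
    ⟨e.symm u, e.map_target hu, (e.right_inv hu).symm⟩
  exact hv.inChart_eq_fderiv hid hem hz
    ((hγ.contDiffAt_diffeo hδ hid hem hz).differentiableAt (by simp))

theorem IsSmoothCurve.eventually_pullback_inChart (hγ : IsSmoothCurve δ γ) (hδ : 0 < δ)
    (hid : ∀ x, (γ 0).2 x = x) {e : OpenPartialHomeomorph M (Model n)}
    (he : e ∈ IsManifold.maximalAtlas (𝓡 (2 * n + 1)) ∞ M) {x : M} (hx : x ∈ e.source) :
    ∀ᶠ p : ℝ × Model n in 𝓝 (0, e x), (pullback (γ p.1).2 (γ p.1).1).inChart e p.2 =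
      ((γ p.1).1.inChart e (e ((γ p.1).2 (e.symm p.2)))).comp
        (fderiv ℝ (fun u => e ((γ p.1).2 (e.symm u))) p.2) := by
  have h0 : ContinuousAt (fun p : ℝ × M => (γ p.1).2 p.2) (0, x) :=
    (hγ.diffeo.contMDiffAt (prod_mem_nhds (isOpen_Ioo.mem_nhds ⟨by linarith, hδ⟩)
      Filter.univ_mem)).continuousAt
  have h1 : ContinuousAt (fun p : ℝ × Model n => (p.1, e.symm p.2)) (0, e x) :=
    continuousAt_fst.prodMk (ContinuousAt.comp (f := Prod.snd) (g := e.symm)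
      (e.continuousAt_symm (e.map_source hx)) continuousAt_snd)
  have h2 : ContinuousAt (fun p : ℝ × Model n => (γ p.1).2 (e.symm p.2)) (0, e x) :=
    ContinuousAt.comp_of_eq h0 h1 (by simp [e.left_inv hx])
  have h3 : ∀ᶠ p : ℝ × Model n in 𝓝 (0, e x), (γ p.1).2 (e.symm p.2) ∈ e.source :=
    h2.eventually (e.open_source.mem_nhds (by simpa [hid, e.left_inv hx]))
  have h4 : ∀ᶠ p : ℝ × Model n in 𝓝 (0, e x), p.2 ∈ e.target :=
    continuousAt_snd.eventually (e.open_target.mem_nhds (e.map_source hx))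
  filter_upwards [h3, h4] with p hp hp'
  exact pullback_inChart _ _ he he hp' hp

/-- The pull-backs of a smooth family of one-forms by a smooth family of diffeomorphisms form a
smooth family. -/
theorem IsSmoothCurve.contDiffAt_pullback (hγ : IsSmoothCurve δ γ) (hδ : 0 < δ)
    (hid : ∀ x, (γ 0).2 x = x) (x : M) :
    ContDiffAt ℝ ∞ (fun p : ℝ × Model n =>
      (pullback (γ p.1).2 (γ p.1).1).inChart (chartAt (Model n) x) p.2)
      (0, chartAt (Model n) x x) := by
  set e := chartAt (Model n) x with he
  have hem : e ∈ IsManifold.maximalAtlas (𝓡 (2 * n + 1)) ∞ M := chartAt_mem_maximalAtlas x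
  have hx : x ∈ e.source := mem_chart_source _ x
  have hG := hγ.contDiffAt_diffeo hδ hid hem hx
  have hL := hγ.contDiffAt_form hδ x
  refine ContDiffAt.congr_of_eventuallyEq ?_ (hγ.eventually_pullback_inChart hδ hid hem hx)
  have h1 : ContDiffAt ℝ ∞ (fun p : ℝ × Model n =>
      (γ p.1).1.inChart e (e ((γ p.1).2 (e.symm p.2)))) (0, e x) := by
    have h2 : ContDiffAt ℝ ∞ (fun p : ℝ × Model n => (p.1, e ((γ p.1).2 (e.symm p.2)))) (0, e x) :=
      contDiffAt_fst.prodMk hG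
    refine ContDiffAt.comp (g := fun p : ℝ × Model n => (γ p.1).1.inChart e p.2) (0, e x) ?_ h2
    simpa only [hid, e.left_inv hx] using hL
  have h3 : ContDiffAt ℝ ∞ (fun p : ℝ × Model n =>
      fderiv ℝ (fun u => e ((γ p.1).2 (e.symm u))) p.2) (0, e x) := by
    have h4 : ContDiffAt ℝ ∞ (fun p : ℝ × Model n =>
        (fderiv ℝ (fun p : ℝ × Model n => e ((γ p.1).2 (e.symm p.2))) p).comp
          (ContinuousLinearMap.inr ℝ ℝ (Model n))) (0, e x) :=
      (hG.fderiv_right (by simp)).clm_comp contDiffAt_const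
    refine h4.congr_of_eventuallyEq ?_
    filter_upwards [(hG.of_le (by simp : (1 : WithTop ℕ∞) ≤ ∞)).eventually (by simp)] with p hp
    exact (HasFDerivAt.comp (g := fun p : ℝ × Model n => e ((γ p.1).2 (e.symm p.2)))
      (f := fun u => (p.1, u)) p.2 (hp.differentiableAt (by norm_num)).hasFDerivAt
      (hasFDerivAt_prodMk_right p.1 p.2)).fderiv
  exact h1.clm_comp h3

/-- **Cartan's formula**: the derivative of `χ_t^* lam_t` at `t = 0`, for a smooth family `χ` that
starts at the identity. -/
theorem IsSmoothCurve.hasDerivAt_pullback (hγ : IsSmoothCurve δ γ) (hδ : 0 < δ)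
    (hv : HasVelocity γ α X) (hid : ∀ x, (γ 0).2 x = x) (hs : (γ 0).1.IsSmooth) :
    ContMDiff (𝓡 (2 * n + 1)) 𝓘(ℝ, ℝ) ∞ (fun x => (γ 0).1 x (X x)) ∧
    ∀ (x : M) (v : TangentSpace (𝓡 (2 * n + 1)) x),
      HasDerivAt (fun t => pullback (γ t).2 (γ t).1 x v)
        (α x v + (γ 0).1.d x (X x) v +
          dFun (fun y => (γ 0).1 y (X y)) x v) 0 := by
  have hX := hγ.isSmooth_velocity hδ hv hid
  have hHe : ∀ {e : OpenPartialHomeomorph M (Model n)}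
      (_ : e ∈ IsManifold.maximalAtlas (𝓡 (2 * n + 1)) ∞ M) {u : Model n} (_ : u ∈ e.target),
      (γ 0).1 (e.symm u) (X (e.symm u)) = (γ 0).1.inChart e u (X.inChart e u) := by
    intro e he u hu
    obtain ⟨z, hz, rfl⟩ : ∃ z ∈ e.source, u = e z :=
      ⟨e.symm u, e.map_target hu, (e.right_inv hu).symm⟩
    rw [e.left_inv hz, X.inChart_apply hz]
    exact (γ 0).1.apply_eq_inChart he hz (X z)
  have hH : ContMDiff (𝓡 (2 * n + 1)) 𝓘(ℝ, ℝ) ∞ (fun x => (γ 0).1 x (X x)) := by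
    refine contMDiff_of_contDiffAt_chart fun x => ?_
    have hem := chartAt_mem_maximalAtlas (n := n) x
    have hx := mem_chart_source (Model n) x
    refine ((hs.contDiffAt_inChart hem hx).clm_apply (hX x)).congr_of_eventuallyEq ?_
    filter_upwards [(chartAt (Model n) x).open_target.mem_nhds
      ((chartAt (Model n) x).map_source hx)] with u hu
    exact hHe hem hu
  refine ⟨hH, fun x v => ?_⟩
  set e := chartAt (Model n) x with he
  have hem : e ∈ IsManifold.maximalAtlas (𝓡 (2 * n + 1)) ∞ M := chartAt_mem_maximalAtlas x
  have hx : x ∈ e.source := mem_chart_source _ x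
  have hG := hγ.contDiffAt_diffeo hδ hid hem hx
  have hL := hγ.contDiffAt_form hδ x
  obtain ⟨v', hv'⟩ : ∃ v' : Model n, v' = mfderiv (𝓡 (2 * n + 1)) (𝓡 (2 * n + 1)) e x v := ⟨_, rfl⟩
  have key := hasDerivAt_pullback_family (hG.of_le (by norm_cast)) (hL.of_le (by simp))
    (by
      filter_upwards [e.open_target.mem_nhds (e.map_source hx)] with y hy
      simp [hid, e.right_inv hy]) v'
  have h1 : (fun t => pullback (γ t).2 (γ t).1 x v) =ᶠ[𝓝 0] fun t =>
      (γ t).1.inChart e (e ((γ t).2 (e.symm (e x))))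
        (fderiv ℝ (fun u => e ((γ t).2 (e.symm u))) (e x) v') := by
    have hc : Filter.Tendsto (fun t : ℝ => (t, e x)) (𝓝 0) (𝓝 (0, e x)) :=
      (Continuous.tendsto (by fun_prop) _)
    filter_upwards [hc.eventually (hγ.eventually_pullback_inChart hδ hid hem hx)] with t ht
    rw [(pullback (γ t).2 (γ t).1).apply_eq_inChart hem hx v, ← hv', ht]
    rfl
  have hα : fderiv ℝ (fun p : ℝ × Model n => (γ p.1).1.inChart e p.2) (0, e x) (1, 0) v' = α x v := by
    rw [← inChart_eq_fderiv_of_hasDerivAt (Λ := fun t => (γ t).1) hv.form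
      (hL.differentiableAt (by simp)), hv']
    exact (α.apply_eq_inChart hem hx v).symm
  have hXG : ∀ u ∈ e.target, X.inChart e u =
      fderiv ℝ (fun p : ℝ × Model n => e ((γ p.1).2 (e.symm p.2))) (0, u) (1, 0) := by
    intro u hu
    obtain ⟨z, hz, rfl⟩ : ∃ z ∈ e.source, u = e z :=
      ⟨e.symm u, e.map_target hu, (e.right_inv hu).symm⟩
    exact hv.inChart_eq_fderiv hid hem hz
      ((hγ.contDiffAt_diffeo hδ hid hem hz).differentiableAt (by simp))
  have hd : fderiv ℝ ((γ 0).1.inChart e) (e x)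
        (fderiv ℝ (fun p : ℝ × Model n => e ((γ p.1).2 (e.symm p.2))) (0, e x) (1, 0)) v' -
      fderiv ℝ ((γ 0).1.inChart e) (e x) v'
        (fderiv ℝ (fun p : ℝ × Model n => e ((γ p.1).2 (e.symm p.2))) (0, e x) (1, 0)) =
      (γ 0).1.d x (X x) v := by
    rw [← hXG _ (e.map_source hx), X.inChart_apply hx, hv']
    rfl
  have hm : fderiv ℝ (fun y => (γ 0).1.inChart e y
        (fderiv ℝ (fun p : ℝ × Model n => e ((γ p.1).2 (e.symm p.2))) (0, y) (1, 0))) (e x) v' =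
      dFun (fun y => (γ 0).1 y (X y)) x v := by
    refine Eq.trans ?_ (fderiv_chart_symm hH hem hx v)
    rw [hv']
    refine DFunLike.congr_fun (Filter.EventuallyEq.fderiv_eq ?_) _
    filter_upwards [e.open_target.mem_nhds (e.map_source hx)] with u hu
    rw [hHe hem hu, hXG u hu]
  convert! key.congr_of_eventuallyEq h1 using 1
  rw [hα, ← hd, ← hm]

end Curves

theorem differentiableAt_fderiv_fst {E F : Type*} [NormedAddCommGroup E] [NormedSpace ℝ E]
    [NormedAddCommGroup F] [NormedSpace ℝ F] {B : ℝ × E → F} {t : ℝ} {y : E}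
    (hB : ContDiffAt ℝ ∞ B (t, y)) : DifferentiableAt ℝ (fun u => fderiv ℝ B (t, u) (1, 0)) y := by
  have h2 : DifferentiableAt ℝ (fderiv ℝ B) (t, y) :=
    (hB.fderiv_right (m := ∞) (by simp)).differentiableAt (by simp)
  have hj : DifferentiableAt ℝ (fun u : E => (t, u)) y :=
    (hasFDerivAt_prodMk_right t y).differentiableAt
  have h3 : DifferentiableAt ℝ (fun u : E => fderiv ℝ B (t, u)) y :=
    DifferentiableAt.comp y h2 hj
  exact h3.clm_apply (differentiableAt_const _)

/-! ### Kernel vectors with vanishing form part are multiples of the Reeb field -/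

section Kernel

variable {n : ℕ} {M : Type*} [TopologicalSpace M] [ChartedSpace (Model n) M]
  [IsManifold (𝓡 (2 * n + 1)) ∞ M] {lam : OneForm n M}

/-- The derivative of the volume form along a family of one-forms that starts at a contact form
`lam` with velocity `h lam`. -/
theorem IsContactForm.hasDerivAt_volForm (hlam : IsContactForm lam) {Λ : ℝ → OneForm n M}
    {h : M → ℝ} (hΛ0 : Λ 0 = lam)
    (hΛ' : ∀ (y : M) (v : TangentSpace (𝓡 (2 * n + 1)) y),
      HasDerivAt (fun t => Λ t y v) (h y * lam y v) 0) {x : M}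
    (hB : ContDiffAt ℝ ∞ (fun p : ℝ × Model n => (Λ p.1).inChart (chartAt (Model n) x) p.2)
      (0, chartAt (Model n) x x)) (v : Fin (2 * n + 1) → TangentSpace (𝓡 (2 * n + 1)) x) :
    HasDerivAt (fun t => (Λ t).volForm x v) ((n + 1) * h x * lam.volForm x v) 0 := by
  set e := chartAt (Model n) x with he
  have hem : e ∈ IsManifold.maximalAtlas (𝓡 (2 * n + 1)) ∞ M := chartAt_mem_maximalAtlas x
  have hx : x ∈ e.source := mem_chart_source _ x
  let Λ' : OneForm n M := fun y => h y • lam y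
  have hΛ'' : ∀ (y : M) (v : TangentSpace (𝓡 (2 * n + 1)) y),
      HasDerivAt (fun t => Λ t y v) (Λ' y v) 0 := hΛ'
  have hl : ContDiffAt ℝ ∞ (lam.inChart e) (e x) := hlam.1.contDiffAt_inChart hem hx
  have hΛe : ∀ u, Λ'.inChart e u = h (e.symm u) • lam.inChart e u := fun u => rfl
  -- `h` is only given pointwise. It is the quotient of the velocity of `Λ` and of `lam` on a fixed
  -- vector `v₀` with `lam v₀ ≠ 0` near the point, and so it is differentiable.
  have hh : DifferentiableAt ℝ (fun u => h (e.symm u)) (e x) := by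
    obtain ⟨v₀, hv₀⟩ : ∃ v₀ : Model n, lam.inChart e (e x) v₀ ≠ 0 :=
      ⟨_, by rw [(hlam.reeb_inChart_spec hem hx).1]; exact one_ne_zero⟩
    let B : ℝ × Model n → Model n →L[ℝ] ℝ := fun p => (Λ p.1).inChart e p.2
    have h1 : DifferentiableAt ℝ (fun u => fderiv ℝ B (0, u) (1, 0) v₀ * (lam.inChart e u v₀)⁻¹)
        (e x) := by
      refine DifferentiableAt.fun_mul ?_ (DifferentiableAt.fun_inv ?_ hv₀)
      · exact (differentiableAt_fderiv_fst hB).clm_apply (differentiableAt_const _)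
      · exact (hl.differentiableAt (by simp)).clm_apply (differentiableAt_const _)
    refine h1.congr_of_eventuallyEq ?_
    have h4 : ∀ᶠ p : ℝ × Model n in 𝓝 (0, e x), DifferentiableAt ℝ B p :=
      ((hB.of_le (by simp : (1 : WithTop ℕ∞) ≤ ∞)).eventually (by simp)).mono
        fun p hp => hp.differentiableAt (by norm_num)
    have hc : Filter.Tendsto (fun u : Model n => ((0 : ℝ), u)) (𝓝 (e x)) (𝓝 (0, e x)) :=
      (Continuous.tendsto (by fun_prop) _)
    have h5 : ∀ᶠ u in 𝓝 (e x), lam.inChart e u v₀ ≠ 0 :=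
      (hl.continuousAt.clm_apply continuousAt_const).eventually_ne hv₀
    filter_upwards [hc.eventually h4, h5] with u hu hu'
    rw [← inChart_eq_fderiv_of_hasDerivAt hΛ'' hu, hΛe]
    simp [hu']
  -- This is `d(h lam) = dh ∧ lam + h d lam`, the shape that `hasDerivAt_wedgePow` expects with `k =
  -- dh`.
  have hd : ∀ v w : TangentSpace (𝓡 (2 * n + 1)) x, Λ'.d x v w =
      fderiv ℝ (fun u => h (e.symm u)) (e x) (mfderiv (𝓡 (2 * n + 1)) (𝓡 (2 * n + 1)) e x v) *
          lam x w -
        fderiv ℝ (fun u => h (e.symm u)) (e x) (mfderiv (𝓡 (2 * n + 1)) (𝓡 (2 * n + 1)) e x w) *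
          lam x v + h x * lam.d x v w := by
    intro v w
    have h1 : Λ'.inChart e = fun u => h (e.symm u) • lam.inChart e u := funext hΛe
    have h2 := (hh.hasFDerivAt.smul (hl.differentiableAt (by simp)).hasFDerivAt).fderiv
    have h3 : ∀ a b : Model n, fderiv ℝ (Λ'.inChart e) (e x) a b - fderiv ℝ (Λ'.inChart e) (e x) b a
        = fderiv ℝ (fun u => h (e.symm u)) (e x) a * lam.inChart e (e x) b -
          fderiv ℝ (fun u => h (e.symm u)) (e x) b * lam.inChart e (e x) a +
          h x * (fderiv ℝ (lam.inChart e) (e x) a b - fderiv ℝ (lam.inChart e) (e x) b a) := by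
      intro a b
      rw [h1]
      erw [h2]
      simp [e.left_inv hx]
      ring
    rw [lam.apply_eq_inChart hem hx v, lam.apply_eq_inChart hem hx w]
    exact h3 _ _
  have h1 := hasDerivAt_d hΛ'' hB
  subst hΛ0
  exact hasDerivAt_wedgePow (V := TangentSpace (𝓡 (2 * n + 1)) x) (a := fun t w => Λ t x w)
    (η := fun t => (Λ t).d x) (k := fun w => fderiv ℝ (fun u => h (e.symm u)) (e x)
      (mfderiv (𝓡 (2 * n + 1)) (𝓡 (2 * n + 1)) e x w)) (hΛ' x)
    (fun v w => (h1 v w).congr_deriv (hd v w)) v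

theorem pullback_trans (φ χ : Diffeo n M) (α : OneForm n M) :
    pullback (φ.trans χ) α = pullback φ (pullback χ α) := by
  funext x
  have h : mfderiv (𝓡 (2 * n + 1)) (𝓡 (2 * n + 1)) (φ.trans χ) x =
      (mfderiv (𝓡 (2 * n + 1)) (𝓡 (2 * n + 1)) χ (φ x)).comp
        (mfderiv (𝓡 (2 * n + 1)) (𝓡 (2 * n + 1)) φ x) :=
    mfderiv_comp x (χ.contMDiff.mdifferentiable (by simp) _)
      (φ.contMDiff.mdifferentiable (by simp) _)
  unfold pullback
  rw [h]
  rfl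

/-- If the derivative of `Φ` along a curve with `α = 0` vanishes, then the derivative of
`ψ_t^* lam_t` is a multiple of `lam`. -/
theorem exists_smul_of_hasDerivAt_Phi (hlam : IsContactForm lam)
    {γ : ℝ → OneForm n M × Diffeo n M} (h0 : (γ 0).1 = lam) {x : M}
    (hl : ∀ v : TangentSpace (𝓡 (2 * n + 1)) x, HasDerivAt (fun t => (γ t).1 x v) 0 0)
    {b' : TangentSpace (𝓡 (2 * n + 1)) x → ℝ}
    (hb : ∀ v, HasDerivAt (fun t => pullback (γ t).2 (γ t).1 x v) (b' v) 0)
    (hΦ : ∀ v : TangentSpace (𝓡 (2 * n + 1)) x,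
      HasDerivAt (fun t : ℝ => Phi (γ t).1 (γ t).2 x v) 0 0) :
    ∃ c : ℝ, ∀ v, b' v = c * lam x v := by
  set v₀ := reeb lam x with hv₀
  have h1 : lam x v₀ = 1 := (hlam.reeb_spec x).1
  let c : ℝ → ℝ := fun t => pullback (γ t).2 (γ t).1 x (reeb (γ t).1 x)
  have hPhi : ∀ t v, Phi (γ t).1 (γ t).2 x v = pullback (γ t).2 (γ t).1 x v - c t * (γ t).1 x v :=
    fun t v => rfl
  have hne : ∀ᶠ t in 𝓝 0, (γ t).1 x v₀ ≠ 0 :=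
    (hl v₀).continuousAt.eventually_ne (by rw [h0, h1]; exact one_ne_zero)
  -- No differentiability of the Reeb field in `t` is used: evaluation on the fixed vector `v₀`,
  -- where `lam_t` does not vanish for small `t`, expresses `c` by differentiable functions.
  have hc : ∃ c', HasDerivAt c c' 0 := by
    refine ⟨_, HasDerivAt.congr_of_eventuallyEq (((hb v₀).sub (hΦ v₀)).fun_div (hl v₀)
      (by rw [h0, h1]; exact one_ne_zero)) ?_⟩
    filter_upwards [hne] with t ht
    simp only [hPhi, Pi.sub_apply]
    field_simp
    ring
  obtain ⟨c', hc'⟩ := hc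
  refine ⟨c', fun v => ?_⟩
  have h2 := (hΦ v).add (hc'.mul (hl v))
  have h3 : ((fun t : ℝ => Phi (γ t).1 (γ t).2 x v) + (c * fun t => (γ t).1 x v)) =
      fun t => pullback (γ t).2 (γ t).1 x v := by
    funext t; simp [hPhi]
  rw [h3] at h2
  rw [(hb v).unique h2, h0]
  ring

/-- The constant is the mean of `H`. The zero measure is separated because the mean divides by the
total mass. -/
theorem exists_integral_sub_const_eq_zero {Ω : Type*} [MeasurableSpace Ω] (μ : Measure Ω)
    [IsFiniteMeasure μ] {H : Ω → ℝ} (hH : Integrable H μ) : ∃ c : ℝ, ∫ x, (H x - c) ∂μ = 0 := by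
  rcases eq_or_ne μ 0 with rfl | hμ
  · exact ⟨0, by simp⟩
  · have : NeZero μ := ⟨hμ⟩
    refine ⟨(∫ x, H x ∂μ) / μ.real univ, ?_⟩
    rw [integral_sub hH (integrable_const _), integral_const, smul_eq_mul, mul_div_cancel₀, sub_self]
    exact (measureReal_univ_pos).ne'

variable [MeasurableSpace M]

/-- The form part of a curve in the kernel of `DΦ` being constant to first order, the derivative
of `ψ_t^* lam_t` vanishes, and so `X` preserves `lam`. -/
theorem mem_reebPairs_of_mem_kerDPhi [CompactSpace M] [BorelSpace M]
    [IsFiniteMeasure (contactMeasure lam)] (hlam : IsNonProjectible lam)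
    {ψ : Diffeo n M} (hψ : IsStrictContactPair lam ψ) {u : OneForm n M × VField n M}
    (hu : u ∈ kerDPhi lam ψ) (hα : u.1 = 0) : u ∈ reebPairs lam := by
  obtain ⟨α, X⟩ := u
  obtain ⟨δ, γ, hδ, hγ, h0, hS, hv, hΦ⟩ := hu
  simp only at hα hv
  subst hα
  have h01 : (γ 0).1 = lam := by rw [h0]
  have h02 : (γ 0).2 = ψ := by rw [h0]
  -- Composition with `ψ⁻¹` on the right makes the curve start at the identity. The velocity `X` is
  -- unchanged, since it is already expressed by right translation.
  let γ' : ℝ → OneForm n M × Diffeo n M := fun t => ((γ t).1, ψ.symm.trans (γ t).2)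
  have hid : ∀ x, (γ' 0).2 x = x := fun x => by
    change (γ 0).2 (ψ.symm x) = x
    rw [h02]; exact ψ.apply_symm_apply x
  have hγ' : IsSmoothCurve δ γ' := by
    refine ⟨hγ.form, ?_⟩
    have h1 : ContMDiff (𝓘(ℝ, ℝ).prod (𝓡 (2 * n + 1))) (𝓘(ℝ, ℝ).prod (𝓡 (2 * n + 1))) ∞
        (fun p : ℝ × M => (p.1, ψ.symm p.2)) :=
      contMDiff_fst.prodMk (ψ.symm.contMDiff.comp contMDiff_snd)
    exact hγ.diffeo.comp h1.contMDiffOn fun p hp => ⟨hp.1, mem_univ _⟩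
  have hv' : HasVelocity γ' 0 X := ⟨hv.form, fun x => hv.diffeo (ψ.symm x)⟩
  have htrans : ∀ t, ψ.trans (γ' t).2 = (γ t).2 := fun t => by
    ext x
    change (γ t).2 (ψ.symm (ψ x)) = _
    rw [ψ.symm_apply_apply]
  obtain ⟨hH, hcartan⟩ := hγ'.hasDerivAt_pullback hδ hv' hid
    (show (γ 0).1.IsSmooth by rw [h01]; exact hlam.1.1)
  have hγ'01 : (γ' 0).1 = lam := h01
  rw [hγ'01] at hH hcartan
  set H : M → ℝ := fun x => lam x (X x) with hHdef
  have hpull : ∀ t (x : M) (v : TangentSpace (𝓡 (2 * n + 1)) x), pullback (γ t).2 (γ t).1 x v =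
      pullback (γ' t).2 (γ' t).1 (ψ x) (mfderiv (𝓡 (2 * n + 1)) (𝓡 (2 * n + 1)) ψ x v) := by
    intro t x v
    rw [← htrans t, pullback_trans]
    rfl
  have hsurj : ∀ x, Function.Surjective (mfderiv (𝓡 (2 * n + 1)) (𝓡 (2 * n + 1)) ψ x) := fun x =>
    (ψ.mfderivToContinuousLinearEquiv (by simp) x).surjective
  -- the derivative of the pull-backs is a multiple of `lam`
  have hconf : ∀ y : M, ∃ c : ℝ, ∀ w : TangentSpace (𝓡 (2 * n + 1)) y,
      lam.d y (X y) w + dFun H y w = c * lam y w := by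
    intro y
    obtain ⟨x, hx⟩ : ∃ x, ψ x = y := ψ.surjective y
    subst hx
    obtain ⟨c, hc⟩ := exists_smul_of_hasDerivAt_Phi hlam.1 h01 (x := x)
      (fun v => hv.form x v) (fun v => by
        have := hcartan (ψ x) (mfderiv (𝓡 (2 * n + 1)) (𝓡 (2 * n + 1)) ψ x v)
        simp only [← hpull] at this
        exact this) (hΦ x)
    refine ⟨c, fun w => ?_⟩
    obtain ⟨v, rfl⟩ := hsurj x w
    have h1 := hc v
    have h2 : lam x v = lam (ψ x) (mfderiv (𝓡 (2 * n + 1)) (𝓡 (2 * n + 1)) ψ x v) := by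
      conv_lhs => rw [← hψ.2]
      rfl
    rw [h2] at h1
    rw [← h1, Pi.zero_apply, zero_apply, zero_add]
  choose h hh using hconf
  have hθ' : ∀ (y : M) (w : TangentSpace (𝓡 (2 * n + 1)) y),
      HasDerivAt (fun t => pullback (γ' t).2 (γ' t).1 y w) (h y * lam y w) 0 := fun y w => by
    have := hcartan y w
    rwa [Pi.zero_apply, zero_apply, zero_add, hh] at this
  have hθ0 : pullback (γ' 0).2 (γ' 0).1 = lam := by
    have : (γ' 0).2 = Diffeomorph.refl (𝓡 (2 * n + 1)) M ∞ := Diffeomorph.ext hid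
    rw [this, pullback_refl, hγ'01]
  -- the multiple vanishes by incompressibility
  have hh0 : ∀ y, h y = 0 := by
    intro y
    obtain ⟨x, hx⟩ : ∃ x, ψ x = y := ψ.surjective y
    subst hx
    obtain ⟨v, hvne⟩ := hlam.1.2 x
    have h1 := hlam.1.hasDerivAt_volForm hθ0 hθ' (hγ'.contDiffAt_pullback hδ hid (ψ x))
      (fun i => mfderiv (𝓡 (2 * n + 1)) (𝓡 (2 * n + 1)) ψ x (v i))
    -- The same formula with `h = 0`: as `α = 0`, the volume forms of `lam_t` are stationary at `t =
    -- 0`.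
    have h2 := hlam.1.hasDerivAt_volForm (Λ := fun t => (γ t).1) (h := fun _ => 0) h01
      (fun y w => by simpa using hv.form y w) (hγ.contDiffAt_form hδ x) v
    rw [hψ.isIncompressible] at h1
    -- Incompressibility of `ψ_t` identifies the two families of volume forms for small `t`, so `(n
    -- + 1) h μ = 0`.
    have h3 : (fun t => (pullback (γ' t).2 (γ' t).1).volForm (ψ x)
        (fun i => mfderiv (𝓡 (2 * n + 1)) (𝓡 (2 * n + 1)) ψ x (v i))) =ᶠ[𝓝 0]
        fun t => (γ t).1.volForm x v := by
      filter_upwards [isOpen_Ioo.mem_nhds (⟨by linarith, hδ⟩ : (0 : ℝ) ∈ Ioo (-δ) δ)] with t ht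
      have hs : (γ t).1.IsSmooth := (hS t ht).1.1.1
      rw [← (hS t ht).2 x v, OneForm.IsSmooth.volForm_pullback (α := (γ' t).1) hs]
      have h4 : ∀ w, mfderiv (𝓡 (2 * n + 1)) (𝓡 (2 * n + 1)) (ψ.trans (γ' t).2) x w =
          mfderiv (𝓡 (2 * n + 1)) (𝓡 (2 * n + 1)) (γ' t).2 (ψ x)
            (mfderiv (𝓡 (2 * n + 1)) (𝓡 (2 * n + 1)) ψ x w) := fun w =>
        DFunLike.congr_fun (mfderiv_comp x ((γ' t).2.contMDiff.mdifferentiable (by simp) _)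
          (ψ.contMDiff.mdifferentiable (by simp) _)) w
      rw [← htrans t]
      simp only [h4]
      rfl
    have h5 := (h2.congr_of_eventuallyEq h3).unique h1
    have h6 : ((n : ℝ) + 1) ≠ 0 := by positivity
    simpa [hvne, h6] using h5
  have hX : ∀ (y : M) (w : TangentSpace (𝓡 (2 * n + 1)) y),
      lam.d y (X y) w + dFun H y w = 0 := fun y w => by rw [hh, hh0, zero_mul]
  -- `H` is constant along the Reeb flow, so it is constant
  have hR : ∀ y, dFun H y (reeb lam y) = 0 := fun y => by
    have h1 := hX y (reeb lam y)
    rw [lam.d_skew, (hlam.1.reeb_spec y).2] at h1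
    simpa using h1
  obtain ⟨c, hc⟩ := exists_integral_sub_const_eq_zero (contactMeasure lam) (H := H)
    (hH.continuous.integrable_of_hasCompactSupport (HasCompactSupport.of_compactSpace _))
  have hd : ∀ y, dFun (fun x => H x - c) y = dFun (n := n) H y := fun y => by
    have h1 := (hH.mdifferentiable (by simp) y).hasMFDerivAt
    have h2 := h1.sub (hasMFDerivAt_const c y)
    exact h2.mfderiv.trans (sub_zero _)
  have hHc := hlam.2 (fun x => H x - c) (hH.sub contMDiff_const)
    (fun y => by have := hR y; rw [← hd] at this; exact this) hc
  have hHc' : ∀ y, H y = c := fun y => sub_eq_zero.1 (congrFun hHc y)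
  refine ⟨c, Prod.ext rfl (funext fun y => hlam.1.eq_smul_reeb (hHc' y) fun w => ?_)⟩
  have h1 := hX y w
  have h2 : dFun (n := n) H y w = 0 := by
    rw [← hd, hHc]
    exact DFunLike.congr_fun (mfderiv_const (I := 𝓡 (2 * n + 1)) (I' := 𝓘(ℝ, ℝ)) (x := y)
      (c := (0 : ℝ))) w
  rwa [h2, add_zero] at h1

end Kernel

/-! ### Finiteness of the contact measure -/

section Volume

variable {n : ℕ} {M : Type*} [TopologicalSpace M] [ChartedSpace (Model n) M]
  [IsManifold (𝓡 (2 * n + 1)) ∞ M] {lam : OneForm n M}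

/-- The expression of the volume form of `lam` in the chart `e`. -/
def chartVolForm (lam : OneForm n M) (e : OpenPartialHomeomorph M (Model n)) (y : Model n) :
    Model n [⋀^Fin (2 * n + 1)]→ₗ[ℝ] ℝ :=
  wedgePowAlt n (lam.inChart e y).toLinearMap (skewBilin (fderiv ℝ (lam.inChart e) y))

/-- The density of the volume form of `lam` in the chart `e`. -/
def chartDensity (lam : OneForm n M) (e : OpenPartialHomeomorph M (Model n)) (y : Model n) : ℝ :=
  chartVolForm lam e y fun i => EuclideanSpace.single i (1 : ℝ)

theorem OneForm.IsSmooth.volForm_eq_chartVolForm (h : lam.IsSmooth)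
    {e : OpenPartialHomeomorph M (Model n)}
    (he : e ∈ IsManifold.maximalAtlas (𝓡 (2 * n + 1)) ∞ M) {x : M} (hx : x ∈ e.source)
    (v : Fin (2 * n + 1) → TangentSpace (𝓡 (2 * n + 1)) x) :
    lam.volForm x v = chartVolForm lam e (e x)
      (fun i => mfderiv (𝓡 (2 * n + 1)) (𝓡 (2 * n + 1)) e x (v i)) := by
  refine Eq.trans ?_ (wedgePowAlt_apply _ _ _).symm
  have h1 := lam.apply_eq_inChart he hx
  have h2 := h.d_eq_inChart he hx
  unfold OneForm.volForm wedgePow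
  simp only [h1, h2]
  rfl

theorem OneForm.IsSmooth.volForm_symm_eq_chartDensity (h : lam.IsSmooth)
    {e : OpenPartialHomeomorph M (Model n)}
    (he : e ∈ IsManifold.maximalAtlas (𝓡 (2 * n + 1)) ∞ M) {y : Model n} (hy : y ∈ e.target) :
    lam.volForm (e.symm y) (fun i => mfderiv (𝓡 (2 * n + 1)) (𝓡 (2 * n + 1)) e.symm y
      (EuclideanSpace.single i (1 : ℝ))) = chartDensity lam e y := by
  rw [h.volForm_eq_chartVolForm he (e.map_target hy), e.right_inv hy]
  unfold chartDensity
  congr 1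
  funext i
  have h1 := DFunLike.congr_fun ((mdifferentiable_of_mem_maximalAtlas he).comp_symm_deriv hy)
    (EuclideanSpace.single i (1 : ℝ))
  exact h1

/-- An alternating form of top degree is a multiple of the determinant, so it scales by the Jacobian
of the change of charts. -/
theorem OneForm.IsSmooth.chartDensity_eq_det_mul (h : lam.IsSmooth)
    {e e' : OpenPartialHomeomorph M (Model n)}
    (he : e ∈ IsManifold.maximalAtlas (𝓡 (2 * n + 1)) ∞ M)
    (he' : e' ∈ IsManifold.maximalAtlas (𝓡 (2 * n + 1)) ∞ M)
    {y : Model n} (hy : y ∈ e.target) (hy' : e.symm y ∈ e'.source) :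
    chartDensity lam e y = (fderiv ℝ (fun z => e' (e.symm z)) y).det *
      chartDensity lam e' (e' (e.symm y)) := by
  obtain ⟨x, hx, rfl⟩ : ∃ x ∈ e.source, y = e x :=
    ⟨e.symm y, e.map_target hy, (e.right_inv hy).symm⟩
  rw [e.left_inv hx] at hy' ⊢
  have key : ∀ v : Fin (2 * n + 1) → Model n, chartVolForm lam e (e x) v =
      chartVolForm lam e' (e' x) (fun i => fderiv ℝ (fun z => e' (e.symm z)) (e x) (v i)) := by
    intro v
    choose w hw using fun i =>
      (mdifferentiable_of_mem_maximalAtlas he).mfderiv_surjective hx (v i)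
    have h1 := h.volForm_eq_chartVolForm he hx w
    rw [h.volForm_eq_chartVolForm he' hy'] at h1
    have h2 : (fun i => mfderiv (𝓡 (2 * n + 1)) (𝓡 (2 * n + 1)) e x (w i)) = v := funext hw
    have h3 : (fun i => mfderiv (𝓡 (2 * n + 1)) (𝓡 (2 * n + 1)) e' x (w i)) =
        fun i => fderiv ℝ (fun z => e' (e.symm z)) (e x) (v i) := by
      funext i
      have := fderiv_chart (f := id) contMDiff_id he he' hx hy' (w i)
      rw [mfderiv_id] at this
      rw [← hw i]
      exact this.symm
    exact (congrArg _ h2.symm).trans (h1.symm.trans (congrArg _ h3))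
  unfold chartDensity
  rw [key]
  let b := (EuclideanSpace.basisFun (Fin (2 * n + 1)) ℝ).toBasis
  have hb : ∀ i, b i = EuclideanSpace.single i (1 : ℝ) := fun i => by simp [b]
  rw [(chartVolForm lam e' (e' x)).eq_smul_basis_det b]
  have h4 := b.det_comp (fderiv ℝ (fun z => e' (e.symm z)) (e x)).toLinearMap b
  have h5 : (⇑(fderiv ℝ (fun z => e' (e.symm z)) (e x)).toLinearMap ∘ b) =
    fun i => fderiv ℝ (fun z => e' (e.symm z)) (e x) (EuclideanSpace.single i (1 : ℝ)) := by
    funext i; simp [hb]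
  have h6 : (b : Fin (2 * n + 1) → Model n) = fun i => EuclideanSpace.single i (1 : ℝ) := funext hb
  rw [h5, b.det_self] at h4
  simp only [AlternatingMap.smul_apply, h4, smul_eq_mul]
  rw [← h6, b.det_self, ContinuousLinearMap.det]
  ring

theorem OneForm.IsSmooth.continuousOn_chartDensity (h : lam.IsSmooth)
    {e : OpenPartialHomeomorph M (Model n)}
    (he : e ∈ IsManifold.maximalAtlas (𝓡 (2 * n + 1)) ∞ M) :
    ContinuousOn (chartDensity lam e) e.target := by
  have h1 : ∀ y ∈ e.target, ContDiffAt ℝ ∞ (lam.inChart e) y := fun y hy => by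
    have := h.contDiffAt_inChart he (e.map_target hy)
    rwa [e.right_inv hy] at this
  have h2 : ∀ v : Model n, ContinuousOn (fun y => lam.inChart e y v) e.target := fun v y hy =>
    ((h1 y hy).continuousAt.clm_apply continuousAt_const).continuousWithinAt
  have h3 : ∀ v w : Model n, ContinuousOn (fun y => skewBilin (fderiv ℝ (lam.inChart e) y) v w)
      e.target := fun v w y hy => by
    have h4 : ContinuousAt (fderiv ℝ (lam.inChart e)) y :=
      ((h1 y hy).fderiv_right (m := ∞) (by simp)).continuousAt
    exact (((h4.clm_apply continuousAt_const).clm_apply continuousAt_const).sub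
      ((h4.clm_apply continuousAt_const).clm_apply continuousAt_const)).continuousWithinAt
  have h4 : chartDensity lam e = fun y => wedgePow (fun v => lam.inChart e y v)
      (fun v w => skewBilin (fderiv ℝ (lam.inChart e) y) v w)
      (fun i => EuclideanSpace.single i (1 : ℝ)) := funext fun y => wedgePowAlt_apply _ _ _
  rw [h4]
  unfold wedgePow
  exact continuousOn_const.mul (continuousOn_finsetSum _ fun σ _ =>
    (continuousOn_const.mul (h2 _)).mul (continuousOn_finsetProd _ fun i _ => h3 _ _))

variable [MeasurableSpace M] [BorelSpace M]

theorem measurableSet_target_inter_preimage_symm (e : OpenPartialHomeomorph M (Model n)) {T : Set M}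
    (hT : MeasurableSet T) : MeasurableSet (e.target ∩ e.symm ⁻¹' T) := by
  have h1 : Measurable (e.target.domRestrict e.symm) :=
    (continuousOn_iff_continuous_domRestrict.1 e.continuousOn_symm).measurable
  have h2 := e.open_target.measurableSet.subtype_image (h1 hT)
  convert h2 using 1
  ext y
  simp [and_comm]

theorem OneForm.IsSmooth.chartMeasure_apply (h : lam.IsSmooth)
    {e : OpenPartialHomeomorph M (Model n)}
    (he : e ∈ IsManifold.maximalAtlas (𝓡 (2 * n + 1)) ∞ M) {T : Set M} (hT : MeasurableSet T) :
    chartMeasure lam e T =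
      ∫⁻ y in e.target ∩ e.symm ⁻¹' T, ENNReal.ofReal |chartDensity lam e y| := by
  have h1 : AEMeasurable e.symm (volume.restrict e.target) :=
    e.continuousOn_symm.aemeasurable e.open_target.measurableSet
  unfold chartMeasure
  rw [Measure.map_apply_of_aemeasurable (h1.mono_ac (withDensity_absolutelyContinuous _ _)) hT,
    withDensity_apply', Measure.restrict_restrict' e.open_target.measurableSet, inter_comm]
  refine setLIntegral_congr_fun (measurableSet_target_inter_preimage_symm e hT) fun y hy => ?_
  rw [h.volForm_symm_eq_chartDensity he hy.1]

/-- The change of variables formula cancels the Jacobian of the densities. Only an inequality holds,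
since `T` may leave the domain of `e`, and it is what bounds a supremum over charts. -/
theorem OneForm.IsSmooth.chartMeasure_le (h : lam.IsSmooth)
    {e e' : OpenPartialHomeomorph M (Model n)}
    (he : e ∈ IsManifold.maximalAtlas (𝓡 (2 * n + 1)) ∞ M)
    (he' : e' ∈ IsManifold.maximalAtlas (𝓡 (2 * n + 1)) ∞ M) {T : Set M} (hT : MeasurableSet T)
    (hTe : T ⊆ e'.source) : chartMeasure lam e T ≤ chartMeasure lam e' T := by
  rw [h.chartMeasure_apply he hT, h.chartMeasure_apply he' hT]
  set A := e.target ∩ e.symm ⁻¹' T with hA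
  have hAm : MeasurableSet A := measurableSet_target_inter_preimage_symm e hT
  have h1 : ∀ y ∈ A, HasFDerivWithinAt (fun z => e' (e.symm z))
      (fderiv ℝ (fun z => e' (e.symm z)) y) A y := fun y hy =>
    ((contDiffAt_chart (f := id) contMDiff_id he he' hy.1
      (hTe hy.2)).differentiableAt (by simp)).hasFDerivAt.hasFDerivWithinAt
  have h2 : InjOn (fun z => e' (e.symm z)) A := fun y hy z hz hyz =>
    e.symm.injOn hy.1 hz.1 (e'.injOn (hTe hy.2) (hTe hz.2) hyz)
  calc ∫⁻ y in A, ENNReal.ofReal |chartDensity lam e y|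
      = ∫⁻ y in A, ENNReal.ofReal |(fderiv ℝ (fun z => e' (e.symm z)) y).det| *
          ENNReal.ofReal |chartDensity lam e' (e' (e.symm y))| := by
        refine setLIntegral_congr_fun hAm fun y hy => ?_
        rw [h.chartDensity_eq_det_mul he he' hy.1 (hTe hy.2), abs_mul,
          ENNReal.ofReal_mul (abs_nonneg _)]
    _ = ∫⁻ y in (fun z => e' (e.symm z)) '' A, ENNReal.ofReal |chartDensity lam e' y| :=
        (lintegral_image_eq_lintegral_abs_det_fderiv_mul volume hAm h1 h2
          (fun y => ENNReal.ofReal |chartDensity lam e' y|)).symm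
    _ ≤ _ := by
        refine lintegral_mono_set ?_
        rintro _ ⟨y, hy, rfl⟩
        refine ⟨e'.map_source (hTe hy.2), ?_⟩
        rw [mem_preimage, e'.left_inv (hTe hy.2)]
        exact hy.2

theorem OneForm.IsSmooth.chartMeasure_lt_top [T2Space M] (h : lam.IsSmooth)
    {e : OpenPartialHomeomorph M (Model n)}
    (he : e ∈ IsManifold.maximalAtlas (𝓡 (2 * n + 1)) ∞ M) {K : Set M} (hK : IsCompact K)
    (hKe : K ⊆ e.source) : chartMeasure lam e K < ⊤ := by
  rw [h.chartMeasure_apply he hK.measurableSet]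
  have h1 : e.target ∩ e.symm ⁻¹' K = e '' K := by
    ext y
    refine ⟨fun hy => ⟨e.symm y, hy.2, e.right_inv hy.1⟩, ?_⟩
    rintro ⟨x, hx, rfl⟩
    refine ⟨e.map_source (hKe hx), ?_⟩
    rwa [mem_preimage, e.left_inv (hKe hx)]
  have h2 : IsCompact (e '' K) := hK.image_of_continuousOn (e.continuousOn.mono hKe)
  have h3 : e '' K ⊆ e.target := by
    rintro _ ⟨x, hx, rfl⟩; exact e.map_source (hKe hx)
  rw [h1]
  have h4 : IntegrableOn (chartDensity lam e) (e '' K) :=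
    ((h.continuousOn_chartDensity he).mono h3).integrableOn_compact h2
  have := h4.2
  simpa [HasFiniteIntegral, Real.enorm_eq_ofReal_abs] using this

/-- Finitely many compact sets, each inside a preferred chart, cover `M`. On each of them the
measure of every chart is at most that of the preferred one, so the supremum is bounded by a finite
sum of finite masses. -/
theorem OneForm.IsSmooth.isFiniteMeasure_contactMeasure [T2Space M] [CompactSpace M]
    (h : lam.IsSmooth) : IsFiniteMeasure (contactMeasure lam) := by
  have hloc : ∀ x : M, ∃ K : Set M, K ∈ 𝓝 x ∧ IsCompact K ∧
      K ⊆ (chartAt (Model n) x).source := fun x => by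
    have := Manifold.locallyCompact_of_finiteDimensional (M := M) (𝓡 (2 * n + 1))
    obtain ⟨K, hK, hKs, hKc⟩ := local_compact_nhds
      ((chartAt (Model n) x).open_source.mem_nhds (mem_chart_source (Model n) x))
    exact ⟨K, hK, hKc, hKs⟩
  choose K hKn hKc hKs using hloc
  obtain ⟨s, -, hs⟩ := isCompact_univ.elim_nhds_subcover K fun x _ => hKn x
  let μ : Measure M := ∑ x ∈ s, (chartMeasure lam (chartAt (Model n) x)).restrict (K x)
  have hle : contactMeasure lam ≤ μ := by
    refine iSup₂_le fun e he => Measure.le_iff.2 fun T hT => ?_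
    calc chartMeasure lam e T ≤ chartMeasure lam e (⋃ x ∈ s, T ∩ K x) := by
          refine measure_mono fun y hy => ?_
          obtain ⟨x, hx, hyx⟩ := mem_iUnion₂.1 (hs (mem_univ y))
          exact mem_iUnion₂.2 ⟨x, hx, hy, hyx⟩
      _ ≤ ∑ x ∈ s, chartMeasure lam e (T ∩ K x) := measure_biUnion_finset_le _ _
      _ ≤ ∑ x ∈ s, chartMeasure lam (chartAt (Model n) x) (T ∩ K x) :=
          Finset.sum_le_sum fun x _ => h.chartMeasure_le he (chartAt_mem_maximalAtlas x)
            (hT.inter (hKc x).measurableSet) (inter_subset_right.trans (hKs x))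
      _ = μ T := by
          simp [μ, Measure.restrict_apply hT]
  refine ⟨(hle univ).trans_lt ?_⟩
  simp only [μ, Measure.coe_finsetSum, Finset.sum_apply, Measure.restrict_apply_univ]
  exact ENNReal.sum_lt_top.2 fun x _ =>
    h.chartMeasure_lt_top (chartAt_mem_maximalAtlas x) (hKc x) (hKs x)

end Volume

/-! ### Flows of vector fields on a compact manifold -/

section Flow

variable {n : ℕ} {M : Type*} [TopologicalSpace M] [ChartedSpace (Model n) M]
  [IsManifold (𝓡 (2 * n + 1)) ∞ M] {X : VField n M}

/-- A smooth map on an open set agrees near every point with a smooth map of compact support. -/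
theorem exists_contDiff_hasCompactSupport_eqOn_closedBall {E F : Type*} [NormedAddCommGroup E]
    [InnerProductSpace ℝ E] [FiniteDimensional ℝ E] [NormedAddCommGroup F] [NormedSpace ℝ F]
    {f : E → F} {U : Set E} (hU : IsOpen U) (hf : ∀ y ∈ U, ContDiffAt ℝ ∞ f y) {c : E}
    (hc : c ∈ U) : ∃ (g : E → F) (r : ℝ), 0 < r ∧ ContDiff ℝ ∞ g ∧ HasCompactSupport g ∧
      Metric.closedBall c r ⊆ U ∧ EqOn g f (Metric.closedBall c r) := by
  obtain ⟨R, hR, hRU⟩ := Metric.nhds_basis_closedBall.mem_iff.1 (hU.mem_nhds hc)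
  let b : ContDiffBump c := ⟨R / 2, R, by linarith, by linarith⟩
  have hts : tsupport b ⊆ U := by rw [b.tsupport_eq]; exact hRU
  refine ⟨fun y => b y • f y, R / 2, by linarith, ?_, ?_,
    (Metric.closedBall_subset_closedBall (by linarith)).trans hRU, fun y hy => ?_⟩
  · refine contDiff_iff_contDiffAt.2 fun y => ?_
    by_cases hy : y ∈ tsupport b
    · exact b.contDiff.contDiffAt.smul (hf y (hts hy))
    · have h1 : (fun y => b y • f y) =ᶠ[𝓝 y] fun _ => 0 := by
        filter_upwards [(isClosed_tsupport b).isOpen_compl.mem_nhds hy] with z hz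
        rw [image_eq_zero_of_notMem_tsupport hz, zero_smul]
      exact contDiffAt_const.congr_of_eventuallyEq h1
  · exact b.hasCompactSupport.smul_right
  · simp only
    rw [b.one_of_mem_closedBall hy, one_smul]

/-- Local flow box of a smooth vector field. -/
theorem VField.IsSmooth.exists_local_flow (hX : X.IsSmooth) (x₀ : M) :
    ∃ (ε : ℝ) (U : Set M) (Ψ : ℝ → M → M), 0 < ε ∧ IsOpen U ∧ x₀ ∈ U ∧
      ContMDiffOn (𝓘(ℝ, ℝ).prod (𝓡 (2 * n + 1))) (𝓡 (2 * n + 1)) ∞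
        (fun p : ℝ × M => Ψ p.1 p.2) (Ioo (-ε) ε ×ˢ U) ∧
      ∀ x ∈ U, Ψ 0 x = x ∧ IsMIntegralCurveOn (I := 𝓡 (2 * n + 1)) (fun t => Ψ t x) X
        (Ioo (-ε) ε) := by
  set e := chartAt (Model n) x₀ with hedef
  have he : e ∈ IsManifold.maximalAtlas (𝓡 (2 * n + 1)) ∞ M := chartAt_mem_maximalAtlas x₀
  have hx₀ : x₀ ∈ e.source := mem_chart_source _ x₀
  have hf : ∀ y ∈ e.target, ContDiffAt ℝ ∞ (X.inChart e) y := fun y hy => by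
    have := hX.contDiffAt_inChart he (e.map_target hy)
    rwa [e.right_inv hy] at this
  obtain ⟨g, r, hr, hg, hgs, hball, hgf⟩ :=
    exists_contDiff_hasCompactSupport_eqOn_closedBall e.open_target hf (e.map_source hx₀)
  obtain ⟨φ, hφ⟩ := exists_isFlow_of_hasCompactSupport (hg.of_le (by simp)) hgs zero_le_one
  have hφs := hφ.contDiffOn hg zero_le_one
  have hφc : ContinuousAt (fun p : ℝ × Model n => φ p.1 p.2) (0, e x₀) :=
    hφs.continuousOn.continuousAt (prod_mem_nhds (isOpen_Ioo.mem_nhds (by simp)) Filter.univ_mem)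
  -- For short times and nearby points the flow of the cut-off field stays in the ball where that
  -- field is the expression of `X`.
  have h1 : ∀ᶠ p : ℝ × Model n in 𝓝 0 ×ˢ 𝓝 (e x₀), φ p.1 p.2 ∈ Metric.ball (e x₀) r := by
    rw [← nhds_prod_eq]
    refine hφc.eventually (Metric.isOpen_ball.mem_nhds ?_)
    simp only [hφ.zero]
    exact Metric.mem_ball_self hr
  obtain ⟨pa, hpa, pb, hpb, hab⟩ := Filter.eventually_prod_iff.1 h1
  obtain ⟨ε', hε', hε'a⟩ := Metric.nhds_basis_ball.mem_iff.1 hpa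
  obtain ⟨W, hWb, hWo, hxW⟩ := mem_nhds_iff.1 hpb
  set ε := min ε' 1 with hε
  have hmem : ∀ t ∈ Ioo (-ε) ε, pa t ∧ t ∈ Ioo (-1 : ℝ) 1 := fun t ht => by
    have h2 : |t| < ε := abs_lt.2 ht
    refine ⟨hε'a ?_, abs_lt.1 (h2.trans_le (min_le_right _ _))⟩
    rw [Metric.mem_ball, dist_zero_right]
    exact h2.trans_le (min_le_left _ _)
  have hin : ∀ t ∈ Ioo (-ε) ε, ∀ x ∈ e.source ∩ e ⁻¹' W, φ t (e x) ∈ Metric.ball (e x₀) r :=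
    fun t ht x hx => hab (hmem t ht).1 (hWb hx.2)
  refine ⟨ε, e.source ∩ e ⁻¹' W, fun t x => e.symm (φ t (e x)), lt_min hε' one_pos,
    e.isOpen_inter_preimage hWo, ⟨hx₀, hxW⟩, ?_, fun x hx => ⟨?_, fun t ht => ?_⟩⟩
  · intro p hp
    have h2 : ContMDiffAt (𝓘(ℝ, ℝ).prod (𝓡 (2 * n + 1))) 𝓘(ℝ, ℝ × Model n) ∞
        (fun p : ℝ × M => (p.1, e p.2)) p := by
      rw [modelWithCornersSelf_prod, ← chartedSpaceSelf_prod]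
      exact contMDiffAt_fst.prodMk
        ((contMDiffAt_of_mem_maximalAtlas he hp.2.1).comp p contMDiffAt_snd)
    have h3 : ContMDiffAt 𝓘(ℝ, ℝ × Model n) 𝓘(ℝ, Model n) ∞
        (fun p : ℝ × Model n => φ p.1 p.2) (p.1, e p.2) :=
      (hφs.contDiffAt (prod_mem_nhds (isOpen_Ioo.mem_nhds (hmem _ hp.1).2)
        Filter.univ_mem)).contMDiffAt
    have h4 : ContMDiffAt 𝓘(ℝ, Model n) (𝓡 (2 * n + 1)) ∞ e.symm (φ p.1 (e p.2)) :=
      contMDiffAt_symm_of_mem_maximalAtlas he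
        (hball (Metric.ball_subset_closedBall (hin _ hp.1 _ hp.2)))
    exact (ContMDiffAt.comp p h4 (ContMDiffAt.comp p h3 h2)).contMDiffWithinAt
  · simp only [hφ.zero]
    exact e.left_inv hx.1
  · have hy : φ t (e x) ∈ e.target :=
      hball (Metric.ball_subset_closedBall (hin _ ht _ hx))
    have h2 : HasDerivAt (fun s => φ s (e x)) (g (φ t (e x))) t :=
      (hφ.deriv (e x) t (Ioo_subset_Icc_self (hmem t ht).2)).hasDerivAt
        (Icc_mem_nhds (hmem t ht).2.1 (hmem t ht).2.2)
    have h3 := ((mdifferentiable_of_mem_maximalAtlas he).mdifferentiableAt_symm hy).hasMFDerivAt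
    have h4 := HasMFDerivAt.comp t h3 h2.hasFDerivAt.hasMFDerivAt
    refine HasMFDerivAt.hasMFDerivWithinAt ?_
    refine h4.congr_mfderiv ?_
    refine ContinuousLinearMap.ext_ring ?_
    obtain ⟨z, hz, hzy⟩ : ∃ z ∈ e.source, e z = φ t (e x) :=
      ⟨_, e.map_target hy, e.right_inv hy⟩
    have h5 : g (φ t (e x)) = mfderiv (𝓡 (2 * n + 1)) (𝓡 (2 * n + 1)) e z (X z) := by
      rw [hgf (Metric.ball_subset_closedBall (hin _ ht _ hx)), ← hzy, X.inChart_apply hz]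
    have hXz : ∀ u, u = z → (X z : Model n) = X u := by
      rintro u rfl; rfl
    have h6 : ∀ w, e z = w → (mfderiv (𝓡 (2 * n + 1)) (𝓡 (2 * n + 1)) e.symm w
        (mfderiv (𝓡 (2 * n + 1)) (𝓡 (2 * n + 1)) e z (X z)) : Model n) = X (e.symm w) := by
      rintro _ rfl
      exact (mfderiv_symm_mfderiv he hz (X z)).trans (hXz _ (e.left_inv hz))
    have h7 := h6 _ hzy
    rw [← h5] at h7
    change (mfderiv (𝓡 (2 * n + 1)) (𝓡 (2 * n + 1)) e.symm (φ t (e x))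
      ((1 : ℝ) • g (φ t (e x))) : Model n) = (1 : ℝ) • (X (e.symm (φ t (e x))) : Model n)
    rw [one_smul, one_smul]
    exact h7

variable [T2Space M] [CompactSpace M]

/-- The flow of a smooth vector field on a compact manifold, as a smooth curve
of diffeomorphisms. -/
theorem VField.IsSmooth.exists_flow (hX : X.IsSmooth) :
    ∃ (δ : ℝ) (χ : ℝ → Diffeo n M), 0 < δ ∧
      ContMDiffOn (𝓘(ℝ, ℝ).prod (𝓡 (2 * n + 1))) (𝓡 (2 * n + 1)) ∞
        (fun p : ℝ × M => χ p.1 p.2) (Ioo (-δ) δ ×ˢ univ) ∧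
      (∀ x, χ 0 x = x) ∧
      (∀ s ∈ Ioo (-δ) δ, ∀ t ∈ Ioo (-δ) δ, s + t ∈ Ioo (-δ) δ → ∀ x, χ (s + t) x = χ s (χ t x)) ∧
      ∀ x, HasMFDerivAt 𝓘(ℝ, ℝ) (𝓡 (2 * n + 1)) (fun t => χ t x) 0
        ((1 : ℝ →L[ℝ] ℝ).smulRight (X x)) := by
  have hM : IsManifold (𝓡 (2 * n + 1)) 1 M := IsManifold.of_le (n := ∞) (by simp)
  have hX1 : ContMDiff (𝓡 (2 * n + 1)) (𝓡 (2 * n + 1)).tangent 1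
      (fun x => (⟨x, X x⟩ : TangentBundle (𝓡 (2 * n + 1)) M)) := hX.contMDiff.of_le (by simp)
  choose ε U Ψ hε hU hxU hΨs hΨ using hX.exists_local_flow
  obtain ⟨s, -, hs⟩ := isCompact_univ.elim_nhds_subcover U fun x _ => (hU x).mem_nhds (hxU x)
  obtain ⟨δ, hδ, hδs⟩ : ∃ δ > 0, ∀ i ∈ s, δ ≤ ε i := by
    clear hs
    classical
    induction s using Finset.induction_on with
    | empty => exact ⟨1, one_pos, by simp⟩
    | insert a s _ ih =>
      obtain ⟨δ, hδ, h⟩ := ih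
      refine ⟨min δ (ε a), lt_min hδ (hε a), fun i hi => ?_⟩
      rcases Finset.mem_insert.1 hi with rfl | hi
      · exact min_le_right _ _
      · exact (min_le_left _ _).trans (h i hi)
  have hcov : ∀ x, ∃ i ∈ s, x ∈ U i := fun x => by
    simpa using hs (mem_univ x)
  have hsub : ∀ i ∈ s, Ioo (-δ) δ ⊆ Ioo (-ε i) (ε i) := fun i hi =>
    Ioo_subset_Ioo (neg_le_neg (hδs i hi)) (hδs i hi)
  -- By compactness the time of existence `δ` is the same for all starting points, so integral
  -- curves extend to all times.
  have hglob : ∀ x, ∃ c : ℝ → M, c 0 = x ∧ IsMIntegralCurve (I := 𝓡 (2 * n + 1)) c X :=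
    exists_isMIntegralCurve_of_isMIntegralCurveOn hX1 hδ fun x => by
      obtain ⟨i, hi, hx⟩ := hcov x
      exact ⟨fun t => Ψ i t x, (hΨ i x hx).1, (hΨ i x hx).2.mono (hsub i hi)⟩
  choose Φ hΦ0 hΦ using hglob
  have hgroup : ∀ t u x, Φ x (t + u) = Φ (Φ x u) t := fun t u x =>
    congrFun (isMIntegralCurve_Ioo_eq_of_contMDiff_boundaryless (t₀ := 0) hX1
      ((hΦ x).comp_add u) (hΦ (Φ x u)) (by simp [hΦ0])) t
  -- Uniqueness of integral curves identifies `Φ` locally with the smooth flow boxes.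
  have hsm : ContMDiffOn (𝓘(ℝ, ℝ).prod (𝓡 (2 * n + 1))) (𝓡 (2 * n + 1)) ∞
      (fun p : ℝ × M => Φ p.2 p.1) (Ioo (-δ) δ ×ˢ univ) := by
    intro p hp
    obtain ⟨i, hi, hx⟩ := hcov p.2
    refine ContMDiffAt.contMDiffWithinAt ?_
    have hmem : Ioo (-δ) δ ×ˢ U i ∈ 𝓝 p :=
      (isOpen_Ioo.prod (hU i)).mem_nhds ⟨hp.1, hx⟩
    have h1 := ((hΨs i).mono (prod_mono (hsub i hi) subset_rfl)).contMDiffAt hmem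
    refine h1.congr_of_eventuallyEq ?_
    filter_upwards [hmem] with q hq
    exact isMIntegralCurveOn_Ioo_eqOn_of_contMDiff_boundaryless (t₀ := 0) ⟨by linarith, hδ⟩ hX1
      ((hΦ q.2).isMIntegralCurveOn _) ((hΨ i q.2 hq.2).2.mono (hsub i hi))
      (by rw [hΦ0, (hΨ i q.2 hq.2).1]) hq.1
  have hsmt : ∀ t ∈ Ioo (-δ) δ, ContMDiff (𝓡 (2 * n + 1)) (𝓡 (2 * n + 1)) ∞ (fun x => Φ x t) :=
    fun t ht => by
      have h1 : ContMDiff (𝓡 (2 * n + 1)) (𝓘(ℝ, ℝ).prod (𝓡 (2 * n + 1))) ∞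
        (fun x : M => (t, x)) := contMDiff_const.prodMk contMDiff_id
      exact contMDiffOn_univ.1 (hsm.comp h1.contMDiffOn fun x _ => ⟨ht, mem_univ _⟩)
  have hneg : ∀ t ∈ Ioo (-δ) δ, -t ∈ Ioo (-δ) δ := fun t ht =>
    ⟨by linarith [ht.2], by linarith [ht.1]⟩
  classical
  let χ : ℝ → Diffeo n M := fun t => if ht : t ∈ Ioo (-δ) δ then
    { toFun := fun x => Φ x t
      invFun := fun x => Φ x (-t)
      left_inv := fun x => by
        change Φ (Φ x t) (-t) = x
        rw [← hgroup, neg_add_cancel, hΦ0]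
      right_inv := fun x => by
        change Φ (Φ x (-t)) t = x
        rw [← hgroup, add_neg_cancel, hΦ0]
      contMDiff_toFun := hsmt t ht
      contMDiff_invFun := hsmt (-t) (hneg t ht) } else Diffeomorph.refl _ _ _
  have hχ : ∀ t ∈ Ioo (-δ) δ, ∀ x, χ t x = Φ x t := fun t ht x => by
    simp only [χ, dif_pos ht]; rfl
  have h0 : (0 : ℝ) ∈ Ioo (-δ) δ := ⟨by linarith, hδ⟩
  refine ⟨δ, χ, hδ, hsm.congr fun p hp => hχ _ hp.1 _, fun x => by rw [hχ 0 h0, hΦ0],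
    fun t ht u hu htu x => by rw [hχ _ htu, hχ t ht, hχ u hu, hgroup], fun x => ?_⟩
  have h1 : HasMFDerivAt 𝓘(ℝ, ℝ) (𝓡 (2 * n + 1)) (Φ x) 0
    ((1 : ℝ →L[ℝ] ℝ).smulRight (X (Φ x 0))) := hΦ x 0
  have h2 : (fun t => χ t x) =ᶠ[𝓝 0] Φ x := by
    filter_upwards [isOpen_Ioo.mem_nhds h0] with t ht using hχ t ht x
  have h3 := h1.congr_of_eventuallyEq h2
  have h4 : ∀ z, z = x → HasMFDerivAt 𝓘(ℝ, ℝ) (𝓡 (2 * n + 1)) (fun t => χ t x) 0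
    ((1 : ℝ →L[ℝ] ℝ).smulRight (X z) : ℝ →L[ℝ] Model n) →
    HasMFDerivAt 𝓘(ℝ, ℝ) (𝓡 (2 * n + 1)) (fun t => χ t x) 0
    ((1 : ℝ →L[ℝ] ℝ).smulRight (X x) : ℝ →L[ℝ] Model n) := by
    rintro z rfl h; exact h
  exact h4 _ (hΦ0 x) h3

/-- If `X ⌟ d lam + d (lam X) = 0`, then the flow of `X` preserves `lam`. -/
theorem exists_flow_pullback_eq {lam : OneForm n M} (hlam : lam.IsSmooth) (hX : X.IsSmooth)
    (hinv : ∀ (x : M) (v : TangentSpace (𝓡 (2 * n + 1)) x),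
      lam.d x (X x) v + dFun (fun y => lam y (X y)) x v = 0) :
    ∃ (δ : ℝ) (χ : ℝ → Diffeo n M), 0 < δ ∧
      ContMDiffOn (𝓘(ℝ, ℝ).prod (𝓡 (2 * n + 1))) (𝓡 (2 * n + 1)) ∞
        (fun p : ℝ × M => χ p.1 p.2) (Ioo (-δ) δ ×ˢ univ) ∧
      (∀ x, χ 0 x = x) ∧
      (∀ x, HasMFDerivAt 𝓘(ℝ, ℝ) (𝓡 (2 * n + 1)) (fun t => χ t x) 0
        ((1 : ℝ →L[ℝ] ℝ).smulRight (X x))) ∧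
      ∀ t ∈ Ioo (-δ) δ, pullback (χ t) lam = lam := by
  obtain ⟨δ, χ, hδ, hχs, hχ0, hχg, hχd⟩ := hX.exists_flow
  refine ⟨δ, χ, hδ, hχs, hχ0, hχd, ?_⟩
  have hγ : IsSmoothCurve δ (fun t => (lam, χ t)) := ⟨hlam.contMDiffOn_const δ, hχs⟩
  have hv : HasVelocity (fun t => (lam, χ t)) 0 X := by
    refine ⟨fun x v => hasDerivAt_const (0 : ℝ) (lam x v), fun x => ?_⟩
    have h4 : ∀ z, x = z → HasMFDerivAt 𝓘(ℝ, ℝ) (𝓡 (2 * n + 1)) (fun t => χ t x) 0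
      ((1 : ℝ →L[ℝ] ℝ).smulRight (X z) : ℝ →L[ℝ] Model n) := by
      rintro z rfl; exact hχd x
    exact h4 _ (hχ0 x).symm
  obtain ⟨-, hc⟩ := hγ.hasDerivAt_pullback hδ hv hχ0 hlam
  have hc0 : ∀ x (v : TangentSpace (𝓡 (2 * n + 1)) x),
      HasDerivAt (fun t => pullback (χ t) lam x v) 0 0 := fun x v => by
    refine (hc x v).congr_deriv ?_
    rw [add_assoc, hinv]
    simp
  have h0 : (0 : ℝ) ∈ Ioo (-δ) δ := ⟨by linarith, hδ⟩
  -- The group law `χ_s = χ_{s-t} ∘ χ_t` turns the derivative at time `t` and point `x` into the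
  -- derivative at time `0` and point `χ_t x`.
  have hder : ∀ x (v : TangentSpace (𝓡 (2 * n + 1)) x), ∀ t ∈ Ioo (-δ) δ,
      HasDerivAt (fun t => pullback (χ t) lam x v) 0 t := by
    intro x v t ht
    have h1 := hc0 (χ t x) (mfderiv (𝓡 (2 * n + 1)) (𝓡 (2 * n + 1)) (χ t) x v)
    have h2 : HasDerivAt (fun s => s - t) 1 t := (hasDerivAt_id t).sub_const t
    have h3 : HasDerivAt (fun s => pullback (χ (s - t)) lam (χ t x)
        (mfderiv (𝓡 (2 * n + 1)) (𝓡 (2 * n + 1)) (χ t) x v)) 0 t := by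
      rw [← sub_self t] at h1
      have h6 := HasDerivAt.scomp (h := fun s => s - t) t h1 h2
      rw [sub_self, smul_zero] at h6
      exact h6
    refine h3.congr_of_eventuallyEq ?_
    have hcont : Filter.Tendsto (fun s => s - t) (𝓝 t) (𝓝 0) := by
      have := h2.continuousAt.tendsto
      simpa using this
    filter_upwards [isOpen_Ioo.mem_nhds ht, hcont.eventually (isOpen_Ioo.mem_nhds h0)] with s hs hst
    have h5 : χ s = (χ t).trans (χ (s - t)) := by
      ext y
      have := hχg (s - t) hst t ht (by simpa using hs) y
      rw [sub_add_cancel] at this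
      exact this
    rw [h5, pullback_trans]
    rfl
  intro t ht
  funext x
  ext v
  have h1 := isOpen_Ioo.is_const_of_deriv_eq_zero isPreconnected_Ioo
    (fun s hs => (hder x v s hs).differentiableAt.differentiableWithinAt)
    (fun s hs => (hder x v s hs).deriv) ht h0
  have h2 : χ 0 = Diffeomorph.refl (𝓡 (2 * n + 1)) M ∞ := Diffeomorph.ext hχ0
  simp only [h2, pullback_refl] at h1
  exact h1

end Flow

/-! ### The Reeb field in Darboux charts -/

section FloerNorm

variable {n : ℕ}

theorem isOpen_cube : IsOpen (cube n) := by
  have h : cube n = ⋂ i, (fun y : Model n => y i) ⁻¹' Ioo (-1 : ℝ) 1 := by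
    ext y; simp [cube]
  rw [h]
  exact isOpen_iInter_of_finite fun i => isOpen_Ioo.preimage (by fun_prop)

/-- A function that is constant on the cube has finite `C^(1,ε)`-norm. -/
theorem finiteC1Eps_of_eqOn_const {F : Type*} [NormedAddCommGroup F] [NormedSpace ℝ F] (ε : ℕ → ℝ)
    {g : Model n → F} {w : F} (h : ∀ y ∈ cube n, g y = w) : FiniteC1Eps ε g := by
  have hsucc : ∀ k, normD (k + 1) g = 0 := fun k => by
    refine le_antisymm (iSup₂_le fun y hy => iSup_le fun i => ?_) bot_le
    have h1 : g =ᶠ[𝓝 y] fun _ => w := by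
      filter_upwards [isOpen_cube.mem_nhds hy] with z hz using h z hz
    rw [(h1.iteratedFDeriv ℝ (k + 1)).eq_of_nhds, iteratedFDeriv_succ_const]
    simp
  have hzero : normD 0 g ≤ ‖w‖ₑ := iSup₂_le fun y hy => iSup_le fun i => by
    rw [iteratedFDeriv_zero_apply, h y hy]
  constructor
  · rw [tsum_eq_single 0 fun k hk => by
      obtain ⟨m, rfl⟩ := Nat.exists_eq_succ_of_ne_zero hk
      rw [Nat.succ_eq_add_one, hsucc, mul_zero]]
    exact ENNReal.mul_lt_top ENNReal.ofReal_lt_top (hzero.trans_lt enorm_lt_top)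
  · simp [hsucc]

variable {M : Type*} [TopologicalSpace M] [ChartedSpace (Model n) M]
  [IsManifold (𝓡 (2 * n + 1)) ∞ M] {lam : OneForm n M}

theorem IsDarbouxChart.fderiv_inChart {e : OpenPartialHomeomorph M (Model n)}
    (he : IsDarbouxChart lam e) (h : lam.IsSmooth) {y : Model n} (hy : y ∈ cube n)
    (a b : Model n) : fderiv ℝ (lam.inChart e) y a b =
      - ∑ i : Fin n, a ⟨n + (i : ℕ), by omega⟩ * b ⟨(i : ℕ), by omega⟩ := by
  have hyt : y ∈ e.target := he.target ▸ hy
  have hd : DifferentiableAt ℝ (lam.inChart e) y := by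
    have := h.contDiffAt_inChart he.smooth (e.map_target hyt)
    rw [e.right_inv hyt] at this
    exact this.differentiableAt (by simp)
  have h1 : HasFDerivAt (fun u => lam.inChart e u b) ((fderiv ℝ (lam.inChart e) y).flip b) y := by
    simpa using hd.hasFDerivAt.clm_apply (hasFDerivAt_const b y)
  have h2 : HasFDerivAt (fun u : Model n => b (Fin.last (2 * n)) -
      ∑ i : Fin n, u ⟨n + (i : ℕ), by omega⟩ * b ⟨(i : ℕ), by omega⟩)
      (0 - ∑ i : Fin n, (b ⟨(i : ℕ), by omega⟩) •
        (EuclideanSpace.proj ⟨n + (i : ℕ), by omega⟩ : Model n →L[ℝ] ℝ)) y :=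
    (hasFDerivAt_const _ _).sub (HasFDerivAt.fun_sum fun i _ =>
      (EuclideanSpace.proj ⟨n + (i : ℕ), by omega⟩ : Model n →L[ℝ] ℝ).hasFDerivAt.mul_const _)
  have h3 : (fun u => lam.inChart e u b) =ᶠ[𝓝 y] fun u : Model n => b (Fin.last (2 * n)) -
      ∑ i : Fin n, u ⟨n + (i : ℕ), by omega⟩ * b ⟨(i : ℕ), by omega⟩ := by
    filter_upwards [isOpen_cube.mem_nhds hy] with u hu using he.form u hu b
  have h4 := DFunLike.congr_fun (h1.unique (h2.congr_of_eventuallyEq h3)) a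
  simpa [sum_apply, mul_comm] using h4

/-- The field `∂_z` satisfies both Reeb conditions for `dz - ∑ p_i dq_i`, since `d lam` involves no
`z`-component. The contact condition makes the solution unique. -/
theorem IsDarbouxChart.reeb_inChart {e : OpenPartialHomeomorph M (Model n)}
    (he : IsDarbouxChart lam e) (h : IsContactForm lam) {y : Model n} (hy : y ∈ cube n) :
    (reeb lam).inChart e y = EuclideanSpace.single (Fin.last (2 * n)) 1 := by
  have hyt : y ∈ e.target := he.target ▸ hy
  obtain ⟨x, hx, rfl⟩ : ∃ x ∈ e.source, y = e x :=
    ⟨e.symm y, e.map_target hyt, (e.right_inv hyt).symm⟩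
  obtain ⟨h1, h2⟩ := h.reeb_inChart_spec he.smooth hx
  have hp : ∀ i : Fin n, (⟨n + (i : ℕ), by omega⟩ : Fin (2 * n + 1)) ≠ Fin.last (2 * n) :=
    fun i hi => by have := congrArg Fin.val hi; simp at this; omega
  have hq : ∀ i : Fin n, (⟨(i : ℕ), by omega⟩ : Fin (2 * n + 1)) ≠ Fin.last (2 * n) :=
    fun i hi => by have := congrArg Fin.val hi; simp at this; omega
  refine sub_eq_zero.1 (h.eq_zero_inChart he.smooth hx ?_ fun w => ?_)
  · rw [map_sub, h1, he.form _ hy]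
    simp [hq]
  · rw [map_sub, LinearMap.sub_apply, h2, zero_sub, neg_eq_zero]
    change fderiv ℝ (lam.inChart e) (e x) _ _ - fderiv ℝ (lam.inChart e) (e x) _ _ = 0
    rw [he.fderiv_inChart h.1 hy, he.fderiv_inChart h.1 hy]
    simp [hp, hq]

/-- Both components are constant in Darboux charts, so all derivatives of positive order vanish and
at most the term of order `0` remains in the two series. -/
theorem reebPairs_subset_c1epsPairs (h : IsContactForm lam)
    {A : Finset (OpenPartialHomeomorph M (Model n))} (hA : IsDarbouxAtlas lam A) (ε : ℕ → ℝ) :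
    reebPairs lam ⊆ c1epsPairs A ε := by
  rintro _ ⟨c, rfl⟩ e he
  refine ⟨finiteC1Eps_of_eqOn_const (w := 0) ε fun y _ => ContinuousLinearMap.zero_comp _,
    finiteC1Eps_of_eqOn_const (w := c • EuclideanSpace.single (Fin.last (2 * n)) 1) ε
      fun y hy => ?_⟩
  rw [← (hA.chart e he).reeb_inChart h hy]
  exact map_smul _ _ _

end FloerNorm

/-! ### Comparison of the tangent spaces -/

section Main

variable {n : ℕ} {M : Type*} [TopologicalSpace M] [ChartedSpace (Model n) M]
  [IsManifold (𝓡 (2 * n + 1)) ∞ M] [MeasurableSpace M] {lam : OneForm n M}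

/-- Along a curve of strict contact pairs, `ψ_t^* lam_t = lam_t` makes `Φ` vanish identically near
`0`, and it preserves the volume form. -/
theorem tangentStrict_subset_kerDPhi (ψ : Diffeo n M) :
    tangentStrict lam ψ ⊆ kerDPhi lam ψ := by
  rintro u ⟨δ, γ, hδ, hγ, h0, hS, hv⟩
  refine ⟨δ, γ, hδ, hγ, h0, fun t ht => ⟨(hS t ht).1, (hS t ht).2.isIncompressible⟩, hv,
    fun x v => (hasDerivAt_const (0 : ℝ) (0 : ℝ)).congr_of_eventuallyEq ?_⟩
  filter_upwards [isOpen_Ioo.mem_nhds (⟨by linarith, hδ⟩ : (0 : ℝ) ∈ Ioo (-δ) δ)] with t ht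
  obtain ⟨h1, h2⟩ := (hS t ht).2
  unfold Phi projPi
  rw [h2, (h1.reeb_spec x).1, one_smul, sub_self]
  rfl

/-- The curve is `(lam, χ_t ∘ ψ)` with `χ` the flow of `c R`. It preserves `lam` because `c R ⌟ d
lam = 0` and `lam(c R) = c` is constant. -/
theorem reebPairs_subset_tangentStrict [T2Space M] [CompactSpace M] {ψ : Diffeo n M}
    (hψ : IsStrictContactPair lam ψ) : reebPairs lam ⊆ tangentStrict lam ψ := by
  rintro _ ⟨c, rfl⟩
  set X : VField n M := fun x => c • reeb lam x with hXdef
  have hlX : (fun y => lam y (X y)) = fun _ => c := funext fun y => by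
    simp [hXdef, (hψ.1.reeb_spec y).1]
  obtain ⟨δ, χ, hδ, hχs, hχ0, hχd, hχp⟩ := exists_flow_pullback_eq hψ.1.1
    (X := X) (hψ.1.isSmooth_reeb.const_smul c) fun x v => by
      have h1 : lam.d x (X x) v = 0 := by
        rw [← OneForm.dBilin_apply, hXdef, map_smul, LinearMap.smul_apply, OneForm.dBilin_apply,
          (hψ.1.reeb_spec x).2, smul_zero]
      have h2 : dFun (n := n) (fun _ : M => c) x v = 0 :=
        DFunLike.congr_fun (mfderiv_const (I := 𝓡 (2 * n + 1)) (I' := 𝓘(ℝ, ℝ)) (x := x)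
          (c := c)) v
      rw [h1, hlX, h2, add_zero]
  refine ⟨δ, fun t => (lam, ψ.trans (χ t)), hδ, ⟨hψ.1.1.contMDiffOn_const δ, ?_⟩,
    Prod.ext rfl (Diffeomorph.ext fun x => hχ0 (ψ x)), fun t ht => ⟨⟨hψ.1, rfl⟩, hψ.1, ?_⟩,
    fun x v => hasDerivAt_const (0 : ℝ) (lam x v), fun x => ?_⟩
  · have h1 : ContMDiff (𝓘(ℝ, ℝ).prod (𝓡 (2 * n + 1))) (𝓘(ℝ, ℝ).prod (𝓡 (2 * n + 1))) ∞
        (fun p : ℝ × M => (p.1, ψ p.2)) :=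
      contMDiff_fst.prodMk (ψ.contMDiff.comp contMDiff_snd)
    exact hχs.comp h1.contMDiffOn fun p hp => ⟨hp.1, mem_univ _⟩
  · rw [pullback_trans, hχp t ht, hψ.2]
  · have h4 : ∀ z, ψ x = z → HasMFDerivAt 𝓘(ℝ, ℝ) (𝓡 (2 * n + 1)) (fun t => χ t (ψ x)) 0
        ((1 : ℝ →L[ℝ] ℝ).smulRight (X z) : ℝ →L[ℝ] Model n) := by
      rintro z rfl; exact hχd (ψ x)
    exact h4 _ (hχ0 (ψ x)).symm

end Main

end StrictContact

end

theorem proposition7p3 {n : ℕ} {M : Type*} [TopologicalSpace M]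
    [ChartedSpace (StrictContact.Model n) M]
    [IsManifold (𝓡 (2 * n + 1)) ∞ M] [T2Space M] [CompactSpace M]
    [MeasurableSpace M] [BorelSpace M]
    (lam : StrictContact.OneForm n M) (hlam : StrictContact.IsNonProjectible lam)
    (ψ : StrictContact.Diffeo n M) (hψ : StrictContact.IsStrictContactPair lam ψ) :
    StrictContact.kerDPi (StrictContact.tangentStrict lam ψ) = StrictContact.reebPairs lam ∧
    StrictContact.kerDPi (StrictContact.kerDPhi lam ψ) = StrictContact.reebPairs lam ∧
    ∀ (A : Finset (OpenPartialHomeomorph M (StrictContact.Model n))) (ε : ℕ → ℝ),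
      StrictContact.IsDarbouxAtlas lam A → (∀ k, 0 < ε k) →
        StrictContact.kerDPi
            (StrictContact.tangentStrict lam ψ ∩ StrictContact.c1epsPairs A ε)
          = StrictContact.reebPairs lam ∧
        StrictContact.kerDPi
            (StrictContact.kerDPhi lam ψ ∩ StrictContact.c1epsPairs A ε)
          = StrictContact.reebPairs lam := by
  have := hlam.1.1.isFiniteMeasure_contactMeasure
  have hT := StrictContact.tangentStrict_subset_kerDPhi (lam := lam) ψ
  have hR := StrictContact.reebPairs_subset_tangentStrict hψ
  -- Only the inclusions of `S` between `reebPairs` and `kerDPhi` matter, so the four equalities are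
  -- instances of one statement.
  have key : ∀ S, StrictContact.reebPairs lam ⊆ S → S ⊆ StrictContact.kerDPhi lam ψ →
      StrictContact.kerDPi S = StrictContact.reebPairs lam := fun S h1 h2 =>
    Subset.antisymm
      (fun u hu => StrictContact.mem_reebPairs_of_mem_kerDPhi hlam hψ (h2 hu.1) hu.2)
      (fun u hu => ⟨h1 hu, by obtain ⟨c, rfl⟩ := hu; rfl⟩)
  refine ⟨key _ hR hT, key _ (hR.trans hT) subset_rfl, fun A ε hA _ => ?_⟩
  have hC := StrictContact.reebPairs_subset_c1epsPairs hlam.1 hA ε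
  exact ⟨key _ (subset_inter hR hC) (inter_subset_left.trans hT),
    key _ (subset_inter (hR.trans hT) hC) inter_subset_left⟩
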